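/- Let $n\ge 1$, and let $R$ be a random integer with values in $\{0,\dots,n-1\}$ (its distribution may depend on $n$). There are $n$ nodes, exactly one of which is informed at the beginning, and time proceeds in synchronous rounds. In each round, every node that may make calls independently (of the other nodes and of the other rounds) samples a fresh value $r$ from $R$ and calls a uniformly random set of $r$ distinct nodes out of all $n$ nodes (as usual for complete graphs, a node may call itself). In the $R$-push protocol only the informed nodes call, and every node called by a node that was informed at the beginning of the round is informed from the end of that round on. In the $R$-push-pull protocol all nodes call, and a node becomes informed in a round if it is called by, or calls, a node that was informed at the beginning of the round. Informed nodes stay informed. The spreading time $T$ is the first $t\ge 0$ such that all $n$ nodes are informed after $t$ rounds. **Theorem.** Assume that $E[R]=\Theta(1)$ and $\operatorname{Var}[R]=O(1)$. 1. For the $R$-push protocol, $E[T]=\log_{1+E[R]} n+\frac1{E[R]}\ln n\pm O(1)$. 2. Let $\ell$ be the smallest nonnegative integer with $\Pr[R=\ell]>0$, and assume that $\Pr[R=\ell]=\Theta(1)$. For the $R$-push-pull protocol, $$E[T]=\begin{cases}\log_{1+2E[R]} n+\dfrac{1}{E[R]-\ln\Pr[R=0]}\,\ln n\pm O(1), & \ell=0,\\[2mm]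 \log_{1+2E[R]} n+\log_{1+\ell}\ln n\pm O(1), & \ell\ge 1.\end{cases}$$ Explicitly: for all $c,C,V,q$ with $c,q>0$ there is a constant $K$ such that for all $n$, all distributions $R$ on $\{0,\dots,n-1\}$ with $c\le E[R]\le C$ and $\operatorname{Var}[R]\le V$ (and $\Pr[R=\ell]\ge q$ in part 2, while in part 1 the constant $K$ depends only on $c,C,V$), and every initially informed node, $E[T]$ is finite and differs from the stated expression (without the $O(1)$) by at most $K$. -/

import Mathlib

open MeasureTheory ProbabilityTheory
open scoped ENNReal

namespace RumorSpreading

/-- `E[R]` for a distribution `R` on `{0, …, n - 1}`. -/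
noncomputable def mean {n : ℕ} (R : PMF (Fin n)) : ℝ :=
  ∫ r, ((r : ℕ) : ℝ) ∂(R.toMeasure)

/-- `Var[R]` for a distribution `R` on `{0, …, n - 1}`. -/
noncomputable def var {n : ℕ} (R : PMF (Fin n)) : ℝ :=
  variance (fun r : Fin n => ((r : ℕ) : ℝ)) R.toMeasure

theorem powersetCard_nonempty {n : ℕ} (r : Fin n) :
    ((Finset.univ : Finset (Fin n)).powersetCard (r : ℕ)).Nonempty := by
  apply Finset.powersetCard_nonempty.2
  simp [r.isLt.le]

/-- The law of the set of nodes called by one node in one round: sample `r` from `R`, then choose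
`r` distinct nodes uniformly at random (on the complete graph, nodes may call themselves). -/
noncomputable def callLaw {n : ℕ} (R : PMF (Fin n)) : PMF (Finset (Fin n)) :=
  R.bind fun r =>
    PMF.uniformOfFinset ((Finset.univ : Finset (Fin n)).powersetCard (r : ℕ))
      (powersetCard_nonempty r)

/-- An outcome of all random choices: `ω (t, v)` is the set of nodes that node `v` calls in
round `t + 1`, provided that it is allowed to make calls. -/
abbrev Calls (n : ℕ) : Type := ℕ × Fin n → Finset (Fin n)

/-- All nodes in all rounds sample their calls independently. -/
noncomputable def callsMeasure {n : ℕ} (R : PMF (Fin n)) : Measure (Calls n) :=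
  Measure.infinitePi fun _ : ℕ × Fin n => (callLaw R).toMeasure

/-- One round of a protocol: from the set of informed nodes at the beginning of the round, and
the sets of nodes called by each node, to the set of informed nodes at the end of the round. -/
abbrev Protocol (n : ℕ) : Type := Finset (Fin n) → (Fin n → Finset (Fin n)) → Finset (Fin n)

/-- Push: each informed node informs all nodes it calls. -/
def push (n : ℕ) : Protocol n := fun I call => I ∪ I.biUnion call

/-- Push-pull: all nodes make calls; in a call between an informed and an uninformed node
(in either direction) the uninformed one becomes informed. -/
def pushPull (n : ℕ) : Protocol n := fun I call =>
  I ∪ I.biUnion call ∪ Finset.univ.filter fun v => (call v ∩ I).Nonempty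

/-- The set of informed nodes after `t` rounds, if only node `s` is informed at the start. -/
def informed {n : ℕ} (P : Protocol n) (s : Fin n) (ω : Calls n) : ℕ → Finset (Fin n)
  | 0 => {s}
  | t + 1 => P (informed P s ω t) fun v => ω (t, v)

/-- The rumor spreading time: the first time at which all nodes are informed (`∞` if there is
no such time). -/
noncomputable def spreadingTime {n : ℕ} (P : Protocol n) (s : Fin n) (ω : Calls n) : ℝ≥0∞ :=
  ⨅ (t : ℕ) (_ : informed P s ω t = Finset.univ), (t : ℝ≥0∞)

/-- The expected rumor spreading time of the `R`-version of a protocol. -/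
noncomputable def expectedTime {n : ℕ} (P : Protocol n) (s : Fin n) (R : PMF (Fin n)) : ℝ≥0∞ :=
  ∫⁻ ω, spreadingTime P s ω ∂(callsMeasure R)

/-- The expected spreading time is finite and equals `x ± K`. -/
def ExpectedTimeWithin {n : ℕ} (P : Protocol n) (s : Fin n) (R : PMF (Fin n)) (x K : ℝ) : Prop :=
  expectedTime P s R ≠ ∞ ∧ |(expectedTime P s R).toReal - x| ≤ K

end RumorSpreading

/-! The informed set is a Markov chain, and E[T] is the sum over t of the probability that some node
is still uninformed after t rounds. Hence a nonnegative potential whose one-round drift is at most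
-1 until everyone is informed bounds E[T] from above by its starting value (`expectedTime_le`). A
potential with drift at least -1 bounds E[T] from below by its starting value minus its final value
(`le_expectedTime`). The proof exhibits such potentials, exact up to O(1), each valid over the whole
process; so no phases are joined and no tail bounds on phase lengths are needed.

Let k be the number of informed nodes and u = n - k. Both protocols enter only through
`RoundBounds`: a node stays uninformed with probability θ k, where 1 - θ k is γ k/n up to O((k/n)²),
and the number of informed nodes after the round has variance O(u k/n). Here γ is E[R] for push and
2 E[R] for push-pull.

Growth: log k / log(1+γ) rises by 1 per round in expectation, up to O(1/k) from fluctuations and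
O(k/n) from collisions. A term proportional to 1/k, which contracts, absorbs the first error; Jensen
makes it unnecessary in the lower bound. A linear term proportional to k/n absorbs the second. Its
expected gain is of order (k/n)(u/n), so it also absorbs errors O(u/n) at the end. This reduces the
problem to finding a function S of u with drift about -1 once more than half of the nodes are
informed (`expectedTime_le_of_shrink`, `le_expectedTime_of_shrink`).

Shrinking: if θ tends to exp(-l), then S is essentially log u / l, with l = E[R] for push and l =
E[R] - ln P[R = 0] for push-pull with ℓ = 0. For push-pull with ℓ ≥ 1, θ is of order (u/n)^ℓ, so a
round multiplies log(n/u) by about 1+ℓ, and S is essentially -log log(n/u) / log(1+ℓ). For the upper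
bounds these functions are modified near u = 0 so that they lie below suitable lines; for the lower
bounds the variance has to be paid for. -/

namespace RumorSpreading

/-- The law of the calls of all nodes in one round. -/
noncomputable def roundLaw {n : ℕ} (R : PMF (Fin n)) : Measure (Fin n → Finset (Fin n)) :=
  Measure.pi fun _ => (callLaw R).toMeasure

instance {n : ℕ} (R : PMF (Fin n)) : IsProbabilityMeasure (roundLaw R) := by
  unfold roundLaw; infer_instance

instance {n : ℕ} (R : PMF (Fin n)) : IsProbabilityMeasure (callsMeasure R) := by
  unfold callsMeasure; infer_instance

/-! ### The chain of informed sets and drift bounds for its absorption time -/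

section chain

variable {n : ℕ} {P : Protocol n} {s : Fin n} {R : PMF (Fin n)}

theorem informed_congr {ω ω' : Calls n} {t : ℕ} (h : ∀ r < t, ∀ v, ω (r, v) = ω' (r, v)) :
    informed P s ω t = informed P s ω' t := by
  induction t with
  | zero => rfl
  | succ t ih =>
    have h1 := ih fun r hr v => h r (by omega) v
    have h2 : (fun v => ω (t, v)) = fun v => ω' (t, v) := funext fun v => h t (by omega) v
    simp only [informed, h1, h2]

theorem measurable_informed (t : ℕ) : Measurable fun ω : Calls n => informed P s ω t := by
  induction t with
  | zero => exact measurable_const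
  | succ t ih =>
    have h : Measurable fun ω : Calls n => (informed P s ω t, fun v => ω (t, v)) :=
      ih.prodMk (measurable_pi_lambda _ fun v => measurable_pi_apply _)
    exact (Measurable.of_discrete
      (f := fun q : Finset (Fin n) × (Fin n → Finset (Fin n)) => P q.1 q.2)).comp h

theorem map_round (t : ℕ) :
    (callsMeasure R).map (fun ω v => ω (t, v)) = roundLaw R := by
  have h := Measure.map_infinitePi_infinitePi_of_inj
    (P := fun _ : ℕ × Fin n => (callLaw R).toMeasure)
    (f := fun v : Fin n => (t, v)) (fun a b hab => by simpa using hab)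
  rw [callsMeasure, roundLaw, ← Measure.infinitePi_eq_pi]
  exact h

theorem indepFun_informed_round (t : ℕ) :
    IndepFun (fun ω : Calls n => informed P s ω t) (fun ω v => ω (t, v)) (callsMeasure R) := by
  classical
  have h0 : iIndepFun (fun (i : ℕ × Fin n) (ω : Calls n) => ω i) (callsMeasure R) :=
    iIndepFun_infinitePi (P := fun _ : ℕ × Fin n => (callLaw R).toMeasure)
      (X := fun _ x => x) fun _ => measurable_id
  have h1 := h0.indepFun_finset (Finset.range t ×ˢ Finset.univ) ({t} ×ˢ Finset.univ)
    (by
      rw [Finset.disjoint_left]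
      rintro ⟨a, b⟩ h h'
      simp at h h'
      omega) fun i => measurable_pi_apply i
  -- The set after `t` rounds depends only on calls with time index below `t`; filling the other
  -- coordinates with `∅` is harmless by `informed_congr`.
  let φ : ((Finset.range t ×ˢ (Finset.univ : Finset (Fin n)) : Finset _) → Finset (Fin n)) →
      Finset (Fin n) := fun x =>
    informed P s (fun i => if h : i ∈ Finset.range t ×ˢ (Finset.univ : Finset (Fin n)) then
      x ⟨i, h⟩ else ∅) t
  let ψ : (({t} ×ˢ (Finset.univ : Finset (Fin n)) : Finset (ℕ × Fin n)) → Finset (Fin n)) →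
      (Fin n → Finset (Fin n)) := fun x v => x ⟨(t, v), by simp⟩
  have h2 := h1.comp (φ := φ) (ψ := ψ) (Measurable.of_discrete) (Measurable.of_discrete)
  convert h2 using 1
  · funext ω
    apply informed_congr
    intro r hr v
    simp [hr]
  · rfl

/-- One step of the Markov chain of informed sets. -/
theorem integral_informed_succ (f : Finset (Fin n) → ℝ) (t : ℕ) :
    ∫ ω, f (informed P s ω (t + 1)) ∂(callsMeasure R) =
      ∫ ω, (∫ c, f (P (informed P s ω t) c) ∂(roundLaw R)) ∂(callsMeasure R) := by
  have hm1 := (measurable_informed (P := P) (s := s) t)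
  have hm2 : Measurable fun (ω : Calls n) v => ω (t, v) :=
    measurable_pi_lambda _ fun v => measurable_pi_apply _
  have h := (indepFun_iff_map_prod_eq_prod_map_map hm1.aemeasurable hm2.aemeasurable).1
    (indepFun_informed_round (P := P) (s := s) (R := R) t)
  rw [map_round] at h
  have : IsProbabilityMeasure ((callsMeasure R).map fun ω => informed P s ω t) :=
    Measure.isProbabilityMeasure_map hm1.aemeasurable
  calc ∫ ω, f (informed P s ω (t + 1)) ∂(callsMeasure R)
      = ∫ q, f (P q.1 q.2) ∂((callsMeasure R).map fun ω => (informed P s ω t, fun v => ω (t, v))) := by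
        rw [integral_map (hm1.prodMk hm2).aemeasurable
          (Measurable.of_discrete).aestronglyMeasurable]
        rfl
    _ = ∫ I, (∫ c, f (P I c) ∂(roundLaw R)) ∂((callsMeasure R).map fun ω => informed P s ω t) := by
        rw [h, integral_prod _ Integrable.of_finite]
    _ = _ := by
        rw [integral_map hm1.aemeasurable (Measurable.of_discrete).aestronglyMeasurable]

theorem integrable_informed (f : Finset (Fin n) → ℝ) (t : ℕ) :
    Integrable (fun ω => f (informed P s ω t)) (callsMeasure R) := by
  have hm1 := (measurable_informed (P := P) (s := s) t)
  have : IsProbabilityMeasure ((callsMeasure R).map fun ω => informed P s ω t) :=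
    Measure.isProbabilityMeasure_map hm1.aemeasurable
  exact (Integrable.of_finite (μ := (callsMeasure R).map fun ω => informed P s ω t)
    (f := f)).comp_measurable hm1

/-- The probability that some node is uninformed after `t` rounds. -/
noncomputable def unfinished (P : Protocol n) (s : Fin n) (R : PMF (Fin n)) (t : ℕ) : ℝ :=
  ∫ ω, (if informed P s ω t = Finset.univ then 0 else 1) ∂(callsMeasure R)

theorem unfinished_nonneg (t : ℕ) : 0 ≤ unfinished P s R t :=
  integral_nonneg fun ω => by dsimp only; split_ifs <;> norm_num

/-- Informed sets only grow, so T counts the times at which somebody is uninformed; both sides are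
infinite together. -/
theorem spreadingTime_eq_tsum (hP : ∀ I c, I ⊆ P I c) (ω : Calls n) :
    spreadingTime P s ω = ∑' t, if informed P s ω t = Finset.univ then 0 else 1 := by
  classical
  have hmono : ∀ {t t'}, t ≤ t' → informed P s ω t = Finset.univ →
      informed P s ω t' = Finset.univ := by
    intro t t' htt h
    induction t', htt using Nat.le_induction with
    | base => exact h
    | succ m _ ih =>
      exact Finset.univ_subset_iff.1 (ih ▸ hP (informed P s ω m) fun v => ω (m, v))
  by_cases hex : ∃ t, informed P s ω t = Finset.univ
  · have h1 := Nat.find_spec hex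
    have h2 : ∀ t, informed P s ω t = Finset.univ ↔ Nat.find hex ≤ t :=
      fun t => ⟨fun h => Nat.find_min' hex h, fun h => hmono h h1⟩
    have h3 : spreadingTime P s ω = (Nat.find hex : ℝ≥0∞) := by
      apply le_antisymm
      · exact iInf₂_le (f := fun (t : ℕ) (_ : informed P s ω t = Finset.univ) => (t : ℝ≥0∞)) _ h1
      · exact le_iInf₂ fun t ht => by exact_mod_cast (h2 t).1 ht
    rw [h3, tsum_eq_sum (s := Finset.range (Nat.find hex))]
    · rw [Finset.sum_congr rfl (g := fun _ => 1)]
      · simp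
      · intro t ht
        rw [if_neg]
        rw [h2]
        simpa using ht
    · intro t ht
      rw [if_pos]
      rw [h2]
      simpa using ht
  · push Not at hex
    have h3 : spreadingTime P s ω = ∞ := by
      simp [spreadingTime, hex]
    simp [h3, hex]

theorem expectedTime_eq_tsum (hP : ∀ I c, I ⊆ P I c) :
    expectedTime P s R = ∑' t, ENNReal.ofReal (unfinished P s R t) := by
  unfold expectedTime
  simp_rw [spreadingTime_eq_tsum hP]
  have hm : ∀ t, Measurable fun ω : Calls n =>
      (if informed P s ω t = Finset.univ then (0 : ℝ≥0∞) else 1) := fun t =>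
    (Measurable.of_discrete (f := fun I : Finset (Fin n) =>
      if I = Finset.univ then (0 : ℝ≥0∞) else 1)).comp (measurable_informed t)
  rw [lintegral_tsum fun t => (hm t).aemeasurable]
  congr 1
  funext t
  rw [unfinished, ofReal_integral_eq_lintegral_ofReal
    (integrable_informed (fun I => if I = Finset.univ then 0 else 1) t)]
  · apply lintegral_congr
    intro ω
    split_ifs <;> simp
  · exact Filter.Eventually.of_forall fun ω => by
      dsimp only; split_ifs <;> simp


theorem mem_informed (hP : ∀ I c, I ⊆ P I c) (ω : Calls n) (t : ℕ) : s ∈ informed P s ω t := by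
  induction t with
  | zero => simp [informed]
  | succ t ih => exact hP _ _ ih

theorem step_univ (hP : ∀ I c, I ⊆ P I c) (c : Fin n → Finset (Fin n)) :
    P Finset.univ c = Finset.univ :=
  Finset.univ_subset_iff.1 (hP _ _)

theorem unfinished_eq_sub (f : Finset (Fin n) → ℝ) (t : ℕ) :
    (∫ ω, f (informed P s ω t) ∂(callsMeasure R)) - unfinished P s R t =
      ∫ ω, (f (informed P s ω t) - if informed P s ω t = Finset.univ then 0 else 1)
        ∂(callsMeasure R) :=
  (integral_sub (integrable_informed f t)
    (integrable_informed (fun I => if I = Finset.univ then 0 else 1) t)).symm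

/-- A nonnegative potential with drift at most `-1` bounds the spreading time from above. -/
theorem sum_unfinished_le {g : Finset (Fin n) → ℝ} (hg : ∀ I, 0 ≤ g I) (hP : ∀ I c, I ⊆ P I c)
    (hd : ∀ I, I.Nonempty → I ≠ Finset.univ → ∫ c, g (P I c) ∂(roundLaw R) ≤ g I - 1) (N : ℕ) :
    ∑ t ∈ Finset.range N, unfinished P s R t ≤ g {s} := by
  have key : ∀ N, ∑ t ∈ Finset.range N, unfinished P s R t +
      ∫ ω, g (informed P s ω N) ∂(callsMeasure R) ≤ g {s} := by
    intro N
    induction N with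
    | zero => simp [informed]
    | succ t ih =>
      have h1 : ∫ ω, g (informed P s ω (t + 1)) ∂(callsMeasure R) ≤
          (∫ ω, g (informed P s ω t) ∂(callsMeasure R)) - unfinished P s R t := by
        rw [integral_informed_succ, unfinished_eq_sub]
        apply integral_mono
        · exact integrable_informed (fun I => ∫ c, g (P I c) ∂(roundLaw R)) t
        · exact integrable_informed (fun I => g I - if I = Finset.univ then 0 else 1) t
        · intro ω
          dsimp only
          split_ifs with h
          · simp [h, step_univ hP]
          · exact hd _ ⟨s, mem_informed hP ω t⟩ h
      rw [Finset.sum_range_succ]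
      linarith
  have h2 : 0 ≤ ∫ ω, g (informed P s ω N) ∂(callsMeasure R) := integral_nonneg fun ω => hg _
  linarith [key N]

/-- A potential with drift at least `-1` bounds the spreading time from below. -/
theorem le_sum_unfinished {h : Finset (Fin n) → ℝ} (hP : ∀ I c, I ⊆ P I c)
    (hd : ∀ I, I.Nonempty → I ≠ Finset.univ → h I - 1 ≤ ∫ c, h (P I c) ∂(roundLaw R)) (N : ℕ) :
    h {s} - ∫ ω, h (informed P s ω N) ∂(callsMeasure R) ≤
      ∑ t ∈ Finset.range N, unfinished P s R t := by
  induction N with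
  | zero => simp [informed]
  | succ t ih =>
    have h1 : (∫ ω, h (informed P s ω t) ∂(callsMeasure R)) - unfinished P s R t ≤
        ∫ ω, h (informed P s ω (t + 1)) ∂(callsMeasure R) := by
      rw [integral_informed_succ, unfinished_eq_sub]
      apply integral_mono
      · exact integrable_informed (fun I => h I - if I = Finset.univ then 0 else 1) t
      · exact integrable_informed (fun I => ∫ c, h (P I c) ∂(roundLaw R)) t
      · intro ω
        dsimp only
        split_ifs with h
        · simp [h, step_univ hP]
        · exact hd _ ⟨s, mem_informed hP ω t⟩ h
    rw [Finset.sum_range_succ]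
    linarith

theorem expectedTime_le {g : Finset (Fin n) → ℝ} (hg : ∀ I, 0 ≤ g I) (hP : ∀ I c, I ⊆ P I c)
    (hd : ∀ I, I.Nonempty → I ≠ Finset.univ → ∫ c, g (P I c) ∂(roundLaw R) ≤ g I - 1) :
    expectedTime P s R ≤ ENNReal.ofReal (g {s}) := by
  rw [expectedTime_eq_tsum hP]
  refine ENNReal.tsum_le_of_sum_range_le fun N => ?_
  rw [← ENNReal.ofReal_sum_of_nonneg fun t _ => unfinished_nonneg t]
  exact ENNReal.ofReal_le_ofReal (sum_unfinished_le hg hP hd N)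

/-- Telescoping leaves the expected potential at time N as a boundary term. There are finitely many
states, so it exceeds the final value by at most a constant times the probability of being
unfinished, which tends to 0 because these probabilities are summable. -/
theorem le_expectedTime {h : Finset (Fin n) → ℝ} (hP : ∀ I c, I ⊆ P I c)
    (hd : ∀ I, I.Nonempty → I ≠ Finset.univ → h I - 1 ≤ ∫ c, h (P I c) ∂(roundLaw R))
    (hfin : expectedTime P s R ≠ ∞) :
    h {s} - h Finset.univ ≤ (expectedTime P s R).toReal := by
  have hsum : Summable (unfinished P s R) := by
    rw [expectedTime_eq_tsum hP] at hfin
    have := ENNReal.summable_toReal hfin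
    simpa only [ENNReal.toReal_ofReal (unfinished_nonneg _)] using this
  have htot : (expectedTime P s R).toReal = ∑' t, unfinished P s R t := by
    rw [expectedTime_eq_tsum hP, ENNReal.tsum_toReal_eq fun t => ENNReal.ofReal_ne_top]
    simp only [ENNReal.toReal_ofReal (unfinished_nonneg _)]
  obtain ⟨M, hM⟩ := (Set.finite_range fun I => |h I - h Finset.univ|).bddAbove
  have hb : ∀ N, ∫ ω, h (informed P s ω N) ∂(callsMeasure R) ≤
      h Finset.univ + M * unfinished P s R N := by
    intro N
    have e : h Finset.univ + M * unfinished P s R N =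
        ∫ ω, (h Finset.univ + M * if informed P s ω N = Finset.univ then 0 else 1)
          ∂(callsMeasure R) := by
      rw [integral_add (integrable_const _)
        (integrable_informed (fun I => M * if I = Finset.univ then 0 else 1) N),
        integral_const_mul, unfinished]
      simp
    rw [e]
    apply integral_mono (integrable_informed h N)
      (integrable_informed (fun I => h Finset.univ + M * if I = Finset.univ then 0 else 1) N)
    intro ω
    dsimp only
    split_ifs with h'
    · simp [h']
    · have := hM ⟨informed P s ω N, rfl⟩
      have := le_abs_self (h (informed P s ω N) - h Finset.univ)
      dsimp only at *
      linarith
  have hle : ∀ N, h {s} - h Finset.univ - M * unfinished P s R N ≤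
      (expectedTime P s R).toReal := by
    intro N
    have h1 := le_sum_unfinished (s := s) hP hd N
    have h2 := hsum.sum_le_tsum (Finset.range N) fun t _ => unfinished_nonneg t
    linarith [hb N]
  have hlim := (hsum.tendsto_atTop_zero.const_mul M).const_sub (h {s} - h Finset.univ)
  rw [mul_zero, sub_zero] at hlim
  exact le_of_tendsto' hlim hle

end chain

/-! ### Ratios of binomial coefficients -/

/-- Sampling without replacement: after r hits in a set of size u, the conditional chance (u - r)/(n
- r) of a further hit is at most u/n. -/
theorem choose_div_choose_le_pow {u n : ℕ} (h : u ≤ n) :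
    ∀ {r : ℕ}, r ≤ n → (u.choose r : ℝ) / n.choose r ≤ ((u : ℝ) / n) ^ r := by
  intro r
  induction r with
  | zero => simp
  | succ r ih =>
    intro hr
    have ih := ih (by omega)
    have hn : (0 : ℝ) < n := by exact_mod_cast (by omega : 0 < n)
    rcases Nat.lt_or_ge u (r + 1) with hu | hu
    · rw [Nat.choose_eq_zero_of_lt hu]
      simp only [CharP.cast_eq_zero, zero_div]
      positivity
    have e1 : ((u.choose (r + 1) : ℕ) : ℝ) = u.choose r * (u - r) / (r + 1) := by
      rw [eq_div_iff (by positivity)]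
      have := Nat.choose_succ_right_eq u r
      rw [← Nat.cast_sub (by omega : r ≤ u)]
      exact_mod_cast this
    have e2 : ((n.choose (r + 1) : ℕ) : ℝ) = n.choose r * (n - r) / (r + 1) := by
      rw [eq_div_iff (by positivity)]
      have := Nat.choose_succ_right_eq n r
      rw [← Nat.cast_sub (by omega : r ≤ n)]
      exact_mod_cast this
    have hnr : (0 : ℝ) < n - r := by
      rw [sub_pos]; exact_mod_cast (by omega : r < n)
    have hc : (0 : ℝ) < n.choose r := by exact_mod_cast Nat.choose_pos (by omega : r ≤ n)
    have e3 : ((u.choose (r + 1) : ℕ) : ℝ) / n.choose (r + 1) =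
        (u.choose r : ℝ) / n.choose r * ((u - r) / (n - r)) := by
      rw [e1, e2]; field_simp
    rw [e3, pow_succ]
    have hur : (r : ℝ) ≤ u := by exact_mod_cast (by omega : r ≤ u)
    have hun : (u : ℝ) ≤ n := by exact_mod_cast h
    apply mul_le_mul ih
    · rw [div_le_div_iff₀ hnr hn]
      nlinarith [(Nat.cast_nonneg r : (0 : ℝ) ≤ r)]
    · exact div_nonneg (by linarith) hnr.le
    · positivity

/-- Both sides are the probability that an r-set and a j-set are disjoint, with either one of them
random. For fixed small j the right side is a polynomial in r, ready to be averaged over R. -/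
theorem choose_sub_div_choose {n j r : ℕ} (hj : j ≤ n) (hr : r ≤ n) :
    ((n - j).choose r : ℝ) / n.choose r = ((n - r).choose j : ℝ) / n.choose j := by
  have h1 : (0 : ℝ) < n.choose r := by exact_mod_cast Nat.choose_pos hr
  have h2 : (0 : ℝ) < n.choose j := by exact_mod_cast Nat.choose_pos hj
  rw [div_eq_div_iff h1.ne' h2.ne']
  norm_cast
  rcases Nat.lt_or_ge n (j + r) with h | h
  · rw [Nat.choose_eq_zero_of_lt (by omega : n - j < r),
      Nat.choose_eq_zero_of_lt (by omega : n - r < j)]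
    simp
  · have a := Nat.choose_mul (n := n) (k := j + r) (s := j) (by omega)
    have b := Nat.choose_mul (n := n) (k := j + r) (s := r) (by omega)
    have e : (j + r).choose j = (j + r).choose r := by
      rw [Nat.choose_symm_add]
    rw [e] at a
    rw [a] at b
    rw [show j + r - j = r by omega, show j + r - r = j by omega] at b
    linarith

/-! ### Calls of a single node -/

section callLaw

variable {n : ℕ} (R : PMF (Fin n))

theorem sum_weights : ∑ r, (R r).toReal = 1 := by
  have h := R.tsum_coe
  rw [tsum_fintype] at h
  rw [← ENNReal.toReal_sum fun r _ => R.apply_ne_top r, h]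
  simp

theorem mean_eq_sum : mean R = ∑ r : Fin n, (R r).toReal * (r : ℕ) := by
  simp [mean, PMF.integral_eq_sum]

theorem var_eq_sum : var R = ∑ r : Fin n, (R r).toReal * (((r : ℕ) : ℝ) - mean R) ^ 2 := by
  rw [var, variance_eq_integral Measurable.of_discrete.aemeasurable, PMF.integral_eq_sum]
  rfl

theorem var_nonneg : 0 ≤ var R := variance_nonneg _ _

theorem mean_nonneg : 0 ≤ mean R := by
  rw [mean_eq_sum]
  exact Finset.sum_nonneg fun r _ => mul_nonneg ENNReal.toReal_nonneg (Nat.cast_nonneg _)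

theorem sum_sq : ∑ r : Fin n, (R r).toReal * ((r : ℕ) : ℝ) ^ 2 = var R + mean R ^ 2 := by
  have h : ∀ r : Fin n, (R r).toReal * (((r : ℕ) : ℝ) - mean R) ^ 2 =
      (R r).toReal * ((r : ℕ) : ℝ) ^ 2 - 2 * mean R * ((R r).toReal * (r : ℕ)) +
        mean R ^ 2 * (R r).toReal := fun r => by ring
  rw [var_eq_sum, Finset.sum_congr rfl fun r _ => h r, Finset.sum_add_distrib,
    Finset.sum_sub_distrib, ← Finset.mul_sum, ← Finset.mul_sum, sum_weights, ← mean_eq_sum]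
  ring

/-- The probability that the calls of a node avoid a given set of `j` nodes. -/
noncomputable def avoid (j : ℕ) : ℝ :=
  ∑ r : Fin n, (R r).toReal * (((n - j).choose r : ℝ) / n.choose r)

theorem callLaw_real_disjoint (J : Finset (Fin n)) :
    (callLaw R).toMeasure.real {S | Disjoint S J} = avoid R J.card := by
  classical
  rw [measureReal_def, callLaw, PMF.toMeasure_bind_apply _ _ _ (MeasurableSet.of_discrete),
    tsum_fintype, ENNReal.toReal_sum, avoid]
  · apply Finset.sum_congr rfl
    intro r _
    rw [ENNReal.toReal_mul, PMF.toMeasure_uniformOfFinset_apply _ _ (MeasurableSet.of_discrete)]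
    congr 1
    rw [ENNReal.toReal_div]
    have h : (Finset.univ.powersetCard (r : ℕ)).filter (fun S => S ∈ {S | Disjoint S J}) =
        (Jᶜ).powersetCard (r : ℕ) := by
      ext S
      simp [Finset.mem_powersetCard, Finset.subset_compl_iff_disjoint_right, and_comm]
    have hc := congrArg Finset.card h
    rw [Finset.card_powersetCard, Finset.card_compl, Fintype.card_fin] at hc
    rw [ENNReal.toReal_natCast, ENNReal.toReal_natCast, Finset.card_powersetCard,
      Finset.card_univ, Fintype.card_fin, ← hc]
    congr!
  · intro r _
    exact ENNReal.mul_ne_top (R.apply_ne_top r) (measure_ne_top _ _)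

theorem avoid_nonneg (j : ℕ) : 0 ≤ avoid R j :=
  Finset.sum_nonneg fun r _ => mul_nonneg ENNReal.toReal_nonneg (by positivity)

theorem avoid_le_one (j : ℕ) : avoid R j ≤ 1 := by
  rw [← sum_weights R, avoid]
  apply Finset.sum_le_sum
  intro r _
  apply mul_le_of_le_one_right ENNReal.toReal_nonneg
  apply div_le_one_of_le₀ _ (Nat.cast_nonneg _)
  exact_mod_cast Nat.choose_le_choose _ (Nat.sub_le n j)

theorem avoid_one (hn : 1 ≤ n) : avoid R 1 = 1 - mean R / n := by
  have hn' : (0 : ℝ) < n := by exact_mod_cast hn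
  have h : ∀ r : Fin n, (R r).toReal * (((n - 1).choose r : ℝ) / n.choose r) =
      (R r).toReal - (R r).toReal * (r : ℕ) / n := by
    intro r
    rw [choose_sub_div_choose hn r.2.le, Nat.choose_one_right, Nat.choose_one_right,
      Nat.cast_sub r.2.le]
    field_simp
  rw [avoid, Finset.sum_congr rfl fun r _ => h r, Finset.sum_sub_distrib, sum_weights,
    ← Finset.sum_div, ← mean_eq_sum]

/-- Missing two given nodes with r calls has probability at most (1 - r/n)². The average of this
square over R is the squared mean plus Var[R]/n². -/
theorem avoid_two_le (hn : 2 ≤ n) : avoid R 2 ≤ avoid R 1 ^ 2 + var R / (n : ℝ) ^ 2 := by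
  have hn' : (0 : ℝ) < n := by exact_mod_cast (by omega : 0 < n)
  have h : ∀ r : Fin n, (R r).toReal * (((n - 2).choose r : ℝ) / n.choose r) ≤
      (R r).toReal - 2 / n * ((R r).toReal * (r : ℕ)) +
        ((R r).toReal * ((r : ℕ) : ℝ) ^ 2) / (n : ℝ) ^ 2 := by
    intro r
    rw [choose_sub_div_choose hn r.2.le]
    have h1 := choose_div_choose_le_pow (u := n - r) (n := n) (Nat.sub_le _ _) hn
    have h2 := mul_le_mul_of_nonneg_left h1 (ENNReal.toReal_nonneg (a := R r))
    refine h2.trans (le_of_eq ?_)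
    rw [Nat.cast_sub r.2.le]
    field_simp
    ring
  rw [avoid_one R (by omega)]
  calc avoid R 2 ≤ _ := Finset.sum_le_sum fun r _ => h r
    _ = _ := by
      rw [Finset.sum_add_distrib, Finset.sum_sub_distrib, sum_weights, ← Finset.sum_div,
        ← Finset.mul_sum, ← mean_eq_sum, sum_sq]
      field_simp
      ring

end callLaw

/-! ### Mean and variance in one round -/

section round

variable {n : ℕ} {P : Protocol n} (R : PMF (Fin n)) {b : Prop} [Decidable b]

/-- Informed nodes push; if `b` holds then uninformed nodes pull. -/
def Spreads (b : Prop) (P : Protocol n) : Prop :=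
  ∀ I c w, w ∈ P I c ↔ w ∈ I ∨ (∃ v ∈ I, w ∈ c v) ∨ (b ∧ ¬ Disjoint (c w) I)

theorem spreads_push : Spreads False (push n) := by
  intro I c w
  simp [push]

theorem spreads_pushPull : Spreads True (pushPull n) := by
  intro I c w
  simp [pushPull, Finset.not_disjoint_iff_nonempty_inter]

omit [Decidable b] in
theorem Spreads.subset (hP : Spreads b P) (I : Finset (Fin n)) (c) : I ⊆ P I c :=
  fun w hw => (hP I c w).2 (Or.inl hw)

/-- The probability that a given uninformed node stays uninformed in a round that starts with
`k` informed nodes. -/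
noncomputable def stay (b : Prop) [Decidable b] (k : ℕ) : ℝ :=
  avoid R 1 ^ k * (if b then avoid R k else 1)

/-- The event is a product box: every node of I must avoid J, and, if there are pulls, every node of
J must avoid I. Since I and J are disjoint, no node is constrained twice. One-element sets J give
the mean and two-element sets the second moment. -/
theorem roundLaw_real_disjoint (hP : Spreads b P) {I J : Finset (Fin n)} (hIJ : Disjoint J I) :
    (roundLaw R).real {c | Disjoint J (P I c)} =
      avoid R J.card ^ I.card * (if b then avoid R I.card else 1) ^ J.card := by
  classical
  have hbox : {c | Disjoint J (P I c)} = Set.univ.pi fun v => if v ∈ I then {S | Disjoint S J}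
      else if v ∈ J ∧ b then {S | Disjoint S I} else Set.univ := by
    ext c
    simp only [Set.mem_ofPred_eq, Set.mem_univ_pi, Finset.disjoint_left, hP I c]
    constructor
    · intro h v
      split_ifs with h1 h2
      · intro w hw hwJ
        exact h hwJ (Or.inr (Or.inl ⟨v, h1, hw⟩))
      · intro w hw hwI
        have := h h2.1
        simp only [h2.2, true_and, not_or, not_not] at this
        exact this.2.2 hw hwI
      · trivial
    · intro h w hwJ
      rintro (h1 | ⟨v, hv, h1⟩ | ⟨hb, h1⟩)
      · exact Finset.disjoint_left.1 hIJ hwJ h1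
      · have := h v
        rw [if_pos hv] at this
        exact this h1 hwJ
      · have := h w
        rw [if_neg (Finset.disjoint_left.1 hIJ hwJ), if_pos ⟨hwJ, hb⟩] at this
        exact h1 fun x hx => (Finset.disjoint_left.1 (show Disjoint (c w) I from Finset.disjoint_left.2 fun a ha => this ha)) hx
  rw [hbox, measureReal_def, roundLaw, Measure.pi_pi, ENNReal.toReal_prod]
  have h2 : ∀ v, ((callLaw R).toMeasure (if v ∈ I then {S | Disjoint S J}
      else if v ∈ J ∧ b then {S | Disjoint S I} else Set.univ)).toReal =
      (if v ∈ I then avoid R J.card else 1) *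
        (if v ∈ J then (if b then avoid R I.card else 1) else 1) := by
    intro v
    by_cases h1 : v ∈ I
    · have h3 : v ∉ J := fun h => Finset.disjoint_left.1 hIJ h h1
      simp only [h1, h3, if_true, if_false, mul_one]
      exact callLaw_real_disjoint R J
    · by_cases h3 : v ∈ J
      · by_cases hb : b
        · simp only [h1, h3, hb, and_self, if_true, if_false, one_mul]
          exact callLaw_real_disjoint R I
        · simp [h1, hb]
      · simp [h1, h3]
  rw [Finset.prod_congr rfl fun v _ => h2 v, Finset.prod_mul_distrib]
  simp [Finset.prod_ite_mem]

omit [Decidable b] in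
theorem sub_card_eq_sum (I : Finset (Fin n)) (hP : Spreads b P) (c) :
    (n : ℝ) - (P I c).card = ∑ w ∈ Iᶜ, if Disjoint {w} (P I c) then 1 else 0 := by
  classical
  rw [Finset.sum_boole]
  have h1 : Iᶜ.filter (fun w => Disjoint {w} (P I c)) = (P I c)ᶜ := by
    ext w
    simp only [Finset.mem_filter, Finset.mem_compl, Finset.disjoint_singleton_left]
    exact ⟨fun h => h.2, fun h => ⟨fun h' => h (hP.subset I c h'), h⟩⟩
  rw [h1, Finset.card_compl, Fintype.card_fin, Nat.cast_sub]
  simpa using Finset.card_le_univ (P I c)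

theorem integral_disjoint (hP : Spreads b P) {I J : Finset (Fin n)} (hIJ : Disjoint J I) :
    ∫ c, (if Disjoint J (P I c) then (1 : ℝ) else 0) ∂(roundLaw R) =
      avoid R J.card ^ I.card * (if b then avoid R I.card else 1) ^ J.card := by
  rw [← roundLaw_real_disjoint R hP hIJ, ← integral_indicator_one MeasurableSet.of_discrete]
  congr 1
  funext c
  by_cases h : Disjoint J (P I c) <;> simp [h]

theorem card_compl_cast (I : Finset (Fin n)) : ((Iᶜ.card : ℕ) : ℝ) = n - I.card := by
  rw [Finset.card_compl, Fintype.card_fin, Nat.cast_sub]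
  simpa using Finset.card_le_univ I

theorem integral_uninformed (hP : Spreads b P) (I : Finset (Fin n)) :
    ∫ c, ((n : ℝ) - (P I c).card) ∂(roundLaw R) = (n - I.card) * stay R b I.card := by
  simp_rw [sub_card_eq_sum I hP]
  rw [integral_finsetSum _ fun _ _ => Integrable.of_finite]
  rw [Finset.sum_congr rfl fun w hw => integral_disjoint R hP
    (Finset.disjoint_singleton_left.2 (Finset.mem_compl.1 hw))]
  simp [stay, card_compl_cast]

theorem pow_sub_pow_le_mul {x y : ℝ} (hx : 0 ≤ x) (hxy : x ≤ y) (hy1 : y ≤ 1) (k : ℕ) :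
    y ^ k - x ^ k ≤ k * (y - x) := by
  induction k with
  | zero => simp
  | succ k ih =>
    have h1 : y ^ (k + 1) - x ^ (k + 1) = y * (y ^ k - x ^ k) + x ^ k * (y - x) := by ring
    have h2 : y * (y ^ k - x ^ k) ≤ k * (y - x) :=
      (mul_le_of_le_one_left (sub_nonneg.2 (pow_le_pow_left₀ hx hxy k)) hy1).trans ih
    have h3 : x ^ k * (y - x) ≤ y - x :=
      mul_le_of_le_one_left (by linarith) (pow_le_one₀ hx (hxy.trans hy1))
    rw [h1]
    push_cast
    linarith

theorem stay_nonneg (k : ℕ) : 0 ≤ stay R b k := by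
  unfold stay
  have := avoid_nonneg R 1
  have := avoid_nonneg R k
  split_ifs <;> positivity

theorem stay_le_one (k : ℕ) : stay R b k ≤ 1 := by
  unfold stay
  apply mul_le_one₀ (pow_le_one₀ (avoid_nonneg R 1) (avoid_le_one R 1))
  · split_ifs
    exacts [avoid_nonneg R k, zero_le_one]
  · split_ifs
    exacts [avoid_le_one R k, le_rfl]

/-- Two uninformed nodes behave almost independently. The pull factor is an exact square; each of
the k pushing nodes adds at most the excess from `avoid_two_le`, since powers on [0,1] grow with
slope at most k. -/
theorem pair_stay_le (hn : 2 ≤ n) (k : ℕ) :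
    avoid R 2 ^ k * (if b then avoid R k else 1) ^ 2 ≤
      stay R b k ^ 2 + k * (var R / (n : ℝ) ^ 2) := by
  set β : ℝ := if b then avoid R k else 1 with hβ
  have hβ0 : 0 ≤ β := by
    rw [hβ]; split_ifs
    exacts [avoid_nonneg R k, zero_le_one]
  have hβ1 : β ≤ 1 := by
    rw [hβ]; split_ifs
    exacts [avoid_le_one R k, le_rfl]
  have h0 : 0 ≤ var R / (n : ℝ) ^ 2 := div_nonneg (var_nonneg R) (by positivity)
  have h1 : avoid R 2 ^ k ≤ (avoid R 1 ^ 2) ^ k + k * (var R / (n : ℝ) ^ 2) := by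
    have h2 := avoid_two_le R hn
    have h3 := avoid_nonneg R 1
    rcases le_total (avoid R 1 ^ 2) (avoid R 2) with h | h
    · have := pow_sub_pow_le_mul (by positivity) h (avoid_le_one R 2) k
      have h4 : (k : ℝ) * (avoid R 2 - avoid R 1 ^ 2) ≤ k * (var R / (n : ℝ) ^ 2) :=
        mul_le_mul_of_nonneg_left (by linarith) (Nat.cast_nonneg k)
      linarith
    · have := pow_le_pow_left₀ (avoid_nonneg R 2) h k
      have : 0 ≤ (k : ℝ) * (var R / (n : ℝ) ^ 2) := by positivity
      linarith
  have h2 : stay R b k ^ 2 = (avoid R 1 ^ 2) ^ k * β ^ 2 := by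
    rw [stay, mul_pow, ← pow_mul, ← pow_mul, mul_comm k 2]
  rw [h2]
  calc _ ≤ ((avoid R 1 ^ 2) ^ k + k * (var R / (n : ℝ) ^ 2)) * β ^ 2 :=
        mul_le_mul_of_nonneg_right h1 (by positivity)
    _ ≤ _ := by
        rw [add_mul]
        exact add_le_add le_rfl
          (mul_le_of_le_one_right (mul_nonneg (Nat.cast_nonneg _) h0) (pow_le_one₀ hβ0 hβ1))

/-- The number of uninformed nodes after a round is concentrated around its mean. -/
theorem integral_uninformed_sub_sq_le (hP : Spreads b P) (I : Finset (Fin n)) :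
    ∫ c, ((n : ℝ) - (P I c).card - (n - I.card) * stay R b I.card) ^ 2 ∂(roundLaw R) ≤
      (n - I.card) * (1 - stay R b I.card) +
        (n - I.card) ^ 2 * (I.card * (var R / (n : ℝ) ^ 2)) := by
  classical
  set u : ℝ := n - I.card with hu
  set θ := stay R b I.card with hθ
  set e : ℝ := I.card * (var R / (n : ℝ) ^ 2) with he
  have hθ0 : 0 ≤ θ := stay_nonneg R _
  have hθ1 : θ ≤ 1 := stay_le_one R _
  have he0 : 0 ≤ e := mul_nonneg (Nat.cast_nonneg _) (div_nonneg (var_nonneg R) (by positivity))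
  have hsq : ∀ c, ((n : ℝ) - (P I c).card) ^ 2 = ∑ w ∈ Iᶜ, ∑ w' ∈ Iᶜ,
      if Disjoint {w, w'} (P I c) then (1 : ℝ) else 0 := by
    intro c
    rw [sub_card_eq_sum I hP, sq, Finset.sum_mul_sum]
    refine Finset.sum_congr rfl fun w _ => Finset.sum_congr rfl fun w' _ => ?_
    simp only [Finset.disjoint_insert_left, Finset.disjoint_singleton_left]
    split_ifs <;> simp_all
  -- On the diagonal the pair is a single node and contributes θ instead of θ²; the excess θ - θ²
  -- yields the binomial part of the variance.
  have hpair : ∀ w ∈ Iᶜ, ∀ w' ∈ Iᶜ,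
      ∫ c, (if Disjoint {w, w'} (P I c) then (1 : ℝ) else 0) ∂(roundLaw R) ≤
        (if w = w' then θ - θ ^ 2 else 0) + (θ ^ 2 + e) := by
    intro w hw w' hw'
    have hd : Disjoint {w, w'} I := by
      simp only [Finset.disjoint_insert_left, Finset.disjoint_singleton_left]
      exact ⟨Finset.mem_compl.1 hw, Finset.mem_compl.1 hw'⟩
    rw [integral_disjoint R hP hd]
    by_cases h1 : w = w'
    · subst h1
      simp only [Finset.pair_eq_singleton, Finset.card_singleton, pow_one, hθ, stay, if_true]
      linarith
    · have hn : 2 ≤ n := by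
        have := Finset.card_le_univ {w, w'}
        rwa [Finset.card_pair h1, Fintype.card_fin] at this
      rw [Finset.card_pair h1, if_neg h1, zero_add]
      exact pair_stay_le R hn I.card
  have hmom : ∫ c, ((n : ℝ) - (P I c).card) ^ 2 ∂(roundLaw R) ≤
      u * (θ - θ ^ 2) + u ^ 2 * (θ ^ 2 + e) := by
    simp_rw [hsq]
    rw [integral_finsetSum _ fun _ _ => Integrable.of_finite]
    rw [Finset.sum_congr rfl fun w _ => integral_finsetSum Iᶜ fun _ _ => Integrable.of_finite]
    refine (Finset.sum_le_sum fun w hw => Finset.sum_le_sum fun w' hw' =>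
      hpair w hw w' hw').trans (le_of_eq ?_)
    simp only [Finset.sum_add_distrib, Finset.sum_const, nsmul_eq_mul, Finset.sum_ite_eq,
      Finset.sum_ite_mem, Finset.inter_self, card_compl_cast]
    ring
  have hexp : ∀ c, ((n : ℝ) - (P I c).card - u * θ) ^ 2 = ((n : ℝ) - (P I c).card) ^ 2 -
      2 * (u * θ) * ((n : ℝ) - (P I c).card) + (u * θ) ^ 2 := fun c => by ring
  simp_rw [hexp]
  rw [integral_add Integrable.of_finite Integrable.of_finite,
    integral_sub Integrable.of_finite Integrable.of_finite, integral_const_mul,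
    integral_uninformed R hP, integral_const]
  simp only [probReal_univ, one_smul]
  have hu0 : 0 ≤ u := by
    rw [hu, ← card_compl_cast]; positivity
  have h5 : u * (θ - θ ^ 2) ≤ u * (1 - θ) := by
    apply mul_le_mul_of_nonneg_left _ hu0
    nlinarith
  rw [← hu, ← hθ]
  nlinarith

end round

/-! ### Estimates for the probability of staying uninformed -/

/-- A union bound, by Pascal's rule: adding one node to the avoided set costs at most the chance r/n
that this node is called. -/
theorem one_sub_mul_le_choose_div_choose {n r : ℕ} (hr : r ≤ n) (hn : 1 ≤ n) :
    ∀ {j : ℕ}, j ≤ n → 1 - (j : ℝ) * r / n ≤ ((n - j).choose r : ℝ) / n.choose r := by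
  have h1 : (0 : ℝ) < n.choose r := by exact_mod_cast Nat.choose_pos hr
  have hn' : (0 : ℝ) < n := by exact_mod_cast hn
  rcases Nat.eq_zero_or_pos r with rfl | hr0
  · simp
  intro j
  induction j with
  | zero => simp [h1.ne']
  | succ j ih =>
    intro hj
    have ih := ih (by omega)
    have e1 : (n - j).choose r = (n - (j + 1)).choose (r - 1) + (n - (j + 1)).choose r := by
      obtain ⟨m, rfl⟩ : ∃ m, n = m + (j + 1) := ⟨n - (j + 1), by omega⟩
      obtain ⟨s, rfl⟩ : ∃ s, r = s + 1 := ⟨r - 1, by omega⟩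
      rw [show m + (j + 1) - j = m + 1 by omega, show m + (j + 1) - (j + 1) = m by omega,
        Nat.choose_succ_succ]
      simp
    have e2 : (n - (j + 1)).choose (r - 1) ≤ (n - 1).choose (r - 1) :=
      Nat.choose_le_choose _ (by omega)
    have e3 : ((n - 1).choose (r - 1) : ℝ) = (r : ℝ) / n * n.choose r := by
      obtain ⟨m, rfl⟩ : ∃ m, n = m + 1 := ⟨n - 1, by omega⟩
      obtain ⟨s, rfl⟩ : ∃ s, r = s + 1 := ⟨r - 1, by omega⟩
      have := Nat.add_one_mul_choose_eq m s
      have h : ((m : ℝ) + 1) * m.choose s = (m + 1).choose (s + 1) * (s + 1) := by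
        exact_mod_cast this
      simp only [Nat.add_sub_cancel]
      push_cast
      rw [div_mul_eq_mul_div, eq_div_iff (by positivity)]
      linarith
    rw [le_div_iff₀ h1] at ih ⊢
    have e1' : ((n - j).choose r : ℝ) = (n - (j + 1)).choose (r - 1) + (n - (j + 1)).choose r := by
      exact_mod_cast e1
    have e2' : ((n - (j + 1)).choose (r - 1) : ℝ) ≤ (r : ℝ) / n * n.choose r := by
      rw [← e3]; exact_mod_cast e2
    have e4 : (1 - ((j + 1 : ℕ) : ℝ) * r / n) * n.choose r =
        (1 - (j : ℝ) * r / n) * n.choose r - (r : ℝ) / n * n.choose r := by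
      push_cast; ring
    linarith

/-- The falling factorial of u is at least (u + 1 - r)^r, and u + 1 - r ≥ u/r; only a factor r^r is
lost. -/
theorem pow_le_choose_div_choose {n u r : ℕ} (hr : 1 ≤ r) (hru : r ≤ u) (hun : u ≤ n) :
    ((u : ℝ) / n / r) ^ r ≤ (u.choose r : ℝ) / n.choose r := by
  have hn : (0 : ℝ) < n := by exact_mod_cast (by omega : 0 < n)
  have hr' : (1 : ℝ) ≤ r := by exact_mod_cast hr
  have hru' : (r : ℝ) ≤ u := by exact_mod_cast hru
  have hc : (0 : ℝ) < n.choose r := by exact_mod_cast Nat.choose_pos (hru.trans hun)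
  have h1 : ((u : ℝ) + 1 - r) ^ r / r.factorial ≤ u.choose r := by
    have := Nat.pow_le_choose (α := ℝ) r u
    rw [Nat.cast_sub (by omega)] at this
    exact_mod_cast this
  have h2 : (n.choose r : ℝ) ≤ (n : ℝ) ^ r / r.factorial := Nat.choose_le_pow_div r n
  have hf : (0 : ℝ) < r.factorial := by exact_mod_cast Nat.factorial_pos r
  have h3 : (u : ℝ) / r ≤ u + 1 - r := by
    rw [div_le_iff₀ (by linarith)]
    nlinarith
  rw [le_div_iff₀ hc]
  calc ((u : ℝ) / n / r) ^ r * n.choose r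
      ≤ ((u : ℝ) / n / r) ^ r * ((n : ℝ) ^ r / r.factorial) := by gcongr
    _ = ((u : ℝ) / r) ^ r / r.factorial := by
        rw [div_right_comm, div_pow _ (n : ℝ)]
        field_simp
    _ ≤ ((u : ℝ) + 1 - r) ^ r / r.factorial := by gcongr
    _ ≤ _ := h1

theorem exp_neg_le {a : ℝ} (ha : 0 ≤ a) : Real.exp (-a) ≤ 1 / (1 + a) := by
  rw [Real.exp_neg, ← one_div]
  exact one_div_le_one_div_of_le (by linarith) (by linarith [Real.add_one_le_exp a])

theorem inv_one_add_le {a : ℝ} (ha : 0 ≤ a) : 1 / (1 + a) ≤ 1 - a + a ^ 2 := by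
  rw [div_le_iff₀ (by linarith)]
  nlinarith [pow_nonneg ha 3]

section stay

variable {n : ℕ} (R : PMF (Fin n)) {b : Prop} [Decidable b]

theorem mean_le : mean R ≤ n - 1 := by
  rw [mean_eq_sum]
  calc ∑ r : Fin n, (R r).toReal * (r : ℕ) ≤ ∑ r : Fin n, (R r).toReal * ((n : ℝ) - 1) := by
        apply Finset.sum_le_sum
        intro r _
        apply mul_le_mul_of_nonneg_left _ ENNReal.toReal_nonneg
        have : ((r : ℕ) : ℝ) + 1 ≤ n := by exact_mod_cast r.2
        linarith
    _ = _ := by rw [← Finset.sum_mul, sum_weights, one_mul]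

theorem two_le_of_mean_pos (h : 0 < mean R) : 2 ≤ n := by
  by_contra hn
  have := mean_le R
  have : (n : ℝ) ≤ 1 := by exact_mod_cast (by omega : n ≤ 1)
  linarith

theorem one_sub_le_avoid (hn : 1 ≤ n) {k : ℕ} (hk : k ≤ n) : 1 - mean R * k / n ≤ avoid R k := by
  rw [avoid, mean_eq_sum]
  have e : 1 - (∑ r : Fin n, (R r).toReal * (r : ℕ)) * k / n =
      ∑ r : Fin n, (R r).toReal * (1 - (k : ℝ) * (r : ℕ) / n) := by
    simp only [mul_sub, Finset.sum_sub_distrib, mul_one, sum_weights, Finset.sum_mul,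
      Finset.sum_div]
    congr 1
    apply Finset.sum_congr rfl
    intro r _
    ring
  rw [e]
  exact Finset.sum_le_sum fun r _ => mul_le_mul_of_nonneg_left
    (one_sub_mul_le_choose_div_choose r.2.le hn hk) ENNReal.toReal_nonneg

theorem avoid_le_sum_pow {k : ℕ} (hk : k ≤ n) :
    avoid R k ≤ ∑ r : Fin n, (R r).toReal * (((n : ℝ) - k) / n) ^ (r : ℕ) := by
  apply Finset.sum_le_sum
  intro r _
  have := choose_div_choose_le_pow (u := n - k) (n := n) (Nat.sub_le _ _) r.2.le
  rw [Nat.cast_sub hk] at this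
  exact mul_le_mul_of_nonneg_left this ENNReal.toReal_nonneg

theorem one_sub_pow_le {x : ℝ} (hx1 : x ≤ 1) (r : ℕ) :
    (1 - x) ^ r ≤ Real.exp (-(r * x)) := by
  have h := Real.add_one_le_exp (-x)
  calc (1 - x) ^ r ≤ Real.exp (-x) ^ r := pow_le_pow_left₀ (by linarith) (by linarith) r
    _ = _ := by rw [← Real.exp_nat_mul]; ring_nf

theorem avoid_le_quadratic (hn : 1 ≤ n) {k : ℕ} (hk : k ≤ n) :
    avoid R k ≤ 1 - mean R * k / n + (var R + mean R ^ 2) * ((k : ℝ) / n) ^ 2 := by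
  have hn' : (0 : ℝ) < n := by exact_mod_cast hn
  have hk' : (k : ℝ) ≤ n := by exact_mod_cast hk
  refine (avoid_le_sum_pow R hk).trans ?_
  have h : ∀ r : Fin n, (R r).toReal * (((n : ℝ) - k) / n) ^ (r : ℕ) ≤
      (R r).toReal - ((R r).toReal * (r : ℕ)) * (k / n) +
        ((R r).toReal * ((r : ℕ) : ℝ) ^ 2) * ((k : ℝ) / n) ^ 2 := by
    intro r
    have e : ((n : ℝ) - k) / n = 1 - k / n := by field_simp
    have hx : 0 ≤ (k : ℝ) / n := by positivity
    have hx1 : (k : ℝ) / n ≤ 1 := div_le_one_of_le₀ hk' hn'.le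
    have h1 := one_sub_pow_le hx1 r
    have h2 : 0 ≤ ((r : ℕ) : ℝ) * (k / n) := by positivity
    have h3 := (h1.trans (exp_neg_le h2)).trans (inv_one_add_le h2)
    rw [e]
    refine (mul_le_mul_of_nonneg_left h3 ENNReal.toReal_nonneg).trans (le_of_eq ?_)
    ring
  refine (Finset.sum_le_sum fun r _ => h r).trans (le_of_eq ?_)
  rw [Finset.sum_add_distrib, Finset.sum_sub_distrib, sum_weights, ← Finset.sum_mul,
    ← Finset.sum_mul, ← mean_eq_sum, sum_sq]
  ring

theorem avoid_one_pow_le (hn : 1 ≤ n) (k : ℕ) :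
    avoid R 1 ^ k ≤ Real.exp (-(mean R * k / n)) := by
  have hn' : (0 : ℝ) < n := by exact_mod_cast hn
  rw [avoid_one R hn]
  have h1 : mean R / n ≤ 1 := div_le_one_of_le₀ (by linarith [mean_le R]) hn'.le
  refine (one_sub_pow_le h1 k).trans (le_of_eq ?_)
  ring_nf

theorem one_sub_le_avoid_one_pow (hn : 1 ≤ n) (k : ℕ) :
    1 - mean R * k / n ≤ avoid R 1 ^ k := by
  have hn' : (0 : ℝ) < n := by exact_mod_cast hn
  have h1 : mean R / n ≤ 1 := div_le_one_of_le₀ (by linarith [mean_le R]) hn'.le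
  rw [avoid_one R hn]
  have := one_add_mul_le_pow (a := -(mean R / n)) (by linarith) k
  refine le_trans (le_of_eq ?_) (this.trans (le_of_eq ?_)) <;> ring

theorem exp_le_avoid_one_pow (hn : 1 ≤ n) {k : ℕ} (hk : k ≤ n) :
    Real.exp (-(mean R + mean R ^ 2 * (1 + mean R) / n)) ≤ avoid R 1 ^ k := by
  have hn' : (0 : ℝ) < n := by exact_mod_cast hn
  have hk' : (k : ℝ) ≤ n := by exact_mod_cast hk
  have hm0 := mean_nonneg R
  have hm := mean_le R
  set μ := mean R
  have hnm : 0 < (n : ℝ) - μ := by linarith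
  rw [avoid_one R hn]
  have hx : 0 < 1 - μ / n := by
    rw [sub_pos, div_lt_one hn']; linarith
  rw [← Real.exp_log (pow_pos hx k), Real.exp_le_exp, Real.log_pow]
  have h1 := Real.one_sub_inv_le_log_of_pos hx
  have e : 1 - (1 - μ / n)⁻¹ = -(μ / (n - μ)) := by
    have : 1 - μ / n = (n - μ) / n := by field_simp
    rw [this, inv_div]
    field_simp
    ring
  rw [e] at h1
  have h2 : (k : ℝ) * (μ / (n - μ)) ≤ n * (μ / (n - μ)) := by gcongr
  -- The difference of the two sides is a nonnegative multiple of n - 1 - μ, and μ ≤ n - 1 because R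
  -- is always below n.
  have h3 : (n : ℝ) * (μ / (n - μ)) ≤ μ + μ ^ 2 * (1 + μ) / n := by
    rw [← sub_nonneg]
    have : μ + μ ^ 2 * (1 + μ) / n - n * (μ / (n - μ)) =
        μ ^ 3 * (n - 1 - μ) / (n * (n - μ)) := by
      field_simp
      ring
    rw [this]
    apply div_nonneg (mul_nonneg (by positivity) (by linarith)) (by positivity)
  have h4 := mul_le_mul_of_nonneg_left h1 (Nat.cast_nonneg k : (0 : ℝ) ≤ k)
  linarith

/-- The expected number of calls between a given informed node and all other nodes. -/
noncomputable def rate (b : Prop) [Decidable b] {n : ℕ} (R : PMF (Fin n)) : ℝ :=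
  if b then 2 * mean R else mean R

theorem one_sub_stay_le (hn : 1 ≤ n) {k : ℕ} (hk : k ≤ n) :
    1 - stay R b k ≤ rate b R * k / n := by
  have h1 := one_sub_le_avoid_one_pow R hn k
  have h2 := one_sub_le_avoid R hn hk
  have h3 : avoid R 1 ^ k ≤ 1 := pow_le_one₀ (avoid_nonneg R 1) (avoid_le_one R 1)
  have h4 := avoid_le_one R k
  unfold stay rate
  split_ifs
  · have e : 2 * mean R * k / n = mean R * k / n + mean R * k / n := by ring
    rw [e]
    nlinarith
  · linarith

/-- With push factor α and pull factor β, 1 - αβ = (1-α) + (1-β) - (1-α)(1-β). Each of the first two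
terms is E[R] k/n up to second order, and the product is of second order. -/
theorem le_one_sub_stay (hn : 1 ≤ n) {k : ℕ} (hk : k ≤ n) :
    rate b R * k / n - (var R + 3 * mean R ^ 2) * ((k : ℝ) / n) ^ 2 ≤ 1 - stay R b k := by
  have h1 := one_sub_le_avoid_one_pow R hn k
  have h2 := one_sub_le_avoid R hn hk
  have ha : 0 ≤ mean R * k / n := by have := mean_nonneg R; positivity
  have h3 := ((avoid_one_pow_le R hn k).trans (exp_neg_le ha)).trans (inv_one_add_le ha)
  have h4 := avoid_le_quadratic R hn hk
  have h5 : avoid R 1 ^ k ≤ 1 := pow_le_one₀ (avoid_nonneg R 1) (avoid_le_one R 1)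
  have h6 := avoid_le_one R k
  have hv := var_nonneg R
  have e2 : mean R * k / n = mean R * (k / n) := by ring
  have hy : 0 ≤ (k : ℝ) / n := by positivity
  unfold stay rate
  split_ifs
  · have e : 2 * mean R * k / n = mean R * k / n + mean R * k / n := by ring
    rw [e]
    have h7 : (1 - avoid R 1 ^ k) * (1 - avoid R k) ≤ (mean R * k / n) * (mean R * k / n) :=
      mul_le_mul (by linarith) (by linarith) (by linarith) ha
    rw [e2] at h1 h2 h3 h4 h7 ⊢
    nlinarith
  · rw [e2] at h1 h2 h3 h4 ⊢
    nlinarith [mul_nonneg hv (sq_nonneg ((k : ℝ) / n)), sq_nonneg (mean R * ((k : ℝ) / n))]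

theorem stay_le_exp (hn : 1 ≤ n) (k : ℕ) :
    stay R b k ≤ Real.exp (-(mean R * k / n)) := by
  refine le_trans ?_ (avoid_one_pow_le R hn k)
  unfold stay
  apply mul_le_of_le_one_right (pow_nonneg (avoid_nonneg R 1) k)
  split_ifs
  exacts [avoid_le_one R k, le_rfl]

/-- The concave function 1 - 1/(1 + c y) lies above its chord on [0,1]. Unlike the second-order
bound this remains useful for large k/n. -/
theorem mul_le_one_sub_stay {c : ℝ} (hc : 0 < c) (hm : c ≤ mean R) (hn : 1 ≤ n) {k : ℕ}
    (hk : k ≤ n) : c / (1 + c) * k / n ≤ 1 - stay R b k := by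
  have hn' : (0 : ℝ) < n := by exact_mod_cast hn
  have hk' : (k : ℝ) ≤ n := by exact_mod_cast hk
  have ha : 0 ≤ mean R * k / n := by have := mean_nonneg R; positivity
  have h1 := (stay_le_exp R (b := b) hn k).trans (exp_neg_le ha)
  have hy : 0 ≤ (k : ℝ) / n := by positivity
  have hy1 : (k : ℝ) / n ≤ 1 := div_le_one_of_le₀ hk' hn'.le
  have h2 : c * (k / n) ≤ mean R * k / n := by
    rw [mul_div_assoc]
    exact mul_le_mul_of_nonneg_right hm hy
  have h3 : 1 / (1 + mean R * k / n) ≤ 1 / (1 + c * (k / n)) :=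
    one_div_le_one_div_of_le (by positivity) (by linarith)
  have h4 : c / (1 + c) * (k / n) ≤ 1 - 1 / (1 + c * (k / n)) := by
    set y := (k : ℝ) / n
    have : 1 - 1 / (1 + c * y) - c / (1 + c) * y =
        c ^ 2 * y * (1 - y) / ((1 + c) * (1 + c * y)) := by
      have : 1 + c * y ≠ 0 := by positivity
      field_simp
      ring
    have h5 : 0 ≤ c ^ 2 * y * (1 - y) / ((1 + c) * (1 + c * y)) :=
      div_nonneg (mul_nonneg (by positivity) (by linarith)) (by positivity)
    linarith
  rw [mul_div_assoc]
  linarith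

theorem weight_eq_zero {ℓ r : Fin n} (hℓ : IsLeast R.support ℓ) (h : r < ℓ) : (R r).toReal = 0 := by
  have : r ∉ R.support := fun hr => absurd (hℓ.2 hr) (not_le.2 h)
  rw [PMF.mem_support_iff, not_not] at this
  simp [this]

theorem le_avoid (ℓ : Fin n) (k : ℕ) :
    (R ℓ).toReal * (((n - k).choose ℓ : ℝ) / n.choose ℓ) ≤ avoid R k :=
  Finset.single_le_sum (f := fun r : Fin n => (R r).toReal * (((n - k).choose r : ℝ) / n.choose r))
    (fun r _ => mul_nonneg ENNReal.toReal_nonneg (by positivity)) (Finset.mem_univ ℓ)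

theorem avoid_le_pow {ℓ : Fin n} (hℓ : IsLeast R.support ℓ) {k : ℕ} (hk : k ≤ n) :
    avoid R k ≤ (((n : ℝ) - k) / n) ^ (ℓ : ℕ) := by
  have hn : (0 : ℝ) < n := by exact_mod_cast ℓ.pos
  have hk' : (k : ℝ) ≤ n := by exact_mod_cast hk
  have h0 : 0 ≤ ((n : ℝ) - k) / n := div_nonneg (by linarith) hn.le
  have h1 : ((n : ℝ) - k) / n ≤ 1 :=
    div_le_one_of_le₀ (by linarith [(Nat.cast_nonneg k : (0 : ℝ) ≤ k)]) hn.le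
  refine (avoid_le_sum_pow R hk).trans ?_
  calc ∑ r : Fin n, (R r).toReal * (((n : ℝ) - k) / n) ^ (r : ℕ)
      ≤ ∑ r : Fin n, (R r).toReal * (((n : ℝ) - k) / n) ^ (ℓ : ℕ) := by
        apply Finset.sum_le_sum
        intro r _
        rcases lt_or_ge r ℓ with h | h
        · simp [weight_eq_zero R hℓ h]
        · exact mul_le_mul_of_nonneg_left (pow_le_pow_of_le_one h0 h1 h) ENNReal.toReal_nonneg
    _ = _ := by rw [← Finset.sum_mul, sum_weights, one_mul]

theorem avoid_le_weight_zero_add {ℓ : Fin n} (hℓ : (ℓ : ℕ) = 0) {k : ℕ} (hk : k ≤ n) :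
    avoid R k ≤ (R ℓ).toReal + ((n : ℝ) - k) / n := by
  have hn : (0 : ℝ) < n := by exact_mod_cast ℓ.pos
  have hk' : (k : ℝ) ≤ n := by exact_mod_cast hk
  have h0 : 0 ≤ ((n : ℝ) - k) / n := div_nonneg (by linarith) hn.le
  have h1 : ((n : ℝ) - k) / n ≤ 1 :=
    div_le_one_of_le₀ (by linarith [(Nat.cast_nonneg k : (0 : ℝ) ≤ k)]) hn.le
  refine (avoid_le_sum_pow R hk).trans ?_
  calc ∑ r : Fin n, (R r).toReal * (((n : ℝ) - k) / n) ^ (r : ℕ)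
      ≤ ∑ r : Fin n, ((if r = ℓ then (R r).toReal else 0) + (R r).toReal * (((n : ℝ) - k) / n)) := by
        apply Finset.sum_le_sum
        intro r _
        split_ifs with h
        · rw [h, hℓ, pow_zero, mul_one]
          exact le_add_of_nonneg_right (mul_nonneg ENNReal.toReal_nonneg h0)
        · rw [zero_add]
          have hr : 1 ≤ (r : ℕ) := by
            by_contra h'
            exact h (Fin.ext (by omega))
          exact mul_le_mul_of_nonneg_left
            ((pow_le_pow_of_le_one h0 h1 hr).trans (by rw [pow_one])) ENNReal.toReal_nonneg
    _ = _ := by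
        rw [Finset.sum_add_distrib, ← Finset.sum_mul, sum_weights, one_mul]
        simp

/-- At least one node is uninformed, so an error of order 1/n can be written as a multiple of (n -
k)/n, the form that the linear term of the potential can absorb. -/
theorem le_stay_false (hn : 1 ≤ n) {k : ℕ} (hk : k < n) {C : ℝ} (hC : mean R ≤ C) :
    Real.exp (-mean R - C ^ 2 * (1 + C) * (((n : ℝ) - k) / n)) ≤ stay R False k := by
  have hm := mean_nonneg R
  have hn' : (0 : ℝ) < n := by exact_mod_cast hn
  have hk' : (k : ℝ) + 1 ≤ n := by exact_mod_cast hk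
  rw [stay, if_neg not_false, mul_one]
  refine le_trans (Real.exp_le_exp.2 ?_) (exp_le_avoid_one_pow R hn hk.le)
  have h1 : mean R ^ 2 * (1 + mean R) ≤ C ^ 2 * (1 + C) := by gcongr
  have h2 : mean R ^ 2 * (1 + mean R) / n ≤ C ^ 2 * (1 + C) * (((n : ℝ) - k) / n) := by
    rw [← mul_div_assoc]
    apply div_le_div_of_nonneg_right _ hn'.le
    have h3 : 0 ≤ C ^ 2 * (1 + C) := le_trans (by positivity) h1
    nlinarith
  linarith

theorem stay_false_le (hn : 1 ≤ n) (k : ℕ) {C : ℝ} (hC : mean R ≤ C) (hk : k ≤ n) :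
    stay R False k ≤ Real.exp (-mean R + C * (((n : ℝ) - k) / n)) := by
  have hn' : (0 : ℝ) < n := by exact_mod_cast hn
  have hk' : (k : ℝ) ≤ n := by exact_mod_cast hk
  refine (stay_le_exp R hn k).trans (Real.exp_le_exp.2 ?_)
  have h0 : 0 ≤ ((n : ℝ) - k) / n := div_nonneg (by linarith) hn'.le
  have h1 := mul_le_mul_of_nonneg_right hC h0
  have h2 : -(mean R * k / n) = -mean R + mean R * (((n : ℝ) - k) / n) := by field_simp; ring
  linarith

theorem stay_true (k : ℕ) : stay R True k = stay R False k * avoid R k := by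
  simp [stay]

theorem le_stay_true {ℓ : Fin n} (hℓ : (ℓ : ℕ) = 0) {k : ℕ} (hk : k < n) {C : ℝ}
    (hC : mean R ≤ C) (hq : 0 < (R ℓ).toReal) :
    Real.exp (-(mean R - Real.log (R ℓ).toReal) - C ^ 2 * (1 + C) * (((n : ℝ) - k) / n)) ≤
      stay R True k := by
  have h1 := le_stay_false R ℓ.pos hk hC
  have h2 := le_avoid R ℓ k
  rw [hℓ] at h2
  simp only [Nat.choose_zero_right, Nat.cast_one, div_one, mul_one] at h2
  rw [stay_true]
  have e : -(mean R - Real.log (R ℓ).toReal) - C ^ 2 * (1 + C) * (((n : ℝ) - k) / n) =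
    (-mean R - C ^ 2 * (1 + C) * (((n : ℝ) - k) / n)) + Real.log (R ℓ).toReal := by ring
  rw [e, Real.exp_add, Real.exp_log hq]
  exact mul_le_mul h1 h2 hq.le (stay_nonneg R k)

/-- A node that makes at least one call misses all informed nodes with probability at most (n -
k)/n. This additive error becomes a factor exp(O((n-k)/n)) because P[R = 0] ≥ q. -/
theorem stay_true_le {ℓ : Fin n} (hℓ : (ℓ : ℕ) = 0) {k : ℕ} (hk : k ≤ n) {C q : ℝ}
    (hC : mean R ≤ C) (hq : 0 < q) (hqR : q ≤ (R ℓ).toReal) :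
    stay R True k ≤
      Real.exp (-(mean R - Real.log (R ℓ).toReal) + (C + 1 / q) * (((n : ℝ) - k) / n)) := by
  have hn' : (0 : ℝ) < n := by exact_mod_cast ℓ.pos
  have hk' : (k : ℝ) ≤ n := by exact_mod_cast hk
  have h0 : 0 ≤ ((n : ℝ) - k) / n := div_nonneg (by linarith) hn'.le
  have hp := hq.trans_le hqR
  have h1 := stay_false_le R ℓ.pos k hC hk
  have h2 := avoid_le_weight_zero_add R hℓ hk
  set x := ((n : ℝ) - k) / n
  set p := (R ℓ).toReal
  have h3 : avoid R k ≤ p * Real.exp (1 / q * x) := by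
    have h4 := Real.add_one_le_exp (1 / q * x)
    have h5 : p * (1 / q * x + 1) ≤ p * Real.exp (1 / q * x) := mul_le_mul_of_nonneg_left h4 hp.le
    have h6 : x ≤ p * (1 / q * x) := by
      rw [← mul_assoc, mul_one_div]
      exact le_mul_of_one_le_left h0 ((one_le_div hq).2 hqR)
    linarith
  rw [stay_true]
  have e : -(mean R - Real.log p) + (C + 1 / q) * x =
      (-mean R + C * x) + (Real.log p + 1 / q * x) := by ring
  rw [e, Real.exp_add, Real.exp_add (Real.log p), Real.exp_log hp]
  exact mul_le_mul h1 h3 (avoid_nonneg R k) (Real.exp_nonneg _)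

theorem stay_true_le_pow {ℓ : Fin n} (hℓ : IsLeast R.support ℓ) {k : ℕ} (hk : k ≤ n) :
    stay R True k ≤ (((n : ℝ) - k) / n) ^ (ℓ : ℕ) := by
  rw [stay_true]
  exact (mul_le_of_le_one_left (avoid_nonneg R k) (stay_le_one R k)).trans (avoid_le_pow R hℓ hk)

/-- Only the event that the node makes exactly ℓ calls is kept in the pull factor, and the push
factor is bounded below by a constant. The condition `ℓ + k ≤ n` ensures that there are ℓ uninformed
nodes to call. -/
theorem pow_le_stay_true {ℓ : Fin n} (hℓ : 1 ≤ (ℓ : ℕ)) {k : ℕ} (hk : k < n) (hkℓ : ℓ + k ≤ n)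
    {C q : ℝ} (hC : mean R ≤ C) (hq : 0 < q) (hqR : q ≤ (R ℓ).toReal) :
    Real.exp (-C - C ^ 2 * (1 + C)) * q / (ℓ : ℕ) ^ (ℓ : ℕ) * (((n : ℝ) - k) / n) ^ (ℓ : ℕ) ≤
      stay R True k := by
  have hn' : (0 : ℝ) < n := by exact_mod_cast ℓ.pos
  have hk' : (k : ℝ) ≤ n := by exact_mod_cast hk.le
  have hm := mean_nonneg R
  have h0 : 0 ≤ ((n : ℝ) - k) / n := div_nonneg (by linarith) hn'.le
  have hx1 : ((n : ℝ) - k) / n ≤ 1 :=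
    div_le_one_of_le₀ (by linarith [(Nat.cast_nonneg k : (0 : ℝ) ≤ k)]) hn'.le
  have h1 := le_stay_false R ℓ.pos hk hC
  have h2 := le_avoid R ℓ k
  have h3 := pow_le_choose_div_choose (n := n) (u := n - k) hℓ (by omega) (Nat.sub_le _ _)
  rw [Nat.cast_sub hk.le] at h3
  have h4 : q * (((n : ℝ) - k) / n / (ℓ : ℕ)) ^ (ℓ : ℕ) ≤ avoid R k :=
    (mul_le_mul hqR h3 (by positivity) (hq.le.trans hqR)).trans h2
  have h5 : Real.exp (-C - C ^ 2 * (1 + C)) ≤ stay R False k := by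
    refine le_trans (Real.exp_le_exp.2 ?_) h1
    have h3 : 0 ≤ C ^ 2 * (1 + C) := by have := hm.trans hC; positivity
    nlinarith
  rw [stay_true]
  have e : Real.exp (-C - C ^ 2 * (1 + C)) * q / (ℓ : ℕ) ^ (ℓ : ℕ) *
      (((n : ℝ) - k) / n) ^ (ℓ : ℕ) =
      Real.exp (-C - C ^ 2 * (1 + C)) * (q * (((n : ℝ) - k) / n / (ℓ : ℕ)) ^ (ℓ : ℕ)) := by
    rw [div_pow _ ((ℓ : ℕ) : ℝ)]; ring
  rw [e]
  exact mul_le_mul h5 h4 (by positivity) (stay_nonneg R k)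

end stay

/-! ### Expectations from pointwise quadratic bounds -/

section moments

variable {Ω : Type*} [MeasurableSpace Ω] [Finite Ω] [MeasurableSingletonClass Ω]
  {μ : Measure Ω} [IsProbabilityMeasure μ] {X : Ω → ℝ} {m : ℝ}

theorem integral_combination (r₀ r₁ r₂ r₃ : ℝ) (f₁ f₂ f₃ f₄ : Ω → ℝ) :
    ∫ ω, (r₀ + r₁ * f₁ ω + r₂ * f₂ ω + r₃ * f₃ ω + f₄ ω) ∂μ =
      r₀ + r₁ * (∫ ω, f₁ ω ∂μ) + r₂ * (∫ ω, f₂ ω ∂μ) + r₃ * (∫ ω, f₃ ω ∂μ) + ∫ ω, f₄ ω ∂μ := by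
  rw [integral_add Integrable.of_finite Integrable.of_finite,
    integral_add Integrable.of_finite Integrable.of_finite,
    integral_add Integrable.of_finite Integrable.of_finite,
    integral_add Integrable.of_finite Integrable.of_finite,
    integral_const_mul, integral_const_mul, integral_const_mul]
  simp

/-- The linear term integrates to zero, so a pointwise quadratic bound around the mean costs only a
multiple of the variance. -/
theorem integral_le_of_quadratic (hm : ∫ ω, X ω ∂μ = m) {f : Ω → ℝ} (α β κ : ℝ)
    (h : ∀ ω, f ω ≤ α + β * (X ω - m) + κ * (X ω - m) ^ 2) :
    ∫ ω, f ω ∂μ ≤ α + κ * ∫ ω, (X ω - m) ^ 2 ∂μ := by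
  have h1 : ∫ ω, f ω ∂μ ≤ ∫ ω, (α + β * (X ω - m) + κ * (X ω - m) ^ 2) ∂μ :=
    integral_mono Integrable.of_finite Integrable.of_finite h
  rw [integral_add Integrable.of_finite Integrable.of_finite,
    integral_add Integrable.of_finite Integrable.of_finite, integral_const_mul,
    integral_const_mul, integral_sub Integrable.of_finite Integrable.of_finite, hm] at h1
  simpa using h1

theorem le_integral_of_quadratic (hm : ∫ ω, X ω ∂μ = m) {f : Ω → ℝ} (α β κ : ℝ)
    (h : ∀ ω, α + β * (X ω - m) - κ * (X ω - m) ^ 2 ≤ f ω) :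
    α - κ * ∫ ω, (X ω - m) ^ 2 ∂μ ≤ ∫ ω, f ω ∂μ := by
  have h1 := integral_le_of_quadratic hm (f := fun ω => -f ω) (-α) (-β) κ fun ω => by
    linarith [h ω]
  rw [integral_neg] at h1
  linarith

theorem integral_neg_log_le {k : ℝ} (hk : 0 < k) (hX : ∀ ω, k ≤ X ω) (hm : ∫ ω, X ω ∂μ = m)
    (hkm : k ≤ m) :
    ∫ ω, -Real.log (X ω) ∂μ ≤ -Real.log m + 1 / (m * k) * ∫ ω, (X ω - m) ^ 2 ∂μ := by
  have hm0 : 0 < m := hk.trans_le hkm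
  apply integral_le_of_quadratic hm _ (-(1 / m))
  intro ω
  have hx : 0 < X ω := hk.trans_le (hX ω)
  have h1 := Real.one_sub_inv_le_log_of_pos (div_pos hx hm0)
  rw [Real.log_div hx.ne' hm0.ne', inv_div] at h1
  have h2 : m / X ω - 1 = -(1 / m) * (X ω - m) + 1 / (m * X ω) * (X ω - m) ^ 2 := by
    field_simp; ring
  have h3 : 1 / (m * X ω) ≤ 1 / (m * k) :=
    one_div_le_one_div_of_le (by positivity) (mul_le_mul_of_nonneg_left (hX ω) hm0.le)
  have h4 := mul_le_mul_of_nonneg_right h3 (sq_nonneg (X ω - m))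
  linarith

theorem integral_log_le (hX : ∀ ω, 0 < X ω) (hm : ∫ ω, X ω ∂μ = m) (hm0 : 0 < m) :
    ∫ ω, Real.log (X ω) ∂μ ≤ Real.log m := by
  have h := integral_le_of_quadratic hm (f := fun ω => Real.log (X ω)) (Real.log m) (1 / m) 0
    fun ω => by
      have h1 := Real.log_le_sub_one_of_pos (div_pos (hX ω) hm0)
      rw [Real.log_div (hX ω).ne' hm0.ne'] at h1
      have : X ω / m - 1 = 1 / m * (X ω - m) := by field_simp
      linarith
  simpa using h

/-- Write 1/X = 1/k - (X - k)/k · 1/X and replace the last 1/X by the linear lower bound 2a/k -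
a²X/k², which is (1 - aX/k)² ≥ 0. With a small, the gain linear in a beats the variance term, which
is quadratic in a. -/
theorem integral_inv_le {k a : ℝ} (hk : 0 < k) (hX : ∀ ω, k ≤ X ω)
    (hm : ∫ ω, X ω ∂μ = m) :
    ∫ ω, 1 / X ω ∂μ ≤ 1 / k * (1 - (2 * a - a ^ 2) * ((m - k) / k) +
      a ^ 2 * ((∫ ω, (X ω - m) ^ 2 ∂μ) + (m - k) ^ 2) / k ^ 2) := by
  have h := integral_le_of_quadratic hm (f := fun ω => 1 / X ω)
    (1 / k * (1 - (2 * a - a ^ 2) * ((m - k) / k) + a ^ 2 * (m - k) ^ 2 / k ^ 2))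
    (1 / k * (-(2 * a - a ^ 2) / k + a ^ 2 * (2 * (m - k)) / k ^ 2)) (1 / k * (a ^ 2 / k ^ 2))
    fun ω => by
      have hx : 0 < X ω := hk.trans_le (hX ω)
      have hz : 0 ≤ X ω - k := by linarith [hX ω]
      have h1 : 2 * a / k - a ^ 2 / k ^ 2 * X ω ≤ 1 / X ω := by
        rw [le_div_iff₀ hx]
        have : (2 * a / k - a ^ 2 / k ^ 2 * X ω) * X ω = 1 - (1 - a / k * X ω) ^ 2 := by ring
        rw [this]
        linarith [sq_nonneg (1 - a / k * X ω)]
      have h2 : 1 / X ω = 1 / k - (X ω - k) / k * (1 / X ω) := by field_simp; ring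
      have h3 := mul_le_mul_of_nonneg_left h1 (div_nonneg hz hk.le)
      rw [h2]
      refine (sub_le_sub_left h3 _).trans (le_of_eq ?_)
      field_simp
      ring
  refine h.trans (le_of_eq ?_)
  ring

end moments

/-! ### The common interface for both protocols -/

/-- Bounds on mean and variance of the number of informed nodes after a round; here `θ k` is the
probability that an uninformed node stays uninformed in a round starting with `k` informed nodes. -/
structure RoundBounds {n : ℕ} (P : Protocol n) (R : PMF (Fin n)) (θ : ℕ → ℝ) (c γ D : ℝ) :
    Prop where
  subset : ∀ I a, I ⊆ P I a
  c_pos : 0 < c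
  c_le_one : c ≤ 1
  c_le : c ≤ γ
  le_D : γ ≤ D
  integral_card : ∀ I : Finset (Fin n), ∫ a, ((P I a).card : ℝ) ∂(roundLaw R) =
    I.card + (n - I.card) * (1 - θ I.card)
  variance_card : ∀ I : Finset (Fin n), ∫ a, (((P I a).card : ℝ) -
    (I.card + (n - I.card) * (1 - θ I.card))) ^ 2 ∂(roundLaw R) ≤ D * (n - I.card) * (I.card / n)
  lower : ∀ k ≤ n, c * (k / n) ≤ 1 - θ k
  upper : ∀ k ≤ n, 1 - θ k ≤ γ * (k / n)
  second : ∀ k ≤ n, γ * (k / n) - D * ((k : ℝ) / n) ^ 2 ≤ 1 - θ k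

/-- The slope `c / (1 + c)` is that of the chord in `mul_le_one_sub_stay`. The last constant
dominates at once the rate (at most 2C), the second-order coefficient V + 3C² and the variance
coefficient V + 2C. -/
theorem Spreads.roundBounds {n : ℕ} {P : Protocol n} {R : PMF (Fin n)} {b : Prop} [Decidable b]
    (hP : Spreads b P) {c C V : ℝ} (hc : 0 < c) (hm : c ≤ mean R) (hC : mean R ≤ C)
    (hV : var R ≤ V) :
    RoundBounds P R (stay R b) (c / (1 + c)) (rate b R) (V + 3 * C ^ 2 + 2 * C) := by
  have hn : 1 ≤ n := (two_le_of_mean_pos R (hc.trans_le hm)).trans' (by norm_num)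
  have hn' : (0 : ℝ) < n := by exact_mod_cast hn
  have hv := (var_nonneg R).trans hV
  have hmC : mean R ^ 2 ≤ C ^ 2 := by
    have := mean_nonneg R; gcongr
  have hrate : rate b R ≤ 2 * C := by
    unfold rate; split_ifs <;> linarith
  have hint : ∀ I : Finset (Fin n), ∫ a, ((P I a).card : ℝ) ∂(roundLaw R) =
      I.card + (n - I.card) * (1 - stay R b I.card) := by
    intro I
    have h := integral_uninformed R hP I
    rw [integral_sub Integrable.of_finite Integrable.of_finite] at h
    simp only [integral_const, probReal_univ, one_smul] at h
    linarith
  refine ⟨hP.subset, by positivity, by rw [div_le_one (by positivity)]; linarith, ?_,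
    by nlinarith, hint, ?_, ?_, ?_, ?_⟩
  · have : c / (1 + c) ≤ c := div_le_self hc.le (by linarith)
    unfold rate; split_ifs <;> linarith
  · intro I
    have hI : I.card ≤ n := by simpa using Finset.card_le_univ I
    have hI' : (I.card : ℝ) ≤ n := by exact_mod_cast hI
    have h := integral_uninformed_sub_sq_le R hP I
    have e : ∀ a, ((n : ℝ) - (P I a).card - (n - I.card) * stay R b I.card) ^ 2 =
        (((P I a).card : ℝ) - (I.card + (n - I.card) * (1 - stay R b I.card))) ^ 2 := fun a => by
      ring
    simp_rw [e] at h
    refine h.trans ?_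
    have h1 := one_sub_stay_le R (b := b) hn hI
    have hu : 0 ≤ (n : ℝ) - I.card := by linarith
    have hy : 0 ≤ (I.card : ℝ) / n := by positivity
    have h2 : ((n : ℝ) - I.card) * (1 - stay R b I.card) ≤
        (n - I.card) * (2 * C * (I.card / n)) := by
      apply mul_le_mul_of_nonneg_left _ hu
      rw [mul_div_assoc] at h1
      exact h1.trans (mul_le_mul_of_nonneg_right hrate hy)
    have h3 : ((n : ℝ) - I.card) ^ 2 * (I.card * (var R / (n : ℝ) ^ 2)) ≤
        (n - I.card) * (V * (I.card / n)) := by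
      have e3 : ((n : ℝ) - I.card) ^ 2 * (I.card * (var R / (n : ℝ) ^ 2)) =
          (n - I.card) * ((n - I.card) / n * var R * (I.card / n)) := by
        field_simp
      rw [e3]
      apply mul_le_mul_of_nonneg_left _ hu
      apply mul_le_mul_of_nonneg_right _ hy
      have h4 : ((n : ℝ) - I.card) / n ≤ 1 :=
        div_le_one_of_le₀ (by linarith [(Nat.cast_nonneg I.card : (0 : ℝ) ≤ I.card)]) hn'.le
      exact (mul_le_of_le_one_left (var_nonneg R) h4).trans hV
    have h4 : 0 ≤ 3 * C ^ 2 * (((n : ℝ) - I.card) * (I.card / n)) := by positivity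
    linarith
  · intro k hk
    have := mul_le_one_sub_stay R (b := b) hc hm hn hk
    rwa [mul_div_assoc] at this
  · intro k hk
    have := one_sub_stay_le R (b := b) hn hk
    rwa [mul_div_assoc] at this
  · intro k hk
    have h1 := le_one_sub_stay R (b := b) hn hk
    rw [mul_div_assoc] at h1
    have h2 : (var R + 3 * mean R ^ 2) * ((k : ℝ) / n) ^ 2 ≤
        (V + 3 * C ^ 2 + 2 * C) * ((k : ℝ) / n) ^ 2 := by
      apply mul_le_mul_of_nonneg_right _ (sq_nonneg _)
      have := (mean_nonneg R).trans hC
      linarith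
    linarith

/-! ### Growth phase: drift of log k and of 1/k -/

namespace RoundBounds

variable {n : ℕ} {P : Protocol n} {R : PMF (Fin n)} {θ : ℕ → ℝ} {c γ D : ℝ}

/-- The mean after the round is k(1+γ) up to a relative error O(k/n), which gives the last term. A
variance of at most Dk in `integral_neg_log_le` gives the term D/k. -/
theorem integral_neg_log_card_le (h : RoundBounds P R θ c γ D) {I : Finset (Fin n)}
    (hI : I.Nonempty) :
    ∫ a, -Real.log ((P I a).card : ℝ) ∂(roundLaw R) ≤
      -Real.log I.card - Real.log (1 + γ) + D * (1 / I.card) + 2 * D * (I.card / n) := by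
  have hk : 1 ≤ I.card := hI.card_pos
  have hkn : I.card ≤ n := by simpa using Finset.card_le_univ I
  have hp := h.lower _ hkn
  have hp2 := h.second _ hkn
  have hv := h.variance_card I
  have hm := h.integral_card I
  have hc := h.c_pos
  have hcγ := h.c_le
  have hγD := h.le_D
  have hX : ∀ a, (I.card : ℝ) ≤ (P I a).card := fun a => by
    exact_mod_cast Finset.card_le_card (h.subset I a)
  have hk1 : (1 : ℝ) ≤ I.card := by exact_mod_cast hk
  have hkn' : (I.card : ℝ) ≤ n := by exact_mod_cast hkn
  have hγ0 : 0 < γ := hc.trans_le hcγ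
  set k : ℝ := (I.card : ℝ) with hkdef
  have hk0 : 0 < k := by linarith
  have hn0 : (0 : ℝ) < n := by linarith
  set p := 1 - θ I.card
  have hp0 : 0 ≤ p := le_trans (by positivity) hp
  set m := k + (n - k) * p with hmdef
  have hkm : k ≤ m := by nlinarith
  have hm0 : 0 < m := by linarith
  have h1 := integral_neg_log_le hk0 hX hm hkm
  have h2 : 1 / (m * k) * ∫ a, (((P I a).card : ℝ) - m) ^ 2 ∂(roundLaw R) ≤ D * (1 / k) := by
    have h3 : D * (n - k) * (k / n) ≤ D * k := by
      have : ((n : ℝ) - k) * (k / n) ≤ k := by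
        rw [mul_div_assoc', div_le_iff₀ hn0]; nlinarith
      have := mul_le_mul_of_nonneg_left this (by linarith : 0 ≤ D)
      linarith
    calc 1 / (m * k) * ∫ a, (((P I a).card : ℝ) - m) ^ 2 ∂(roundLaw R)
        ≤ 1 / (m * k) * (D * k) := mul_le_mul_of_nonneg_left (hv.trans h3) (by positivity)
      _ = D * (1 / m) := by field_simp
      _ ≤ _ := mul_le_mul_of_nonneg_left (one_div_le_one_div_of_le hk0 hkm) (by linarith)
  have hlower : k * (1 + γ) * (1 - 2 * D / (1 + γ) * (k / n)) ≤ m := by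
    have e : k * (1 + γ) * (1 - 2 * D / (1 + γ) * (k / n)) = k * (1 + γ) - 2 * D * k * (k / n) := by
      have : 1 + γ ≠ 0 := by positivity
      field_simp
    have e2 : ((n : ℝ) - k) * (γ * (k / n) - D * (k / n) ^ 2) =
        k * γ - γ * k * (k / n) - D * k * (k / n) + D * k * (k / n) ^ 2 := by
      field_simp; ring
    have h3 := mul_le_mul_of_nonneg_left hp2 (by linarith : 0 ≤ (n : ℝ) - k)
    have h4 : 0 ≤ D * k * (k / n) ^ 2 := by
      have : 0 ≤ D := by linarith
      positivity
    have h5 : γ * k * (k / n) ≤ D * k * (k / n) := by gcongr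
    rw [e]
    linarith
  have h4 : -Real.log m ≤ -Real.log k - Real.log (1 + γ) + 2 * D * (k / n) := by
    have h5 := Real.one_sub_inv_le_log_of_pos (x := m / (k * (1 + γ))) (by positivity)
    rw [Real.log_div hm0.ne' (by positivity), Real.log_mul hk0.ne' (by positivity), inv_div] at h5
    have h6 : k * (1 + γ) / m - 1 ≤ 2 * D * (k / n) := by
      have h7 : k * (1 + γ) - m ≤ 2 * D * (k / n) * k := by
        have e : k * (1 + γ) * (1 - 2 * D / (1 + γ) * (k / n)) =
            k * (1 + γ) - 2 * D * (k / n) * k := by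
          have : 1 + γ ≠ 0 := by positivity
          field_simp
        linarith
      rw [← sub_nonneg]
      have h8 : 2 * D * (k / n) * k ≤ 2 * D * (k / n) * m := by
        have : 0 ≤ D := by linarith
        gcongr
      have : 2 * D * (k / n) - (k * (1 + γ) / m - 1) =
          (2 * D * (k / n) * m - (k * (1 + γ) - m)) / m := by
        field_simp
      rw [this]
      exact div_nonneg (by linarith) hm0.le
    linarith
  linarith

/-- The contraction of 1/k that pays for the fluctuation error D/k of the logarithm; it needs growth
by a constant factor, hence at most half of the nodes informed. -/
theorem integral_inv_card_le (h : RoundBounds P R θ c γ D) {I : Finset (Fin n)}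
    (hI : I.Nonempty) (hIn : 2 * I.card ≤ n) :
    ∫ a, 1 / ((P I a).card : ℝ) ∂(roundLaw R) ≤
      1 / I.card - c ^ 2 / (16 * (D + D ^ 2 + 1)) * (1 / I.card) := by
  have hk : 1 ≤ I.card := hI.card_pos
  have hkn : I.card ≤ n := by simpa using Finset.card_le_univ I
  have hp := h.lower _ hkn
  have hp2 := h.upper _ hkn
  have hv := h.variance_card I
  have hm := h.integral_card I
  have hc := h.c_pos
  have hc1 := h.c_le_one
  have hcγ := h.c_le
  have hγD := h.le_D
  have hX : ∀ a, (I.card : ℝ) ≤ (P I a).card := fun a => by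
    exact_mod_cast Finset.card_le_card (h.subset I a)
  have hk1 : (1 : ℝ) ≤ I.card := by exact_mod_cast hk
  have hkn' : 2 * (I.card : ℝ) ≤ n := by exact_mod_cast hIn
  set k : ℝ := (I.card : ℝ) with hkdef
  have hk0 : 0 < k := by linarith
  have hn0 : (0 : ℝ) < n := by linarith
  have hD0 : 0 < D := by linarith
  set p := 1 - θ I.card
  set m := k + (n - k) * p with hmdef
  set F := D + D ^ 2 + 1 with hF
  have hF0 : 0 < F := by positivity
  -- The maximiser of l c/2 - l² F; the maximum is the gain c²/(16F).
  set l := c / (4 * F) with hl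
  have hl0 : 0 < l := by positivity
  have hl1 : l ≤ 1 := by
    rw [hl, div_le_one (by positivity)]
    nlinarith [sq_nonneg D]
  have h1 := integral_inv_le (a := l) hk0 hX hm
  have hmk1 : c / 2 ≤ (m - k) / k := by
    rw [le_div_iff₀ hk0]
    have h2 : (1 / 2 * n) * (c * (k / n)) ≤ (n - k) * p :=
      mul_le_mul (by linarith) hp (by positivity) (by linarith)
    have e : (1 / 2 * n) * (c * (k / n)) = c / 2 * k := by field_simp
    linarith
  have hmk2 : m - k ≤ D * k := by
    have h2 : (n - k) * p ≤ n * (D * (k / n)) := by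
      apply mul_le_mul (by linarith) _ (le_trans (by positivity) hp) hn0.le
      exact hp2.trans (mul_le_mul_of_nonneg_right hγD (by positivity))
    have e : n * (D * (k / n)) = D * k := by field_simp
    linarith
  have hmk0 : 0 ≤ m - k := by
    have : 0 ≤ (m - k) / k := le_trans (by positivity) hmk1
    by_contra hneg
    have := div_neg_of_neg_of_pos (not_le.1 hneg) hk0
    linarith
  have hvk : ∫ a, (((P I a).card : ℝ) - m) ^ 2 ∂(roundLaw R) ≤ D * k ^ 2 := by
    refine hv.trans ?_
    have h2 : ((n : ℝ) - k) * (k / n) ≤ k ^ 2 := by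
      have h3 : ((n : ℝ) - k) * (k / n) ≤ k := by
        rw [mul_div_assoc', div_le_iff₀ hn0]; nlinarith
      nlinarith
    have := mul_le_mul_of_nonneg_left h2 hD0.le
    linarith
  have h3 : l ^ 2 * ((∫ a, (((P I a).card : ℝ) - m) ^ 2 ∂(roundLaw R)) + (m - k) ^ 2) / k ^ 2 ≤
      l ^ 2 * F := by
    rw [div_le_iff₀ (by positivity), mul_assoc]
    apply mul_le_mul_of_nonneg_left _ (by positivity)
    have h4 : (m - k) ^ 2 ≤ (D * k) ^ 2 := pow_le_pow_left₀ hmk0 hmk2 2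
    have h5 : F * k ^ 2 = D * k ^ 2 + (D * k) ^ 2 + k ^ 2 := by rw [hF]; ring
    linarith [sq_nonneg k]
  have h4 : l * (c / 2) ≤ (2 * l - l ^ 2) * ((m - k) / k) := by
    have hll : l ^ 2 ≤ l := by
      rw [sq]; exact mul_le_of_le_one_left hl0.le hl1
    exact mul_le_mul (by linarith) hmk1 (by positivity) (by linarith)
  have h5 : l * (c / 2) - l ^ 2 * F = c ^ 2 / (16 * F) := by
    rw [hl]; field_simp; ring
  have h6 : 1 / k * (1 - (2 * l - l ^ 2) * ((m - k) / k) + l ^ 2 *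
      ((∫ a, (((P I a).card : ℝ) - m) ^ 2 ∂(roundLaw R)) + (m - k) ^ 2) / k ^ 2) ≤
      1 / k * (1 - c ^ 2 / (16 * F)) :=
    mul_le_mul_of_nonneg_left (by linarith) (by positivity)
  linarith

end RoundBounds

/-! ### Potentials for the whole process, given one for the shrinking phase -/

namespace RoundBounds

variable {n : ℕ} {P : Protocol n} {R : PMF (Fin n)} {θ : ℕ → ℝ} {c γ D : ℝ}

theorem D_pos (h : RoundBounds P R θ c γ D) : 0 < D :=
  h.c_pos.trans_le (h.c_le.trans h.le_D)

theorem gamma_pos (h : RoundBounds P R θ c γ D) : 0 < γ := h.c_pos.trans_le h.c_le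

theorem card_le (I : Finset (Fin n)) : I.card ≤ n := by simpa using Finset.card_le_univ I

theorem card_mono (h : RoundBounds P R θ c γ D) (I : Finset (Fin n)) (a) :
    (I.card : ℝ) ≤ (P I a).card := by exact_mod_cast Finset.card_le_card (h.subset I a)

theorem log_pos (h : RoundBounds P R θ c γ D) : 0 < Real.log (1 + c) :=
  Real.log_pos (by linarith [h.c_pos])

theorem log_le (h : RoundBounds P R θ c γ D) : Real.log (1 + c) ≤ Real.log (1 + γ) :=
  Real.log_le_log (by linarith [h.c_pos]) (by linarith [h.c_le])

/-- The expected relative gain in a round is at least proportional to the number of informed nodes,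
and to the number of uninformed nodes. -/
theorem gain_le_integral_card (h : RoundBounds P R θ c γ D) (I : Finset (Fin n)) :
    I.card + c * (n - I.card) * (I.card / n) ≤ ∫ a, ((P I a).card : ℝ) ∂(roundLaw R) := by
  have hkn : (I.card : ℝ) ≤ n := by exact_mod_cast card_le I
  rw [h.integral_card I]
  have := mul_le_mul_of_nonneg_left (h.lower _ (card_le I)) (by linarith : 0 ≤ (n : ℝ) - I.card)
  linarith

/-- While at most half of the nodes are informed, S merely does not increase and the logarithm
supplies the drift -1. Afterwards the logarithmic and reciprocal terms merely do not increase and S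
supplies it. The linear term pays all errors proportional to k/n or (n-k)/n. -/
theorem expectedTime_le_of_shrink (h : RoundBounds P R θ c γ D) (s : Fin n) {S : ℕ → ℝ} {E : ℝ}
    (hE : 0 ≤ E) (hS : ∀ u, 0 ≤ S u) (hmono : ∀ u v, u ≤ v → v ≤ n → S u ≤ S v)
    (hd : ∀ I : Finset (Fin n), n < 2 * I.card → I.card < n →
      ∫ a, S (n - (P I a).card) ∂(roundLaw R) ≤
        S (n - I.card) - 1 + E * (((n : ℝ) - I.card) / n)) :
    expectedTime P s R ≤ ENNReal.ofReal (Real.log n / Real.log (1 + γ) + S (n - 1) +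
      (16 * (D + D ^ 2 + 1) * D / c ^ 2 / Real.log (1 + c) +
        (4 * D / (c * Real.log (1 + c)) + 2 * E / c))) := by
  have hc := h.c_pos
  have hD := h.D_pos
  have hγ := h.gamma_pos
  have hn : 0 < n := s.pos
  have hn' : (0 : ℝ) < n := by exact_mod_cast hn
  have hG0 := h.log_pos
  have hGG := h.log_le
  set G := Real.log (1 + γ) with hGdef
  set G₀ := Real.log (1 + c) with hG₀def
  have hG : 0 < G := hG0.trans_le hGG
  -- Chosen so that the expected decrease of A/k is at least D/k.
  set A := 16 * (D + D ^ 2 + 1) * D / c ^ 2 with hA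
  have hA0 : 0 ≤ A := by positivity
  -- Chosen so that B c/2 = 2D/G₀ + E. With y = k/n the linear term gains at least B c y (1 - y),
  -- and one of y, 1 - y is at least 1/2.
  set B := 4 * D / (c * G₀) + 2 * E / c with hB
  have hB0 : 0 ≤ B := by positivity
  let g : Finset (Fin n) → ℝ := fun I => (Real.log n / G + B) + 1 / G * -Real.log (I.card : ℝ) +
    A / G * (1 / (I.card : ℝ)) + -(B / n) * (I.card : ℝ) + S (n - I.card)
  have hg0 : ∀ I, 0 ≤ g I := by
    intro I
    have hkn : (I.card : ℝ) ≤ n := by exact_mod_cast card_le I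
    have h1 : Real.log (I.card : ℝ) ≤ Real.log n := by
      rcases Nat.eq_zero_or_pos I.card with h0 | h0
      -- The empty set is included here, with log 0 = 0 and 1/0 = 0.
      · rw [h0]; simpa using Real.log_natCast_nonneg n
      · exact Real.log_le_log (by exact_mod_cast h0) hkn
    have h2 : 1 / G * Real.log (I.card : ℝ) ≤ Real.log n / G := by
      rw [div_mul_eq_mul_div, one_mul]
      exact div_le_div_of_nonneg_right h1 hG.le
    have h3 : B / n * (I.card : ℝ) ≤ B := by
      rw [div_mul_eq_mul_div, div_le_iff₀ hn']
      exact mul_le_mul_of_nonneg_left hkn hB0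
    have h4 : 0 ≤ A / G * (1 / (I.card : ℝ)) := by positivity
    have := hS (n - I.card)
    dsimp only [g]
    linarith
  have hdrift : ∀ I : Finset (Fin n), I.Nonempty → I ≠ Finset.univ →
      ∫ a, g (P I a) ∂(roundLaw R) ≤ g I - 1 := by
    intro I hI hIu
    have hkn : I.card < n := by
      have := Finset.card_lt_card (Finset.ssubset_univ_iff.2 hIu)
      simpa using this
    have hk : (1 : ℝ) ≤ I.card := by exact_mod_cast hI.card_pos
    have hkn' : (I.card : ℝ) < n := by exact_mod_cast hkn
    have hX := h.card_mono I
    have hgain := h.gain_le_integral_card I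
    have hSmono : ∫ a, S (n - (P I a).card) ∂(roundLaw R) ≤ S (n - I.card) := by
      have : ∫ a, S (n - (P I a).card) ∂(roundLaw R) ≤ ∫ a, S (n - I.card) ∂(roundLaw R) :=
        integral_mono Integrable.of_finite Integrable.of_finite fun a =>
          hmono _ _ (Nat.sub_le_sub_left (Finset.card_le_card (h.subset I a)) n) (Nat.sub_le _ _)
      simpa using this
    have hlin := integral_combination (μ := roundLaw R) (Real.log n / G + B) (1 / G) (A / G) (-(B / n))
      (fun a => -Real.log ((P I a).card : ℝ)) (fun a => 1 / ((P I a).card : ℝ))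
      (fun a => ((P I a).card : ℝ)) (fun a => S (n - (P I a).card))
    dsimp only [g]
    rw [hlin]
    set y : ℝ := (I.card : ℝ) / n with hy
    have hy0 : 0 < y := by positivity
    have hBX : -(B / n) * (∫ a, ((P I a).card : ℝ) ∂(roundLaw R)) ≤
        -(B / n) * I.card - B * c * ((1 - y) * y) := by
      have h1 := mul_le_mul_of_nonneg_left hgain (by positivity : 0 ≤ B / n)
      have e : B / n * (I.card + c * (n - I.card) * y) =
          B / n * I.card + B * c * ((1 - y) * y) := by
        rw [hy]; field_simp
      linarith
    rcases le_or_gt (2 * I.card) n with hhalf | hhalf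
    · have h1 := h.integral_neg_log_card_le hI
      have h2 := h.integral_inv_card_le hI hhalf
      have hhalf' : 2 * (I.card : ℝ) ≤ n := by exact_mod_cast hhalf
      have hy2 : y ≤ 1 / 2 := by rw [hy, div_le_iff₀ hn']; linarith
      have e1 : A * (c ^ 2 / (16 * (D + D ^ 2 + 1))) = D := by
        rw [hA]; field_simp
      have h3 := mul_le_mul_of_nonneg_left h1 (by positivity : 0 ≤ 1 / G)
      have h4 := mul_le_mul_of_nonneg_left h2 (by positivity : 0 ≤ A / G)
      have e2 : 1 / G * (-Real.log I.card - G + D * (1 / I.card) + 2 * D * y) +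
          A / G * (1 / I.card - c ^ 2 / (16 * (D + D ^ 2 + 1)) * (1 / I.card)) =
          1 / G * -Real.log I.card + A / G * (1 / I.card) - 1 + 2 * D / G * y +
          (D - A * (c ^ 2 / (16 * (D + D ^ 2 + 1)))) * (1 / G * (1 / I.card)) := by
        have : G ≠ 0 := hG.ne'
        field_simp
        ring
      rw [e1, sub_self, zero_mul, add_zero] at e2
      have h5 : 2 * D / G * y ≤ 2 * D / G₀ * y := by gcongr
      have h6 : 2 * D / G₀ * y ≤ B * c * ((1 - y) * y) := by
        have h7 : 2 * D / G₀ ≤ B * c * (1 / 2) := by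
          have : B * c * (1 / 2) = 2 * D / G₀ + E := by
            rw [hB]; field_simp; ring
          linarith
        have h8 : B * c * (1 / 2) ≤ B * c * (1 - y) :=
          mul_le_mul_of_nonneg_left (by linarith) (by positivity)
        have := mul_le_mul_of_nonneg_right (h7.trans h8) hy0.le
        linarith
      linarith
    · have hhalf' : (n : ℝ) < 2 * I.card := by exact_mod_cast hhalf
      have hy2 : 1 / 2 ≤ y := by rw [hy, le_div_iff₀ hn']; linarith
      have hy1 : y ≤ 1 := by rw [hy, div_le_iff₀ hn']; linarith
      have h1 : ∫ a, -Real.log ((P I a).card : ℝ) ∂(roundLaw R) ≤ -Real.log I.card := by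
        have : ∫ a, -Real.log ((P I a).card : ℝ) ∂(roundLaw R) ≤
            ∫ a, -Real.log (I.card : ℝ) ∂(roundLaw R) :=
          integral_mono Integrable.of_finite Integrable.of_finite fun a =>
            neg_le_neg (Real.log_le_log (by linarith) (hX a))
        simpa using this
      have h2 : ∫ a, 1 / ((P I a).card : ℝ) ∂(roundLaw R) ≤ 1 / I.card := by
        have : ∫ a, 1 / ((P I a).card : ℝ) ∂(roundLaw R) ≤
            ∫ a, 1 / (I.card : ℝ) ∂(roundLaw R) :=
          integral_mono Integrable.of_finite Integrable.of_finite fun a =>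
            one_div_le_one_div_of_le (by linarith) (hX a)
        simpa using this
      have h3 := mul_le_mul_of_nonneg_left h1 (by positivity : 0 ≤ 1 / G)
      have h4 := mul_le_mul_of_nonneg_left h2 (by positivity : 0 ≤ A / G)
      have h5 := hd I hhalf hkn
      have e1 : ((n : ℝ) - I.card) / n = 1 - y := by rw [hy]; field_simp
      rw [e1] at h5
      have h6 : E * (1 - y) ≤ B * c * ((1 - y) * y) := by
        have h7 : E ≤ B * c * (1 / 2) := by
          have : B * c * (1 / 2) = 2 * D / G₀ + E := by
            rw [hB]; field_simp; ring
          have : 0 ≤ 2 * D / G₀ := by positivity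
          linarith
        have h8 : B * c * (1 / 2) ≤ B * c * y :=
          mul_le_mul_of_nonneg_left (by linarith) (by positivity)
        have := mul_le_mul_of_nonneg_right (h7.trans h8) (by linarith : 0 ≤ 1 - y)
        linarith
      linarith
  refine (expectedTime_le hg0 h.subset hdrift).trans (ENNReal.ofReal_le_ofReal ?_)
  dsimp only [g]
  simp only [Finset.card_singleton, Nat.cast_one, Real.log_one, neg_zero, mul_zero, div_one,
    mul_one, add_zero]
  have h1 : A / G ≤ A / G₀ := by gcongr
  have h2 : 0 ≤ B / n := by positivity
  linarith

/-- By Jensen the logarithmic term rises by at most 1 in a growth round, so no 1/k correction is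
needed. In the shrinking phase it still rises by at most D(1-y)/G with y = k/n, which is charged to
the linear term. -/
theorem le_expectedTime_of_shrink (h : RoundBounds P R θ c γ D) (s : Fin n) {S : ℕ → ℝ} {E : ℝ}
    (hE : 0 ≤ E) (hfin : expectedTime P s R ≠ ∞)
    (hd₁ : ∀ I : Finset (Fin n), I.Nonempty → 2 * I.card ≤ n →
      S (n - I.card) - E * ((I.card : ℝ) / n) ≤ ∫ a, S (n - (P I a).card) ∂(roundLaw R))
    (hd₂ : ∀ I : Finset (Fin n), n < 2 * I.card → I.card < n →
      S (n - I.card) - 1 - E * (((n : ℝ) - I.card) / n) ≤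
        ∫ a, S (n - (P I a).card) ∂(roundLaw R)) :
    Real.log n / Real.log (1 + γ) + S (n - 1) - S 0 - 2 * (E + D / Real.log (1 + c)) / c ≤
      (expectedTime P s R).toReal := by
  have hc := h.c_pos
  have hD := h.D_pos
  have hγ := h.gamma_pos
  have hn : 0 < n := s.pos
  have hn' : (0 : ℝ) < n := by exact_mod_cast hn
  have hG0 := h.log_pos
  have hGG := h.log_le
  set G := Real.log (1 + γ) with hGdef
  set G₀ := Real.log (1 + c) with hG₀def
  have hG : 0 < G := hG0.trans_le hGG
  set B := 2 * (E + D / G₀) / c with hB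
  have hB0 : 0 ≤ B := by positivity
  have hBc : B * c * (1 / 2) = E + D / G₀ := by rw [hB]; field_simp
  -- The zero summands give the potential the shape expected by `integral_combination`.
  let g : Finset (Fin n) → ℝ := fun I => 0 + -(1 / G) * Real.log (I.card : ℝ) +
    0 * 0 + (B / n) * (I.card : ℝ) + S (n - I.card)
  have hdrift : ∀ I : Finset (Fin n), I.Nonempty → I ≠ Finset.univ →
      g I - 1 ≤ ∫ a, g (P I a) ∂(roundLaw R) := by
    intro I hI hIu
    have hkn : I.card < n := by
      have := Finset.card_lt_card (Finset.ssubset_univ_iff.2 hIu)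
      simpa using this
    have hk : (1 : ℝ) ≤ I.card := by exact_mod_cast hI.card_pos
    have hkn' : (I.card : ℝ) < n := by exact_mod_cast hkn
    have hX := h.card_mono I
    have hgain := h.gain_le_integral_card I
    have hlin := integral_combination (μ := roundLaw R) 0 (-(1 / G)) 0 (B / n)
      (fun a => Real.log ((P I a).card : ℝ)) (fun a => 0)
      (fun a => ((P I a).card : ℝ)) (fun a => S (n - (P I a).card))
    dsimp only [g]
    rw [hlin]
    have hm := h.integral_card I
    have hup := h.upper _ hkn.le
    set y : ℝ := (I.card : ℝ) / n with hy
    have hy0 : 0 < y := by positivity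
    have hy1 : y ≤ 1 := by rw [hy, div_le_iff₀ hn']; linarith
    have hBX : B / n * I.card + B * c * ((1 - y) * y) ≤
        B / n * (∫ a, ((P I a).card : ℝ) ∂(roundLaw R)) := by
      have h1 := mul_le_mul_of_nonneg_left hgain (by positivity : 0 ≤ B / n)
      have e : B / n * (I.card + c * (n - I.card) * y) =
          B / n * I.card + B * c * ((1 - y) * y) := by
        rw [hy]; field_simp
      linarith
    have hm1 : ∫ a, ((P I a).card : ℝ) ∂(roundLaw R) ≤ I.card * (1 + γ * (1 - y)) := by
      rw [hm]
      have h1 := mul_le_mul_of_nonneg_left hup (by linarith : 0 ≤ (n : ℝ) - I.card)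
      have e : ((n : ℝ) - I.card) * (γ * y) = I.card * (γ * (1 - y)) := by
        rw [hy]; field_simp
      linarith
    have hy1' : 0 ≤ γ * (1 - y) := mul_nonneg hγ.le (by linarith)
    have hlog : ∫ a, Real.log ((P I a).card : ℝ) ∂(roundLaw R) ≤
        Real.log I.card + Real.log (1 + γ * (1 - y)) := by
      have h0 : (0 : ℝ) < I.card + c * (n - I.card) * y := by
        have : 0 ≤ c * (n - I.card) * y :=
          mul_nonneg (mul_nonneg hc.le (by linarith)) hy0.le
        linarith
      refine (integral_log_le (fun a => lt_of_lt_of_le (by linarith) (hX a)) rfl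
        (h0.trans_le hgain)).trans ?_
      rw [← Real.log_mul (by linarith) (by linarith)]
      exact Real.log_le_log (h0.trans_le hgain) hm1
    rcases le_or_gt (2 * I.card) n with hhalf | hhalf
    · have hhalf' : 2 * (I.card : ℝ) ≤ n := by exact_mod_cast hhalf
      have hy2 : y ≤ 1 / 2 := by rw [hy, div_le_iff₀ hn']; linarith
      have h1 : Real.log (1 + γ * (1 - y)) ≤ G :=
        Real.log_le_log (by linarith) (by nlinarith)
      have h2 := mul_le_mul_of_nonneg_left (hlog.trans (add_le_add le_rfl h1))
        (by positivity : 0 ≤ 1 / G)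
      have e2 : 1 / G * (Real.log I.card + G) = 1 / G * Real.log I.card + 1 := by
        field_simp
      have h3 := hd₁ I hI hhalf
      have h6 : E * y ≤ B * c * ((1 - y) * y) := by
        have h7 : E ≤ B * c * (1 / 2) := by
          have : 0 ≤ D / G₀ := by positivity
          linarith
        have h8 : B * c * (1 / 2) ≤ B * c * (1 - y) :=
          mul_le_mul_of_nonneg_left (by linarith) (by positivity)
        have := mul_le_mul_of_nonneg_right (h7.trans h8) hy0.le
        linarith
      linarith
    · have hhalf' : (n : ℝ) < 2 * I.card := by exact_mod_cast hhalf
      have hy2 : 1 / 2 ≤ y := by rw [hy, le_div_iff₀ hn']; linarith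
      have h1 : Real.log (1 + γ * (1 - y)) ≤ D * (1 - y) := by
        have h2 := Real.log_le_sub_one_of_pos (by linarith : 0 < 1 + γ * (1 - y))
        have h3 := mul_le_mul_of_nonneg_right h.le_D (by linarith : 0 ≤ 1 - y)
        linarith
      have h2 := mul_le_mul_of_nonneg_left (hlog.trans (add_le_add le_rfl h1))
        (by positivity : 0 ≤ 1 / G)
      have e2 : 1 / G * (Real.log I.card + D * (1 - y)) =
          1 / G * Real.log I.card + D / G * (1 - y) := by
        field_simp
      have h3 := hd₂ I hhalf hkn
      have e1 : ((n : ℝ) - I.card) / n = 1 - y := by rw [hy]; field_simp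
      rw [e1] at h3
      have h5 : D / G * (1 - y) ≤ D / G₀ * (1 - y) := by
        apply mul_le_mul_of_nonneg_right _ (by linarith)
        gcongr
      have h6 : (E + D / G₀) * (1 - y) ≤ B * c * ((1 - y) * y) := by
        have h8 : B * c * (1 / 2) ≤ B * c * y :=
          mul_le_mul_of_nonneg_left (by linarith) (by positivity)
        have := mul_le_mul_of_nonneg_right (hBc.symm.le.trans h8) (by linarith : 0 ≤ 1 - y)
        linarith
      linarith
  have hfinal := le_expectedTime (s := s) h.subset hdrift hfin
  dsimp only [g] at hfinal
  simp only [Finset.card_singleton, Nat.cast_one, Real.log_one, mul_zero, mul_one, add_zero,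
    zero_add, Finset.card_univ, Fintype.card_fin, Nat.sub_self] at hfinal
  have e1 : B / n * n = B := by field_simp
  have e2 : 1 / G * Real.log n = Real.log n / G := by ring
  have h2 : 0 ≤ B / n := by positivity
  linarith

end RoundBounds

/-! ### Shrinking by a constant factor per round -/

/-- For x ≥ m/2 this is Taylor's bound. For smaller x, the inequality log y = 2 log √y ≥ 2 - 2/√y
with y = x/m and x ≥ 1 gives at least 2 - 2√m, and (y-1)² ≥ 1/4 accounts for the factor 8√m. -/
theorem log_ge_of_one_le {x m : ℝ} (hx : 1 ≤ x) (hm : 1 ≤ m) :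
    Real.log m + 1 / m * (x - m) - 8 / (m * √m) * (x - m) ^ 2 ≤ Real.log x := by
  have hx0 : 0 < x := by linarith
  have hm0 : 0 < m := by linarith
  set y := x / m with hy
  have hy0 : 0 < y := by positivity
  have hs : 1 ≤ √m := by rw [Real.one_le_sqrt]; exact hm
  have hs2 : √m * √m = m := Real.mul_self_sqrt hm0.le
  have e1 : Real.log y = Real.log x - Real.log m := Real.log_div hx0.ne' hm0.ne'
  have e2 : 1 / m * (x - m) = y - 1 := by rw [hy]; field_simp
  have e3 : 8 / (m * √m) * (x - m) ^ 2 = 8 * √m * (y - 1) ^ 2 := by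
    have e4 : x - m = m * (y - 1) := by rw [hy]; field_simp
    rw [e4]
    nth_rewrite 1 3 [← hs2]
    have : √m ≠ 0 := by positivity
    field_simp
  rw [e2, e3]
  suffices h : (y - 1) - 8 * √m * (y - 1) ^ 2 ≤ Real.log y by linarith
  rcases le_or_gt (1 / 2) y with h | h
  · have h1 := Real.one_sub_inv_le_log_of_pos hy0
    have h2 : 1 - y⁻¹ = (y - 1) - (1 / y) * (y - 1) ^ 2 := by field_simp; ring
    have h3 : 1 / y ≤ 2 := by rw [div_le_iff₀ hy0]; linarith
    have h4 : 1 / y * (y - 1) ^ 2 ≤ 8 * √m * (y - 1) ^ 2 :=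
      mul_le_mul_of_nonneg_right (by linarith) (sq_nonneg _)
    linarith
  · have h1 := Real.one_sub_inv_le_log_of_pos (Real.sqrt_pos.2 hy0)
    rw [Real.log_sqrt hy0.le] at h1
    have h2 : (√y)⁻¹ ≤ √m := by
      rw [inv_le_iff_one_le_mul₀ (Real.sqrt_pos.2 hy0), ← Real.sqrt_mul hm0.le, hy,
        mul_div_cancel₀ _ hm0.ne', Real.one_le_sqrt]
      exact hx
    have h3 : 1 / 4 ≤ (y - 1) ^ 2 := by nlinarith
    have h4 : 8 * √m * (1 / 4) ≤ 8 * √m * (y - 1) ^ 2 :=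
      mul_le_mul_of_nonneg_left h3 (by positivity)
    linarith

theorem inv_sqrt_ge {x m : ℝ} (hx : 0 < x) (hm : 0 < m) :
    1 / √m - 1 / (2 * m * √m) * (x - m) ≤ 1 / √x := by
  have hs := Real.sqrt_pos.2 hx
  have ht := Real.sqrt_pos.2 hm
  have es := Real.mul_self_sqrt hx.le
  have et := Real.mul_self_sqrt hm.le
  set s := √x
  set t := √m
  rw [← es, ← et, ← sub_nonneg]
  have : 1 / s - (1 / t - 1 / (2 * (t * t) * t) * (s * s - t * t)) =
      (s - t) ^ 2 * (s + 2 * t) / (2 * t ^ 3 * s) := by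
    field_simp; ring
  rw [this]
  positivity

namespace RoundBounds

variable {n : ℕ} {P : Protocol n} {R : PMF (Fin n)} {θ : ℕ → ℝ} {c γ D : ℝ}

theorem cast_sub_card (I : Finset (Fin n)) : ((n - I.card : ℕ) : ℝ) = n - I.card :=
  Nat.cast_sub (card_le I)

theorem integral_sub_card (h : RoundBounds P R θ c γ D) (I : Finset (Fin n)) :
    ∫ a, ((n - (P I a).card : ℕ) : ℝ) ∂(roundLaw R) = (n - I.card) * θ I.card := by
  simp_rw [cast_sub_card]
  rw [integral_sub Integrable.of_finite Integrable.of_finite, h.integral_card I]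
  simp only [integral_const, probReal_univ, one_smul]
  ring

theorem variance_sub_card (h : RoundBounds P R θ c γ D) (I : Finset (Fin n)) :
    ∫ a, (((n - (P I a).card : ℕ) : ℝ) - (n - I.card) * θ I.card) ^ 2 ∂(roundLaw R) ≤
      D * (n - I.card) * (I.card / n) := by
  refine le_trans (le_of_eq ?_) (h.variance_card I)
  congr 1
  funext a
  rw [cast_sub_card]
  ring

/-- If the number of uninformed nodes finally shrinks by a constant factor in expectation, then
the spreading time is at most logarithmic. -/
theorem expectedTime_le_of_exp (h : RoundBounds P R θ c γ D) (s : Fin n) {l l₀ Λ M : ℝ}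
    (hl₀ : 0 < l₀) (hl : l₀ ≤ l) (hΛ : l ≤ Λ) (hM : 0 ≤ M)
    (hθ : ∀ k < n, θ k ≤ Real.exp (-l + M * (((n : ℝ) - k) / n))) :
    expectedTime P s R ≤ ENNReal.ofReal (Real.log n / Real.log (1 + γ) + 1 / l * Real.log n +
      (Real.exp Λ / l₀ + (16 * (D + D ^ 2 + 1) * D / c ^ 2 / Real.log (1 + c) +
        (4 * D / (c * Real.log (1 + c)) + 2 * (M / l₀) / c)))) := by
  have hn : 0 < n := s.pos
  have hn' : (0 : ℝ) < n := by exact_mod_cast hn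
  have hl' : 0 < l := hl₀.trans_le hl
  set L := Real.exp l with hL
  have hL1 : 1 ≤ L := Real.one_le_exp hl'.le
  -- The jump from 0 to L/l at u = 1 puts l S below the tangent of L + log at any y ≥ 1, and below
  -- the line with slope L through the origin, which serves for y < 1. Here y is an upper bound for
  -- the mean number of uninformed nodes.
  let S : ℕ → ℝ := fun u => if u = 0 then 0 else 1 / l * (L + Real.log u)
  have hS0 : ∀ u, 0 ≤ S u := by
    intro u
    dsimp only [S]
    split_ifs
    · exact le_rfl
    · have := Real.log_natCast_nonneg u
      have : 0 < L := by linarith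
      positivity
  have hmono : ∀ u v, u ≤ v → v ≤ n → S u ≤ S v := by
    intro u v huv _
    rcases Nat.eq_zero_or_pos u with hu | hu
    · rw [show S u = 0 from if_pos hu]; exact hS0 v
    · dsimp only [S]
      rw [if_neg hu.ne', if_neg (hu.trans_le huv).ne']
      have : Real.log (u : ℝ) ≤ Real.log v :=
        Real.log_le_log (by exact_mod_cast hu) (by exact_mod_cast huv)
      gcongr
  have hE : 0 ≤ M / l₀ := by positivity
  refine (h.expectedTime_le_of_shrink s hE hS0 hmono ?_).trans (ENNReal.ofReal_le_ofReal ?_)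
  · intro I _ hI
    have hk : (I.card : ℝ) + 1 ≤ n := by exact_mod_cast hI
    have hu1 : (1 : ℝ) ≤ n - I.card := by linarith
    have hm := h.integral_sub_card I
    have hθ' := hθ _ hI
    set u : ℝ := n - I.card with hu
    set x := M * (u / n) with hx
    have hx0 : 0 ≤ x := by positivity
    set y := u * Real.exp (-l + x) with hy
    have hy0 : 0 < y := by positivity
    have hmy : ∫ a, ((n - (P I a).card : ℕ) : ℝ) ∂(roundLaw R) ≤ y := by
      rw [hm]; exact mul_le_mul_of_nonneg_left hθ' (by linarith)
    have hlogy : Real.log y = Real.log u - l + x := by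
      rw [hy, Real.log_mul (by linarith) (Real.exp_ne_zero _), Real.log_exp]; ring
    have key : l * ∫ a, S (n - (P I a).card) ∂(roundLaw R) ≤ L + Real.log y := by
      rcases le_or_gt 1 y with hy1 | hy1
      · have hp : ∀ a, l * S (n - (P I a).card) ≤
            L + Real.log y - 1 + 1 / y * ((n - (P I a).card : ℕ) : ℝ) := by
          intro a
          dsimp only [S]
          split_ifs with h0
          · rw [h0]
            have := Real.log_nonneg hy1
            simp only [mul_zero, Nat.cast_zero]
            linarith
          · have hz : (0 : ℝ) < ((n - (P I a).card : ℕ) : ℝ) := by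
              exact_mod_cast Nat.pos_of_ne_zero h0
            have h1 := Real.log_le_sub_one_of_pos (div_pos hz hy0)
            rw [Real.log_div hz.ne' hy0.ne'] at h1
            rw [← mul_assoc, mul_one_div_cancel hl'.ne', one_mul, one_div, inv_mul_eq_div]
            linarith
        have h1 := integral_mono (μ := roundLaw R) Integrable.of_finite Integrable.of_finite hp
        rw [integral_add Integrable.of_finite Integrable.of_finite, integral_const_mul,
          integral_const_mul] at h1
        simp only [integral_const, probReal_univ, one_smul] at h1
        have h2 := mul_le_mul_of_nonneg_left hmy (by positivity : 0 ≤ 1 / y)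
        rw [one_div_mul_cancel hy0.ne'] at h2
        linarith
      · have hp : ∀ a, l * S (n - (P I a).card) ≤ L * ((n - (P I a).card : ℕ) : ℝ) := by
          intro a
          dsimp only [S]
          split_ifs with h0
          · simp [h0]
          · have hz : (1 : ℝ) ≤ ((n - (P I a).card : ℕ) : ℝ) := by
              exact_mod_cast Nat.pos_of_ne_zero h0
            have h1 := Real.log_le_sub_one_of_pos (by linarith : (0 : ℝ) < ((n - (P I a).card : ℕ) : ℝ))
            rw [← mul_assoc, mul_one_div_cancel hl'.ne', one_mul]
            nlinarith
        have h1 := integral_mono (μ := roundLaw R) Integrable.of_finite Integrable.of_finite hp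
        rw [integral_const_mul, integral_const_mul] at h1
        have h2 := mul_le_mul_of_nonneg_left hmy (by linarith : 0 ≤ L)
        -- It remains that L y ≤ L + log y. This uses L = exp l together with y ≥ exp(-l), which
        -- holds since at least one node was uninformed.
        have h3 := Real.one_sub_inv_le_log_of_pos hy0
        have h4 : y⁻¹ ≤ L := by
          rw [hL, ← neg_neg l, Real.exp_neg (-l)]
          apply inv_anti₀ (Real.exp_pos _)
          calc Real.exp (-l) ≤ Real.exp (-l + x) := Real.exp_le_exp.2 (by linarith)
            _ ≤ y := le_mul_of_one_le_left (Real.exp_nonneg _) hu1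
        have h5 : y⁻¹ - 1 ≤ L * (1 - y) := by
          have e : y⁻¹ - 1 = y⁻¹ * (1 - y) := by field_simp
          rw [e]
          exact mul_le_mul_of_nonneg_right h4 (by linarith)
        linarith
    have e1 : S (n - I.card) = 1 / l * (L + Real.log u) := by
      dsimp only [S]
      rw [if_neg (by omega), cast_sub_card]
    rw [e1]
    have h1 : ∫ a, S (n - (P I a).card) ∂(roundLaw R) ≤ 1 / l * (L + Real.log y) := by
      rw [div_mul_eq_mul_div, one_mul, le_div_iff₀ hl']
      linarith
    refine h1.trans ?_
    rw [hlogy]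
    have h2 : 1 / l * x ≤ M / l₀ * (u / n) := by
      rw [hx, ← mul_assoc, one_div_mul_eq_div]
      have : M / l ≤ M / l₀ := by gcongr
      gcongr
    have h3 : 1 / l * (L + (Real.log u - l + x)) = 1 / l * (L + Real.log u) - 1 + 1 / l * x := by
      field_simp; ring
    linarith
  · have h1 : S (n - 1) ≤ 1 / l * Real.log n + Real.exp Λ / l₀ := by
      have h2 : S (n - 1) ≤ S n := hmono _ _ (Nat.sub_le _ _) le_rfl
      have h3 : S n = 1 / l * (L + Real.log n) := if_neg hn.ne'
      have h4 : 1 / l * L ≤ Real.exp Λ / l₀ := by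
        rw [one_div_mul_eq_div]
        have : L ≤ Real.exp Λ := Real.exp_le_exp.2 hΛ
        gcongr
      linarith
    linarith

/-- By concavity, fluctuations lower the expected logarithm, here by at most O(1/√m), where m - 1 is
the mean number of uninformed nodes. The correction A/√(u+1) increases by a constant fraction in
every shrinking round and pays for this. The shift u + 1 keeps the potential controlled at u = 0. -/
theorem le_expectedTime_of_exp (h : RoundBounds P R θ c γ D) (s : Fin n) {l l₀ Λ M : ℝ}
    (hl₀ : 0 < l₀) (hl : l₀ ≤ l) (hΛ : l ≤ Λ) (hM : 0 ≤ M) (hfin : expectedTime P s R ≠ ∞)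
    (hθ : ∀ k < n, Real.exp (-l - M * (((n : ℝ) - k) / n)) ≤ θ k) :
    Real.log n / Real.log (1 + γ) + 1 / l * Real.log n -
      (64 * D / (Real.exp (-Λ - M) * c) / l₀ +
      2 * ((18 * D / Real.exp (-Λ - M) + M) / l₀ + D / Real.log (1 + c)) / c) ≤
      (expectedTime P s R).toReal := by
  have hn : 0 < n := s.pos
  have hn' : (0 : ℝ) < n := by exact_mod_cast hn
  have hl' : 0 < l := hl₀.trans_le hl
  have hc := h.c_pos
  have hc1 := h.c_le_one
  have hD := h.D_pos
  set c₀ := Real.exp (-Λ - M) with hc₀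
  have hc₀0 : 0 < c₀ := Real.exp_pos _
  have hc₀1 : c₀ ≤ 1 := Real.exp_le_one_iff.2 (by linarith)
  -- Solves A c/8 = 8D/c₀: a fraction c/8 of A/√m is gained and 8D/(c₀√m) is lost.
  set A := 64 * D / (c₀ * c) with hA
  have hA0 : 0 < A := by positivity
  let S : ℕ → ℝ := fun u => 1 / l * (Real.log (u + 1) + A * (1 / √((u : ℝ) + 1)))
  have hE : 0 ≤ (18 * D / c₀ + M) / l₀ := by positivity
  have key : ∀ I : Finset (Fin n), I.card < n →
      1 / l * (Real.log ((n - I.card) * θ I.card + 1) +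
        A * (1 / √((n - I.card) * θ I.card + 1)) -
        8 / (((n - I.card) * θ I.card + 1) * √((n - I.card) * θ I.card + 1)) *
        (D * (n - I.card) * (I.card / n))) ≤ ∫ a, S (n - (P I a).card) ∂(roundLaw R) := by
    intro I hI
    have hk : (I.card : ℝ) + 1 ≤ n := by exact_mod_cast hI
    have hθ0 : 0 ≤ θ I.card := (Real.exp_nonneg _).trans (hθ _ hI)
    set m := (n - I.card) * θ I.card + 1 with hm
    have hm1 : 1 ≤ m := by
      have : 0 ≤ (n - I.card) * θ I.card := mul_nonneg (by linarith) hθ0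
      linarith
    have hm0 : 0 < m := by linarith
    have h1 := le_integral_of_quadratic (μ := roundLaw R) (h.integral_sub_card I)
      (f := fun a => Real.log (((n - (P I a).card : ℕ) : ℝ) + 1) +
        A * (1 / √(((n - (P I a).card : ℕ) : ℝ) + 1)))
      (Real.log m + A * (1 / √m)) (1 / m - A * (1 / (2 * m * √m))) (8 / (m * √m))
      (by
        intro a
        have hx : (1 : ℝ) ≤ ((n - (P I a).card : ℕ) : ℝ) + 1 := by
          linarith [(Nat.cast_nonneg (n - (P I a).card) : (0 : ℝ) ≤ _)]
        have h2 := log_ge_of_one_le hx hm1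
        have h3 := mul_le_mul_of_nonneg_left
          (inv_sqrt_ge (by linarith : 0 < ((n - (P I a).card : ℕ) : ℝ) + 1) hm0) hA0.le
        have e : ((n - (P I a).card : ℕ) : ℝ) + 1 - m =
            ((n - (P I a).card : ℕ) : ℝ) - (n - I.card) * θ I.card := by rw [hm]; ring
        rw [e] at h2 h3
        linarith)
    have h2 := mul_le_mul_of_nonneg_left (h.variance_sub_card I)
      (by positivity : 0 ≤ 8 / (m * √m))
    dsimp only [S]
    rw [integral_const_mul]
    exact mul_le_mul_of_nonneg_left (by linarith) (by positivity)
  have hSI : ∀ I : Finset (Fin n), S (n - I.card) =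
      1 / l * (Real.log (n - I.card + 1) + A * (1 / √((n : ℝ) - I.card + 1))) := by
    intro I
    dsimp only [S]
    rw [cast_sub_card]
  have hlow : ∀ I : Finset (Fin n), I.card < n → c₀ ≤ θ I.card := by
    intro I hI
    refine le_trans (Real.exp_le_exp.2 ?_) (hθ _ hI)
    have : ((n : ℝ) - I.card) / n ≤ 1 :=
      div_le_one_of_le₀ (by linarith [(Nat.cast_nonneg I.card : (0 : ℝ) ≤ I.card)]) hn'.le
    nlinarith
  have hfinal := h.le_expectedTime_of_shrink s (S := S) hE hfin ?_ ?_
  · refine le_trans ?_ hfinal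
    have e1 : ((n - 1 : ℕ) : ℝ) + 1 = n := by
      rw [Nat.cast_sub (by omega)]; simp
    have h1 : 1 / l * Real.log n ≤ S (n - 1) := by
      dsimp only [S]
      rw [e1]
      apply mul_le_mul_of_nonneg_left _ (by positivity)
      have : 0 ≤ A * (1 / √(n : ℝ)) := by positivity
      linarith
    have h2 : S 0 ≤ A / l₀ := by
      dsimp only [S]
      simp only [Nat.cast_zero, zero_add, Real.log_one, Real.sqrt_one, div_one, mul_one]
      rw [one_div_mul_eq_div]
      gcongr
    linarith
  · intro I hI hhalf
    have hk : (1 : ℝ) ≤ I.card := by exact_mod_cast hI.card_pos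
    have hkn : I.card < n := by have := hI.card_pos; omega
    have hhalf' : 2 * (I.card : ℝ) ≤ n := by exact_mod_cast hhalf
    refine le_trans ?_ (key I hkn)
    rw [hSI]
    have hlowI := hlow I hkn
    have hup := h.upper _ hkn.le
    have hγD := h.le_D
    have hlo := h.lower _ hkn.le
    set k : ℝ := (I.card : ℝ)
    set u := (n : ℝ) - k with hu
    set t := θ I.card
    set m := u * t + 1 with hm
    have hu0 : 0 ≤ u := by rw [hu]; linarith
    have hy0 : 0 ≤ k / n := by positivity
    have ht1 : t ≤ 1 := by
      have : 0 ≤ c * (k / n) := by positivity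
      linarith
    have hm1 : 1 ≤ m := by
      have : 0 ≤ u * t := mul_nonneg hu0 (hc₀0.le.trans hlowI)
      linarith
    have hm0 : 0 < m := by linarith
    have hmw : m ≤ u + 1 := by nlinarith
    have hmn : c₀ * n / 2 ≤ m := by
      have : u * c₀ ≤ u * t := mul_le_mul_of_nonneg_left hlowI hu0
      nlinarith
    have h1 : Real.log (u + 1) - 2 * D / c₀ * (k / n) ≤ Real.log m := by
      have h2 := Real.one_sub_inv_le_log_of_pos (div_pos hm0 (by linarith : 0 < u + 1))
      rw [Real.log_div hm0.ne' (by linarith), inv_div] at h2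
      have h3 : (u + 1) / m - 1 ≤ 2 * D / c₀ * (k / n) := by
        have e : (u + 1) / m - 1 = u * (1 - t) / m := by
          rw [div_sub_one hm0.ne', hm]; ring_nf
        rw [e, div_le_iff₀ hm0]
        have h4 : u * (1 - t) ≤ n * (D * (k / n)) := by
          apply mul_le_mul (by rw [hu]; linarith) _ (by linarith) hn'.le
          exact hup.trans (mul_le_mul_of_nonneg_right hγD hy0)
        have h5 : 2 * D / c₀ * (k / n) * (c₀ * n / 2) ≤ 2 * D / c₀ * (k / n) * m :=
          mul_le_mul_of_nonneg_left hmn (by positivity)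
        have e2 : 2 * D / c₀ * (k / n) * (c₀ * n / 2) = n * (D * (k / n)) := by
          field_simp
        linarith
      linarith
    have h2 : A * (1 / √(u + 1)) ≤ A * (1 / √m) := by
      apply mul_le_mul_of_nonneg_left _ hA0.le
      exact one_div_le_one_div_of_le (Real.sqrt_pos.2 hm0) (Real.sqrt_le_sqrt hmw)
    have h3 : 8 / (m * √m) * (D * u * (k / n)) ≤ 16 * D / c₀ * (k / n) := by
      have hs1 : 1 ≤ √m := by rw [Real.one_le_sqrt]; exact hm1
      have h4 : 8 / (m * √m) ≤ 8 / (c₀ * n / 2) := by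
        apply div_le_div_of_nonneg_left (by norm_num) (by positivity)
        exact hmn.trans (le_mul_of_one_le_right hm0.le hs1)
      have h5 : D * u * (k / n) ≤ D * n * (k / n) := by
        have : u ≤ n := by rw [hu]; linarith
        gcongr
      calc 8 / (m * √m) * (D * u * (k / n)) ≤ 8 / (c₀ * n / 2) * (D * n * (k / n)) :=
            mul_le_mul h4 h5 (by positivity) (by positivity)
        _ = _ := by field_simp; ring
    have h4 : 1 / l * (18 * D / c₀ * (k / n)) ≤ (18 * D / c₀ + M) / l₀ * (k / n) := by
      rw [← mul_assoc, one_div_mul_eq_div]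
      apply mul_le_mul_of_nonneg_right _ hy0
      have h5 : 18 * D / c₀ ≤ 18 * D / c₀ + M := by linarith
      gcongr
    have h5 : 18 * D / c₀ * (k / n) = 2 * D / c₀ * (k / n) + 16 * D / c₀ * (k / n) := by ring
    have h6 : 1 / l * (Real.log (u + 1) + A * (1 / √(u + 1)) - 18 * D / c₀ * (k / n)) ≤
        1 / l * (Real.log m + A * (1 / √m) - 8 / (m * √m) * (D * u * (k / n))) :=
      mul_le_mul_of_nonneg_left (by linarith) (by positivity)
    linarith
  · intro I hhalf hkn
    have hhalf' : (n : ℝ) < 2 * (I.card : ℝ) := by exact_mod_cast hhalf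
    have hkn' : (I.card : ℝ) + 1 ≤ n := by exact_mod_cast hkn
    refine le_trans ?_ (key I hkn)
    rw [hSI]
    have hlowI := hlow I hkn
    have hθI := hθ _ hkn
    have hlo := h.lower _ hkn.le
    set k : ℝ := (I.card : ℝ)
    set u := (n : ℝ) - k with hu
    set t := θ I.card
    set m := u * t + 1 with hm
    set w := u + 1 with hw
    have hu1 : 1 ≤ u := by rw [hu]; linarith
    have hy0 : 1 / 2 ≤ k / n := by rw [le_div_iff₀ hn']; linarith
    have hy1 : k / n ≤ 1 := by rw [div_le_iff₀ hn']; linarith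
    have ht0 : 0 < t := hc₀0.trans_le hlowI
    have ht : c / 2 ≤ 1 - t := by nlinarith
    have ht1 : t ≤ 1 := by linarith
    have hm1 : 1 ≤ m := by
      have : 0 ≤ u * t := by positivity
      linarith
    have hm0 : 0 < m := by linarith
    have hw0 : 0 < w := by linarith
    -- Since u ≥ w/2 and t ≤ 1 - c/2, m ≤ w(1 - c/4); the square is there to be removed by the root.
    have hmw : m ≤ w * (1 - c / 8) ^ 2 := by nlinarith [sq_nonneg c]
    have hmt : w * t ≤ m := by rw [hw, hm]; linarith
    have h1 : Real.log w - l - M * (u / n) ≤ Real.log m := by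
      have h2 : Real.log (w * t) ≤ Real.log m := Real.log_le_log (by positivity) hmt
      rw [Real.log_mul hw0.ne' ht0.ne'] at h2
      have h3 := (Real.le_log_iff_exp_le ht0).2 hθI
      linarith
    have h2 : A * (1 / √w) + 8 * D / c₀ * (1 / √m) ≤ A * (1 / √m) := by
      have hs : √m ≤ √w * (1 - c / 8) := by
        have := Real.sqrt_le_sqrt hmw
        rwa [Real.sqrt_mul hw0.le, Real.sqrt_sq (by linarith)] at this
      have hsm := Real.sqrt_pos.2 hm0
      have hsw := Real.sqrt_pos.2 hw0
      have h3 : 1 / √w ≤ (1 - c / 8) * (1 / √m) := by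
        rw [mul_one_div, div_le_div_iff₀ hsw hsm]
        linarith
      have h4 := mul_le_mul_of_nonneg_left h3 hA0.le
      have e : 8 * D / c₀ = A * (c / 8) := by rw [hA]; field_simp; norm_num
      rw [e]
      linarith
    have h3 : 8 / (m * √m) * (D * u * (k / n)) ≤ 8 * D / c₀ * (1 / √m) := by
      have hsm := Real.sqrt_pos.2 hm0
      have h4 : D * u * (k / n) ≤ D * (m / c₀) := by
        rw [mul_assoc]
        apply mul_le_mul_of_nonneg_left _ hD.le
        have h5 : u * (k / n) ≤ u := mul_le_of_le_one_right (by linarith) hy1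
        refine h5.trans ?_
        rw [le_div_iff₀ hc₀0]
        have : u * c₀ ≤ u * t := mul_le_mul_of_nonneg_left hlowI (by linarith)
        linarith
      calc 8 / (m * √m) * (D * u * (k / n)) ≤ 8 / (m * √m) * (D * (m / c₀)) :=
            mul_le_mul_of_nonneg_left h4 (by positivity)
        _ = _ := by field_simp
    have h4 : 1 / l * (M * (u / n)) ≤ (18 * D / c₀ + M) / l₀ * (u / n) := by
      rw [← mul_assoc, one_div_mul_eq_div]
      apply mul_le_mul_of_nonneg_right _ (by positivity)
      have h5 : M ≤ 18 * D / c₀ + M := by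
        have : 0 ≤ 18 * D / c₀ := by positivity
        linarith
      gcongr
    have h6 : 1 / l * (Real.log w + A * (1 / √w) - l - M * (u / n)) ≤
        1 / l * (Real.log m + A * (1 / √m) - 8 / (m * √m) * (D * u * (k / n))) :=
      mul_le_mul_of_nonneg_left (by linarith) (by positivity)
    have h7 : 1 / l * (Real.log w + A * (1 / √w) - l - M * (u / n)) =
        1 / l * (Real.log w + A * (1 / √w)) - 1 - 1 / l * (M * (u / n)) := by
      field_simp
    linarith

end RoundBounds

/-! ### Doubly exponential shrinking -/

/-- Meant for a = log(n/y) and t = log(z/y): the right side is then (z/y - 1)/a, linear in z, so the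
mean of z can be inserted. Truncation at 2 keeps the outer logarithm away from its singularity. -/
theorem log_sub_log_max_le {a t : ℝ} (ha : 2 ≤ a) (h : 4 ≤ a ∨ 0 ≤ t) :
    Real.log a - Real.log (max (a - t) 2) ≤ (Real.exp t - 1) / a := by
  have ha0 : 0 < a := by linarith
  have key : ∀ t, 0 ≤ t → t ≤ a - 2 → Real.log a - Real.log (a - t) ≤ (Real.exp t - 1) / a := by
    intro t ht hta
    have hz : 0 < a - t := by linarith
    have h1 := Real.log_le_sub_one_of_pos (div_pos ha0 hz)
    rw [Real.log_div ha0.ne' hz.ne'] at h1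
    refine h1.trans ?_
    have e : a / (a - t) - 1 = t / (a - t) := by field_simp; ring
    rw [e, div_le_div_iff₀ hz ha0]
    have h2 := Real.quadratic_le_exp_of_nonneg ht
    nlinarith [mul_le_mul_of_nonneg_right h2 hz.le, mul_nonneg (sq_nonneg t) (sub_nonneg.2 hta)]
  rcases le_or_gt 0 t with ht | ht
  · rcases le_or_gt t (a - 2) with hta | hta
    · rw [max_eq_left (by linarith)]
      exact key t ht hta
    · rw [max_eq_right (by linarith)]
      have h1 := key (a - 2) (by linarith) le_rfl
      rw [sub_sub_cancel] at h1
      refine h1.trans (div_le_div_of_nonneg_right ?_ ha0.le)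
      have := Real.exp_le_exp.2 hta.le
      linarith
  · have ha4 : 4 ≤ a := h.resolve_right (not_le.2 ht)
    rw [max_eq_left (by linarith)]
    have hz : 0 < a - t := by linarith
    have h1 := Real.log_le_sub_one_of_pos (div_pos ha0 hz)
    rw [Real.log_div ha0.ne' hz.ne'] at h1
    refine h1.trans ?_
    have e : a / (a - t) - 1 = t / (a - t) := by field_simp; ring
    rw [e, div_le_div_iff₀ hz ha0]
    rcases le_or_gt (-2) t with h2 | h2
    · have h3 : (1 + t / 2) ^ 2 ≤ Real.exp t := by
        have h4 := Real.add_one_le_exp (t / 2)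
        calc (1 + t / 2) ^ 2 ≤ Real.exp (t / 2) ^ 2 := pow_le_pow_left₀ (by linarith) (by linarith) 2
          _ = Real.exp t := by rw [← Real.exp_nat_mul]; ring_nf
      have h4 : 0 ≤ t ^ 2 * (a / 4 - 1 - t / 4) := mul_nonneg (sq_nonneg t) (by linarith)
      nlinarith [mul_le_mul_of_nonneg_right h3 hz.le]
    · have h3 := Real.exp_pos t
      nlinarith [mul_pos h3 hz]

namespace RoundBounds

variable {n : ℕ} {P : Protocol n} {R : PMF (Fin n)} {θ : ℕ → ℝ} {c γ D : ℝ}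

theorem half_le_log_two : (1 : ℝ) / 2 ≤ Real.log 2 := by
  linarith [Real.log_two_gt_d9]

set_option maxHeartbeats 1000000 in
theorem expectedTime_le_of_pow (h : RoundBounds P R θ c γ D) (s : Fin n) (hn2 : 2 ≤ n) {ℓ : ℕ}
    (hℓ : 1 ≤ ℓ) (hθ : ∀ k < n, θ k ≤ (((n : ℝ) - k) / n) ^ ℓ) :
    expectedTime P s R ≤ ENNReal.ofReal (Real.log n / Real.log (1 + γ) +
      Real.log (Real.log n) / Real.log (1 + ℓ) +
      (2 * (1 + ℓ + Real.log 4) + (16 * (D + D ^ 2 + 1) * D / c ^ 2 / Real.log (1 + c) +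
        (4 * D / (c * Real.log (1 + c)) + 2 * Real.exp 2 / c)))) := by
  have hn' : (2 : ℝ) ≤ n := by exact_mod_cast hn2
  have hn0 : (0 : ℝ) < n := by linarith
  have hℓ' : (1 : ℝ) ≤ ℓ := by exact_mod_cast hℓ
  have hb2 : Real.log 2 ≤ Real.log (1 + ℓ) := Real.log_le_log (by norm_num) (by linarith)
  have hbh : 1 / 2 ≤ Real.log (1 + (ℓ : ℝ)) := half_le_log_two.trans hb2
  have hbℓ : Real.log (1 + (ℓ : ℝ)) ≤ ℓ := by
    have := Real.log_le_sub_one_of_pos (by linarith : (0 : ℝ) < 1 + ℓ)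
    linarith
  set b := Real.log (1 + (ℓ : ℝ)) with hbdef
  have hb : 0 < b := by linarith
  have hlogn : 1 / 2 ≤ Real.log n :=
    half_le_log_two.trans (Real.log_le_log (by norm_num) hn')
  set W := Real.log (max (Real.log n) 2) with hW
  set L : ℝ := 1 + ℓ with hL
  have hL0 : 0 < L := by linarith
  -- W makes S nonnegative, and L/b is the jump at extinction, up to the truncation at 2.
  let S : ℕ → ℝ := fun u => if u = 0 then 0 else
    1 / b * (L + W - Real.log (max (Real.log n - Real.log u) 2))
  have hmax : ∀ x : ℝ, 0 < max x 2 := fun x => lt_of_lt_of_le (by norm_num) (le_max_right _ _)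
  have hS0 : ∀ u, 0 ≤ S u := by
    intro u
    dsimp only [S]
    split_ifs
    · exact le_rfl
    · have h1 : Real.log (max (Real.log n - Real.log u) 2) ≤ W :=
        Real.log_le_log (hmax _) (max_le_max (by linarith [Real.log_natCast_nonneg u]) le_rfl)
      exact mul_nonneg (by positivity) (by linarith)
  have hmono : ∀ u v, u ≤ v → v ≤ n → S u ≤ S v := by
    intro u v huv _
    rcases Nat.eq_zero_or_pos u with hu | hu
    · rw [show S u = 0 from if_pos hu]; exact hS0 v
    · dsimp only [S]
      rw [if_neg hu.ne', if_neg (hu.trans_le huv).ne']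
      have h1 : Real.log (u : ℝ) ≤ Real.log v :=
        Real.log_le_log (by exact_mod_cast hu) (by exact_mod_cast huv)
      have h2 : Real.log (max (Real.log n - Real.log v) 2) ≤
          Real.log (max (Real.log n - Real.log u) 2) :=
        Real.log_le_log (hmax _) (max_le_max (by linarith) le_rfl)
      exact mul_le_mul_of_nonneg_left (by linarith) (by positivity)
  refine (h.expectedTime_le_of_shrink s (Real.exp_pos 2).le hS0 hmono ?_).trans
    (ENNReal.ofReal_le_ofReal ?_)
  · intro I _ hI
    have hk : (I.card : ℝ) + 1 ≤ n := by exact_mod_cast hI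
    have hu1 : (1 : ℝ) ≤ n - I.card := by linarith
    have hm := h.integral_sub_card I
    have hθ' := hθ _ hI
    have e1 : S (n - I.card) =
        1 / b * (L + W - Real.log (max (Real.log n - Real.log ((n : ℝ) - I.card)) 2)) := by
      dsimp only [S]
      rw [if_neg (by omega), cast_sub_card]
    have hSmono : ∫ a, S (n - (P I a).card) ∂(roundLaw R) ≤ S (n - I.card) := by
      have : ∫ a, S (n - (P I a).card) ∂(roundLaw R) ≤ ∫ a, S (n - I.card) ∂(roundLaw R) :=
        integral_mono Integrable.of_finite Integrable.of_finite fun a =>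
          hmono _ _ (Nat.sub_le_sub_left (Finset.card_le_card (h.subset I a)) n) (Nat.sub_le _ _)
      simpa using this
    set u : ℝ := n - I.card with hu
    have hu0 : 0 < u := by linarith
    set a₀ := Real.log n - Real.log u with ha₀
    have ha₀n : a₀ ≤ Real.log n := by
      have := Real.log_nonneg hu1
      linarith
    -- If log(n/u) < 2, the allowed error exp 2 · u/n exceeds 1, so monotonicity of S suffices.
    rcases lt_or_ge a₀ 2 with ha | ha
    · have h1 : 1 ≤ Real.exp 2 * (u / n) := by
        rw [← Real.log_nonneg_iff (by positivity), Real.log_mul (Real.exp_ne_zero _) (by positivity),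
          Real.log_exp, Real.log_div hu0.ne' hn0.ne']
        linarith
      linarith
    · rw [max_eq_left ha] at e1
      set y := u * (u / n) ^ ℓ with hy
      have hy0 : 0 < y := by positivity
      have hmy : ∫ a, ((n - (P I a).card : ℕ) : ℝ) ∂(roundLaw R) ≤ y := by
        rw [hm]; exact mul_le_mul_of_nonneg_left hθ' hu0.le
      have hlogy : Real.log y = Real.log n - L * a₀ := by
        rw [hy, Real.log_mul hu0.ne' (by positivity), Real.log_pow,
          Real.log_div hu0.ne' hn0.ne', hL, ha₀]
        ring
      have hloga : Real.log (L * a₀) = b + Real.log a₀ :=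
        Real.log_mul hL0.ne' (by linarith)
      have hWn : W = Real.log (Real.log n) := by rw [hW, max_eq_left (by linarith)]
      suffices key : b * ∫ a, S (n - (P I a).card) ∂(roundLaw R) ≤ L + W - Real.log (L * a₀) by
        have h1 : ∫ a, S (n - (P I a).card) ∂(roundLaw R) ≤ 1 / b * (L + W - Real.log (L * a₀)) := by
          rw [div_mul_eq_mul_div, one_mul, le_div_iff₀ hb]
          linarith
        have h2 : 1 / b * (L + W - Real.log (L * a₀)) = 1 / b * (L + W - Real.log a₀) - 1 := by
          rw [hloga]; field_simp; ring
        have h3 : 0 ≤ Real.exp 2 * (u / n) := by positivity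
        linarith
      rcases le_or_gt 1 y with hy1 | hy1
      · have haL : 4 ≤ L * a₀ := by
          have : 2 * a₀ ≤ L * a₀ := mul_le_mul_of_nonneg_right (by linarith) (by linarith)
          linarith
        have hp : ∀ a, b * S (n - (P I a).card) ≤ L + W - Real.log (L * a₀) - 1 / (L * a₀) +
            1 / (L * a₀) / y * ((n - (P I a).card : ℕ) : ℝ) := by
          intro a
          dsimp only [S]
          split_ifs with h0
          · rw [h0]
            have h1 : Real.log (L * a₀) ≤ W := by
              rw [hWn]
              apply Real.log_le_log (by linarith)
              have := Real.log_nonneg hy1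
              linarith
            have h2 : 1 / (L * a₀) ≤ 1 := by rw [div_le_one (by linarith)]; linarith
            simp only [mul_zero, Nat.cast_zero]
            linarith
          · have hz : (0 : ℝ) < ((n - (P I a).card : ℕ) : ℝ) := by
              exact_mod_cast Nat.pos_of_ne_zero h0
            set z : ℝ := ((n - (P I a).card : ℕ) : ℝ)
            have h1 := log_sub_log_max_le (a := L * a₀) (t := Real.log z - Real.log y)
              (by linarith) (Or.inl haL)
            rw [Real.exp_sub, Real.exp_log hz, Real.exp_log hy0] at h1
            have e2 : L * a₀ - (Real.log z - Real.log y) = Real.log n - Real.log z := by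
              rw [hlogy]; ring
            rw [e2] at h1
            have e3 : (z / y - 1) / (L * a₀) = 1 / (L * a₀) / y * z - 1 / (L * a₀) := by
              field_simp
            rw [← mul_assoc, mul_one_div_cancel hb.ne', one_mul]
            linarith
        have h1 := integral_mono (μ := roundLaw R) Integrable.of_finite Integrable.of_finite hp
        rw [integral_add Integrable.of_finite Integrable.of_finite, integral_const_mul,
          integral_const_mul] at h1
        simp only [integral_const, probReal_univ, one_smul] at h1
        have h2 := mul_le_mul_of_nonneg_left hmy (by positivity : 0 ≤ 1 / (L * a₀) / y)
        rw [div_mul_cancel₀ _ hy0.ne'] at h2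
        linarith
      · have hp : ∀ a, b * S (n - (P I a).card) ≤ L * ((n - (P I a).card : ℕ) : ℝ) := by
          intro a
          dsimp only [S]
          split_ifs with h0
          · simp [h0]
          · have hz : (1 : ℝ) ≤ ((n - (P I a).card : ℕ) : ℝ) := by
              exact_mod_cast Nat.pos_of_ne_zero h0
            set z : ℝ := ((n - (P I a).card : ℕ) : ℝ)
            have h1 := log_sub_log_max_le (a := Real.log n) (t := Real.log z)
              (by linarith) (Or.inr (Real.log_nonneg hz))
            rw [Real.exp_log (by linarith)] at h1
            have h2 : (z - 1) / Real.log n ≤ z - 1 :=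
              div_le_self (by linarith) (by linarith)
            rw [← mul_assoc, mul_one_div_cancel hb.ne', one_mul, hWn]
            have : L * 1 + (z - 1) ≤ L * z := by
              have := mul_le_mul_of_nonneg_right (by linarith : 1 ≤ L) (by linarith : 0 ≤ z - 1)
              linarith
            linarith
        have h1 := integral_mono (μ := roundLaw R) Integrable.of_finite Integrable.of_finite hp
        rw [integral_const_mul, integral_const_mul] at h1
        have h2 := mul_le_mul_of_nonneg_left hmy hL0.le
        set z := L * a₀ - Real.log n with hz
        have hz0 : 0 < z := by
          have := Real.log_neg hy0 hy1
          linarith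
        have hyz : y ≤ 1 / (1 + z) := by
          rw [← Real.exp_log hy0, hlogy, show Real.log n - L * a₀ = -z by rw [hz]; ring]
          exact exp_neg_le hz0.le
        set r := Real.log (L * a₀) - W with hr
        have hrb : r ≤ ℓ := by
          have : Real.log a₀ ≤ W := by
            rw [hWn]; exact Real.log_le_log (by linarith) ha₀n
          linarith
        have hrz : r ≤ z := by
          have h3 := Real.log_le_sub_one_of_pos
            (div_pos (by positivity : 0 < L * a₀) (by linarith : 0 < Real.log n))
          rw [Real.log_div (by positivity) (by linarith), ← hWn] at h3
          have h4 : L * a₀ / Real.log n - 1 = z / Real.log n := by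
            rw [hz]; field_simp
          have h5 : z / Real.log n ≤ z := div_le_self hz0.le (by linarith)
          linarith
        -- From r ≤ z and r ≤ ℓ follows r(1+z) ≤ (1+ℓ)z; this is where L = 1 + ℓ is needed.
        have h3 : r ≤ L * (1 - 1 / (1 + z)) := by
          have e : L * (1 - 1 / (1 + z)) = L * z / (1 + z) := by field_simp; ring
          rw [e, le_div_iff₀ (by linarith), hL]
          have := mul_le_mul_of_nonneg_right hrb hz0.le
          linarith
        have h4 := mul_le_mul_of_nonneg_left hyz hL0.le
        linarith
  · have h1 : S (n - 1) ≤ Real.log (Real.log n) / b + 2 * (1 + ℓ + Real.log 4) := by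
      have h2 : S (n - 1) ≤ S n := hmono _ _ (Nat.sub_le _ _) le_rfl
      have h3 : S n = 1 / b * (L + W - Real.log 2) := by
        dsimp only [S]
        rw [if_neg (by omega), sub_self, max_eq_right (by norm_num)]
      have h4 : W ≤ Real.log (Real.log n) + Real.log 4 := by
        rw [← Real.log_mul (by linarith) (by norm_num)]
        exact Real.log_le_log (hmax _) (max_le (by linarith) (by linarith))
      have h5 : 1 / b ≤ 2 := by rw [div_le_iff₀ hb]; linarith
      have h6 : 0 ≤ L + Real.log 4 := by
        have := Real.log_nonneg (by norm_num : (1 : ℝ) ≤ 4)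
        linarith
      have h7 : 1 / b * (L + W - Real.log 2) ≤
          1 / b * (Real.log (Real.log n) + (L + Real.log 4)) :=
        mul_le_mul_of_nonneg_left (by linarith [half_le_log_two]) (by positivity)
      have h8 := mul_le_mul_of_nonneg_right h5 h6
      have h9 : 1 / b * (Real.log (Real.log n) + (L + Real.log 4)) =
          Real.log (Real.log n) / b + 1 / b * (L + Real.log 4) := by ring
      linarith
    linarith

set_option maxHeartbeats 1000000 in
-- Chebyshev: the number of uninformed nodes falls below half its mean m with probability O(Var/m²),
-- and then the truncated potential loses at most (log M)/b. Otherwise log(n/u), suitably shifted,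
-- grows at most by the factor 1+ℓ. The truncation at M = log n / 4 stops the argument while m² is
-- still at least of order n^(3/2).
theorem le_expectedTime_of_pow (h : RoundBounds P R θ c γ D) (s : Fin n) {ℓ : ℕ} (hℓ : 1 ≤ ℓ)
    {c₀ a : ℝ} (hc₀ : 0 < c₀) (hc₀1 : c₀ ≤ 1)
    (ha : a = Real.log (2 / c₀) + (1 + ℓ) * Real.log 2) (hfin : expectedTime P s R ≠ ∞)
    (hθ : ∀ k < n, ℓ + k ≤ n → c₀ * (((n : ℝ) - k) / n) ^ ℓ ≤ θ k)
    (hn₁ : 2 * ℓ ≤ n) (hn₂ : ℓ ^ 2 ≤ n) (hn₃ : 8 * a ≤ Real.log n) :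
    Real.log n / Real.log (1 + γ) + Real.log (Real.log n) / Real.log (1 + ℓ) -
      (2 * (Real.log 4 + Real.log (2 * a)) +
      2 * (8 * D * 4 ^ (1 + ℓ) / c₀ ^ 2 + D / Real.log (1 + c)) / c) ≤
      (expectedTime P s R).toReal := by
  have hn2 : 2 ≤ n := by omega
  have hn' : (2 : ℝ) ≤ n := by exact_mod_cast hn2
  have hn0 : (0 : ℝ) < n := by linarith
  have hD := h.D_pos
  have hℓ' : (1 : ℝ) ≤ ℓ := by exact_mod_cast hℓ
  have hb2 : Real.log 2 ≤ Real.log (1 + ℓ) := Real.log_le_log (by norm_num) (by linarith)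
  have hbh : 1 / 2 ≤ Real.log (1 + (ℓ : ℝ)) := half_le_log_two.trans hb2
  have hl2 := half_le_log_two
  set b := Real.log (1 + (ℓ : ℝ)) with hbdef
  have hb : 0 < b := by linarith
  have h1b : 1 / b ≤ 2 := by rw [div_le_iff₀ hb]; linarith
  set p : ℝ := 1 + ℓ with hp
  set β := Real.log (2 / c₀) with hβ
  have hβ0 : 0 ≤ β := Real.log_nonneg (by rw [le_div_iff₀ hc₀]; linarith)
  have hβe : β = Real.log 2 - Real.log c₀ := Real.log_div (by norm_num) hc₀.ne'
  have ha1 : 2 * Real.log 2 ≤ a := by rw [ha]; nlinarith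
  have haβ : β + p * Real.log 2 ≤ a := ha.ge
  set M := Real.log n / 4 with hM
  have hMa : 2 * a ≤ M := by rw [hM]; linarith
  have hM1 : 1 ≤ M := by linarith
  have hlM : 0 ≤ Real.log M := Real.log_nonneg hM1
  -- The shift a absorbs the constants: β ≤ ℓ a turns an affine recursion into multiplication by
  -- 1+ℓ. The floor 2a makes F(m/2) ≤ F(u) throughout the growth phase, where log(n/u) ≤ log 2.
  let F : ℝ → ℝ := fun x => min (max (Real.log n - Real.log x + a) (2 * a)) M
  have hF2 : ∀ x, 2 * a ≤ F x := fun x => le_min (le_max_right _ _) hMa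
  have hFM : ∀ x, F x ≤ M := fun x => min_le_right _ _
  have hF0 : ∀ x, 0 < F x := fun x => lt_of_lt_of_le (by linarith) (hF2 x)
  have hFanti : ∀ x y, 0 < x → x ≤ y → F y ≤ F x := by
    intro x y hx hxy
    have := Real.log_le_log hx hxy
    exact min_le_min (max_le_max (by linarith) le_rfl) le_rfl
  let S : ℕ → ℝ := fun u => -(1 / b) * Real.log (F u)
  set E := 8 * D * 4 ^ (1 + ℓ) / c₀ ^ 2 with hEdef
  have hE : 0 ≤ E := by positivity
  have hmean : ∀ I : Finset (Fin n), I.card < n → ℓ + I.card ≤ n →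
      0 < ((n : ℝ) - I.card) * θ I.card ∧
      Real.log c₀ + Real.log n - p * (Real.log n - Real.log ((n : ℝ) - I.card)) ≤
        Real.log (((n : ℝ) - I.card) * θ I.card) := by
    intro I hI hIℓ
    have hk : (I.card : ℝ) + 1 ≤ n := by exact_mod_cast hI
    have h1 := hθ _ hI hIℓ
    set u : ℝ := n - I.card with hu
    have hu0 : 0 < u := by linarith
    have h2 : 0 < c₀ * (u / n) ^ ℓ := by positivity
    have h3 := mul_le_mul_of_nonneg_left h1 hu0.le
    refine ⟨mul_pos hu0 (h2.trans_le h1), le_trans (le_of_eq ?_) (Real.log_le_log (by positivity) h3)⟩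
    rw [Real.log_mul hu0.ne' h2.ne', Real.log_mul hc₀.ne' (by positivity), Real.log_pow,
      Real.log_div hu0.ne' hn0.ne', hp]
    ring
  have key : ∀ I : Finset (Fin n), I.card < n → ∀ m, m = ((n : ℝ) - I.card) * θ I.card → 0 < m →
      -(1 / b) * (Real.log (F (m / 2)) +
        4 * Real.log M / m ^ 2 * (D * (n - I.card) * (I.card / n))) ≤
        ∫ a, S (n - (P I a).card) ∂(roundLaw R) := by
    intro I _ m hm hm0
    have h1 := integral_le_of_quadratic (μ := roundLaw R) (h.integral_sub_card I)
      (f := fun a => Real.log (F ((n - (P I a).card : ℕ) : ℝ)))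
      (Real.log (F (m / 2))) 0 (4 * Real.log M / m ^ 2)
      (by
        intro a
        rw [← hm, zero_mul, add_zero]
        set x : ℝ := ((n - (P I a).card : ℕ) : ℝ)
        rcases le_or_gt (m / 2) x with hx | hx
        · have h2 : Real.log (F x) ≤ Real.log (F (m / 2)) :=
            Real.log_le_log (hF0 _) (hFanti _ _ (by linarith) hx)
          have h3 : 0 ≤ 4 * Real.log M / m ^ 2 * (x - m) ^ 2 := by positivity
          linarith
        · have h2 : Real.log (F x) ≤ Real.log M := Real.log_le_log (hF0 _) (hFM _)
          have h3 : 0 ≤ Real.log (F (m / 2)) :=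
            Real.log_nonneg (by linarith [hF2 (m / 2)])
          have h4 : (m / 2) ^ 2 ≤ (x - m) ^ 2 := by nlinarith
          have h5 := mul_le_mul_of_nonneg_left h4 (by positivity : 0 ≤ 4 * Real.log M / m ^ 2)
          have e : 4 * Real.log M / m ^ 2 * (m / 2) ^ 2 = Real.log M := by field_simp; ring
          linarith)
    have h2 := mul_le_mul_of_nonneg_left (h.variance_sub_card I)
      (by positivity : 0 ≤ 4 * Real.log M / m ^ 2)
    dsimp only [S]
    rw [integral_const_mul]
    exact mul_le_mul_of_nonpos_left (by linarith) (by
      have : 0 < 1 / b := by positivity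
      linarith)
  have hSI : ∀ I : Finset (Fin n), S (n - I.card) = -(1 / b) * Real.log (F ((n : ℝ) - I.card)) := by
    intro I
    dsimp only [S]
    rw [cast_sub_card]
  have hfinal := h.le_expectedTime_of_shrink s (S := S) hE hfin ?_ ?_
  · refine le_trans ?_ hfinal
    have e1 : ((n - 1 : ℕ) : ℝ) = n - 1 := by
      rw [Nat.cast_sub (by omega)]; simp
    have h1 : Real.log (F ((n - 1 : ℕ) : ℝ)) ≤ Real.log (2 * a) := by
      apply Real.log_le_log (hF0 _)
      refine (min_le_left _ _).trans (max_le ?_ le_rfl)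
      rw [e1]
      have h2 : Real.log n ≤ Real.log (2 * (n - 1)) := Real.log_le_log hn0 (by linarith)
      rw [Real.log_mul (by norm_num) (by linarith)] at h2
      linarith
    -- The convention log 0 = 0 gives the correct value at extinction, since log n + a already
    -- exceeds M.
    have h0 : F ((0 : ℕ) : ℝ) = M := by
      dsimp only [F]
      rw [Nat.cast_zero, Real.log_zero, sub_zero]
      exact min_eq_right (le_max_of_le_left (by rw [hM]; linarith))
    have h2 : Real.log M = Real.log (Real.log n) - Real.log 4 :=
      Real.log_div (by linarith) (by norm_num)
    have h3 : S (n - 1) - S 0 = 1 / b * (Real.log M - Real.log (F ((n - 1 : ℕ) : ℝ))) := by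
      dsimp only [S]
      rw [h0]; ring
    have h4 : 1 / b * (Real.log (Real.log n) - (Real.log 4 + Real.log (2 * a))) ≤
        1 / b * (Real.log M - Real.log (F ((n - 1 : ℕ) : ℝ))) :=
      mul_le_mul_of_nonneg_left (by linarith) (by positivity)
    have h5 : 0 ≤ Real.log 4 + Real.log (2 * a) :=
      add_nonneg (Real.log_nonneg (by norm_num)) (Real.log_nonneg (by linarith))
    have h6 := mul_le_mul_of_nonneg_right h1b h5
    have e2 : 1 / b * (Real.log (Real.log n) - (Real.log 4 + Real.log (2 * a))) =
        Real.log (Real.log n) / b - 1 / b * (Real.log 4 + Real.log (2 * a)) := by ring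
    linarith
  · intro I hI hhalf
    have hk : (1 : ℝ) ≤ I.card := by exact_mod_cast hI.card_pos
    have hkn : I.card < n := by have := hI.card_pos; omega
    have hhalf' : 2 * (I.card : ℝ) ≤ n := by exact_mod_cast hhalf
    obtain ⟨hm0, hlogm⟩ := hmean I hkn (by omega)
    refine le_trans ?_ (key I hkn _ rfl hm0)
    rw [hSI]
    have hθI := hθ _ hkn (by omega)
    set k : ℝ := (I.card : ℝ)
    set u : ℝ := (n : ℝ) - k with hu
    set m := u * θ I.card with hm
    have hu2 : n / 2 ≤ u := by rw [hu]; linarith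
    have hun : u ≤ n := by rw [hu]; linarith
    have hu0 : 0 < u := by linarith
    have hy0 : 0 ≤ k / n := by positivity
    have hLu : Real.log n - Real.log u ≤ Real.log 2 := by
      have h2 : Real.log n ≤ Real.log (2 * u) := Real.log_le_log hn0 (by linarith)
      rw [Real.log_mul (by norm_num) hu0.ne'] at h2
      linarith
    have h1 : Real.log (F (m / 2)) ≤ Real.log (F u) := by
      apply Real.log_le_log (hF0 _)
      refine le_trans ((min_le_left _ _).trans (max_le ?_ le_rfl)) (hF2 u)
      rw [Real.log_div hm0.ne' (by norm_num)]
      have := mul_le_mul_of_nonneg_left hLu (by linarith : 0 ≤ p)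
      linarith
    have h2 : 4 * Real.log M / m ^ 2 * (D * u * (k / n)) ≤ E / 2 * (k / n) := by
      have h3 : Real.log M ≤ n := by
        have h4 := Real.log_le_sub_one_of_pos (by linarith : 0 < M)
        have h5 := Real.log_le_sub_one_of_pos hn0
        rw [hM] at h4 ⊢
        linarith
      have h4 : c₀ * n / 2 ^ (1 + ℓ) ≤ m := by
        have h5 : c₀ * (1 / 2) ^ ℓ ≤ θ I.card := by
          refine le_trans ?_ hθI
          have : 1 / 2 ≤ u / n := by rw [le_div_iff₀ hn0]; linarith
          gcongr
        have h6 : n / 2 * (c₀ * (1 / 2) ^ ℓ) ≤ u * θ I.card :=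
          mul_le_mul hu2 h5 (by positivity) hu0.le
        refine le_trans (le_of_eq ?_) h6
        rw [one_div, inv_pow, pow_add, pow_one]
        field_simp
      have h5 : (c₀ * n / 2 ^ (1 + ℓ)) ^ 2 ≤ m ^ 2 := pow_le_pow_left₀ (by positivity) h4 2
      calc 4 * Real.log M / m ^ 2 * (D * u * (k / n))
          ≤ 4 * n / (c₀ * n / 2 ^ (1 + ℓ)) ^ 2 * (D * n * (k / n)) := by gcongr
        _ = E / 2 * (k / n) := by
            rw [hEdef, show (4 : ℝ) = 2 ^ 2 by norm_num, ← pow_mul, mul_comm 2 (1 + ℓ), pow_mul]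
            field_simp
            norm_num
    have h3 : 1 / b * (E / 2 * (k / n)) ≤ E * (k / n) := by
      have := mul_le_mul_of_nonneg_right h1b (by positivity : 0 ≤ E / 2 * (k / n))
      linarith
    have h4 := mul_le_mul_of_nonneg_left (add_le_add h1 h2) (by positivity : 0 ≤ 1 / b)
    linarith
  · intro I hhalf hkn
    have hhalf' : (n : ℝ) < 2 * (I.card : ℝ) := by exact_mod_cast hhalf
    have hkn' : (I.card : ℝ) + 1 ≤ n := by exact_mod_cast hkn
    have huE : 0 ≤ E * (((n : ℝ) - I.card) / n) :=
      mul_nonneg hE (div_nonneg (by linarith) hn0.le)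
    -- If (1+ℓ) F(u) reaches the cap M, no outcome can lower S by more than 1. Otherwise u is large
    -- enough for the Chebyshev argument.
    rcases le_or_gt M (p * F ((n : ℝ) - I.card)) with hcase | hcase
    · have h1 : ∀ a, S (n - I.card) - 1 ≤ S (n - (P I a).card) := by
        intro a
        rw [hSI]
        dsimp only [S]
        have h2 : Real.log (F ((n - (P I a).card : ℕ) : ℝ)) ≤ b + Real.log (F ((n : ℝ) - I.card)) := by
          rw [hbdef, ← Real.log_mul (by linarith) (hF0 _).ne']
          exact Real.log_le_log (hF0 _) ((hFM _).trans hcase)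
        have h3 := mul_le_mul_of_nonneg_left h2 (by positivity : 0 ≤ 1 / b)
        have e : 1 / b * (b + Real.log (F ((n : ℝ) - I.card))) =
            1 + 1 / b * Real.log (F ((n : ℝ) - I.card)) := by field_simp
        linarith
      have h2 : ∫ _, (S (n - I.card) - 1) ∂(roundLaw R) ≤
          ∫ a, S (n - (P I a).card) ∂(roundLaw R) :=
        integral_mono Integrable.of_finite Integrable.of_finite h1
      simp only [integral_const, probReal_univ, one_smul] at h2
      linarith
    · have hu0' : (0 : ℝ) < n - I.card := by linarith
      have hFu : F ((n : ℝ) - I.card) = max (Real.log n - Real.log ((n : ℝ) - I.card) + a) (2 * a) := by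
        apply min_eq_left
        by_contra hcon
        have h1 : F ((n : ℝ) - I.card) = M := min_eq_right (not_le.1 hcon).le
        rw [h1] at hcase
        have : M ≤ p * M := le_mul_of_one_le_left (by linarith) (by linarith)
        linarith
      have hpL : p * (Real.log n - Real.log ((n : ℝ) - I.card) + a) < M := by
        refine lt_of_le_of_lt (mul_le_mul_of_nonneg_left ?_ (by linarith)) hcase
        rw [hFu]; exact le_max_left _ _
      have hLpos : 0 ≤ Real.log n - Real.log ((n : ℝ) - I.card) := by
        have := Real.log_le_log hu0' (by linarith [(Nat.cast_nonneg I.card : (0 : ℝ) ≤ I.card)] :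
          (n : ℝ) - I.card ≤ n)
        linarith
      have hIℓ : ℓ + I.card ≤ n := by
        have h1 : Real.log n / 2 ≤ Real.log ((n : ℝ) - I.card) := by
          have : Real.log n - Real.log ((n : ℝ) - I.card) + a ≤
              p * (Real.log n - Real.log ((n : ℝ) - I.card) + a) :=
            le_mul_of_one_le_left (by linarith) (by linarith)
          linarith
        have h2 : 2 * Real.log (ℓ : ℝ) ≤ Real.log n := by
          have : Real.log ((ℓ : ℝ) ^ 2) ≤ Real.log n :=
            Real.log_le_log (by positivity) (by exact_mod_cast hn₂)
          rw [Real.log_pow] at this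
          exact_mod_cast this
        have h3 : (ℓ : ℝ) ≤ n - I.card :=
          (Real.log_le_log_iff (by linarith) hu0').1 (by linarith)
        have : (ℓ : ℝ) + I.card ≤ n := by linarith
        exact_mod_cast this
      obtain ⟨hm0, hlogm⟩ := hmean I hkn hIℓ
      refine le_trans ?_ (key I hkn _ rfl hm0)
      rw [hSI]
      set k : ℝ := (I.card : ℝ)
      set u : ℝ := (n : ℝ) - k with hu
      set m := u * θ I.card with hm
      have hy1 : k / n ≤ 1 := by rw [div_le_iff₀ hn0]; linarith
      have hy0 : 0 ≤ k / n := by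
        have : 0 ≤ k := by linarith
        positivity
      have h1 : Real.log (F (m / 2)) ≤ b + Real.log (F u) := by
        rw [hbdef, ← Real.log_mul (by linarith) (hF0 _).ne']
        apply Real.log_le_log (hF0 _)
        refine (min_le_left _ _).trans (max_le ?_ ?_)
        · rw [Real.log_div hm0.ne' (by norm_num)]
          have h2 : p * (Real.log n - Real.log u + a) ≤ p * F u := by
            apply mul_le_mul_of_nonneg_left _ (by linarith)
            rw [hFu]; exact le_max_left _ _
          have h3 : β ≤ ℓ * a := by
            have := le_mul_of_one_le_left (by linarith : 0 ≤ a) hℓ'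
            linarith [mul_nonneg (by linarith : 0 ≤ p) (by linarith : 0 ≤ Real.log 2)]
          have h4 : p * (Real.log n - Real.log u + a) =
            p * (Real.log n - Real.log u) + a + ℓ * a := by rw [hp]; ring
          linarith
        · exact (hF2 u).trans (le_mul_of_one_le_left (hF0 u).le (by linarith))
      have h2 : 4 * Real.log M / m ^ 2 * (D * u * (k / n)) ≤ E / 2 * (u / n) := by
        have hs := Real.sqrt_pos.2 hn0
        have h3 : Real.log M ≤ √n := by
          have h4 := Real.log_le_sub_one_of_pos (by linarith : 0 < M)
          have h5 := Real.log_le_sub_one_of_pos hs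
          rw [Real.log_sqrt hn0.le] at h5
          rw [hM] at h4 ⊢
          linarith
        -- Below the cap, (1+ℓ) log(n/u) ≤ (log n)/4, hence m ≥ c₀ n^(3/4). Together with log M ≤ √n
        -- the loss is O(u/n).
        have h4 : c₀ ^ 2 * (n * √n) ≤ m ^ 2 := by
          rw [← Real.log_le_log_iff (by positivity) (by positivity),
            Real.log_mul (by positivity) (by positivity), Real.log_mul hn0.ne' hs.ne',
            Real.log_pow, Real.log_pow, Real.log_sqrt hn0.le]
          have h5 : p * (Real.log n - Real.log u) ≤ Real.log n / 4 := by
            have : p * (Real.log n - Real.log u) ≤ p * (Real.log n - Real.log u + a) :=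
              mul_le_mul_of_nonneg_left (by linarith) (by linarith)
            linarith
          push_cast
          linarith
        have h5 : (1 : ℝ) ≤ 4 ^ (1 + ℓ) := one_le_pow₀ (by norm_num)
        calc 4 * Real.log M / m ^ 2 * (D * u * (k / n))
            ≤ 4 * √n / (c₀ ^ 2 * (n * √n)) * (D * u * 1) := by gcongr
          _ = 4 * D * 1 / c₀ ^ 2 * (u / n) := by field_simp
          _ ≤ 4 * D * 4 ^ (1 + ℓ) / c₀ ^ 2 * (u / n) := by gcongr
          _ = E / 2 * (u / n) := by rw [hEdef]; ring
      have h3 : 1 / b * (E / 2 * (u / n)) ≤ E * (u / n) := by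
        have := mul_le_mul_of_nonneg_right h1b (by positivity : 0 ≤ E / 2 * (u / n))
        linarith
      have h4 := mul_le_mul_of_nonneg_left (add_le_add h1 h2) (by positivity : 0 ≤ 1 / b)
      have e : 1 / b * (b + Real.log (F u) + E / 2 * (u / n)) =
          1 + 1 / b * Real.log (F u) + 1 / b * (E / 2 * (u / n)) := by field_simp
      linarith

end RoundBounds

/-! ### Uniform constants and the theorem -/

variable {n : ℕ} {P : Protocol n} {s : Fin n} {R : PMF (Fin n)}

theorem ExpectedTimeWithin.mono {x K K' : ℝ} (h : ExpectedTimeWithin P s R x K) (hK : K ≤ K') :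
    ExpectedTimeWithin P s R x K' :=
  ⟨h.1, h.2.trans hK⟩

theorem expectedTimeWithin_of_le {x K₁ K₂ : ℝ} (hx : 0 ≤ x + K₁)
    (h₁ : expectedTime P s R ≤ ENNReal.ofReal (x + K₁))
    (h₂ : expectedTime P s R ≠ ∞ → x - K₂ ≤ (expectedTime P s R).toReal) :
    ExpectedTimeWithin P s R x (|K₁| + |K₂|) := by
  have hfin : expectedTime P s R ≠ ∞ := ne_top_of_le_ne_top ENNReal.ofReal_ne_top h₁
  refine ⟨hfin, abs_le.2 ⟨?_, ?_⟩⟩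
  · linarith [h₂ hfin, le_abs_self K₂, abs_nonneg K₁]
  · linarith [ENNReal.toReal_le_of_le_ofReal hx h₁, le_abs_self K₁, abs_nonneg K₂]

/-- The constant in the upper bound for the time of the exponential growth phase. -/
noncomputable def growthConst (c D E : ℝ) : ℝ :=
  16 * (D + D ^ 2 + 1) * D / c ^ 2 / Real.log (1 + c) +
    (4 * D / (c * Real.log (1 + c)) + 2 * E / c)

/-- The error term if the number of uninformed nodes finally shrinks by a constant factor. -/
noncomputable def expConst (c D l₀ Λ M : ℝ) : ℝ :=
  |Real.exp Λ / l₀ + growthConst c D (M / l₀)| +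
    |64 * D / (Real.exp (-Λ - M) * c) / l₀ +
      2 * ((18 * D / Real.exp (-Λ - M) + M) / l₀ + D / Real.log (1 + c)) / c|

theorem RoundBounds.expectedTimeWithin_of_exp {θ : ℕ → ℝ} {c γ D : ℝ}
    (h : RoundBounds P R θ c γ D) {l l₀ Λ M : ℝ}
    (hl₀ : 0 < l₀) (hl : l₀ ≤ l) (hΛ : l ≤ Λ) (hM : 0 ≤ M)
    (hθ₁ : ∀ k < n, θ k ≤ Real.exp (-l + M * (((n : ℝ) - k) / n)))
    (hθ₂ : ∀ k < n, Real.exp (-l - M * (((n : ℝ) - k) / n)) ≤ θ k) :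
    ExpectedTimeWithin P s R (Real.logb (1 + γ) n + 1 / l * Real.log n)
      (expConst c D l₀ Λ M) := by
  apply expectedTimeWithin_of_le
  · have hG := h.log_pos
    have hD := h.D_pos
    have hc := h.c_pos
    have hlog := Real.log_natCast_nonneg n
    have hl' : 0 < l := hl₀.trans_le hl
    have h1 : 0 ≤ Real.logb (1 + γ) n := div_nonneg hlog (hG.trans_le h.log_le).le
    unfold growthConst
    positivity
  · exact h.expectedTime_le_of_exp s hl₀ hl hΛ hM hθ₁
  · exact fun hfin => h.le_expectedTime_of_exp s hl₀ hl hΛ hM hfin hθ₂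

theorem exists_expectedTimeWithin_push (c C V : ℝ) (hc : 0 < c) :
    ∃ K : ℝ, ∀ (n : ℕ) (R : PMF (Fin n)) (s : Fin n), c ≤ mean R → mean R ≤ C → var R ≤ V →
      ExpectedTimeWithin (push n) s R
        (Real.logb (1 + mean R) n + 1 / mean R * Real.log n) K := by
  refine ⟨expConst (c / (1 + c)) (V + 3 * C ^ 2 + 2 * C) c C (C + C ^ 2 * (1 + C)),
    fun n R s hm hC hV => ?_⟩
  have hC0 : 0 < C := hc.trans_le (hm.trans hC)
  have h := spreads_push.roundBounds (P := push n) hc hm hC hV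
  rw [show rate False R = mean R from if_neg not_false] at h
  have hx : ∀ k < n, 0 ≤ ((n : ℝ) - k) / n := fun k hk =>
    div_nonneg (by have : (k : ℝ) ≤ n := by exact_mod_cast hk.le
                   linarith) (Nat.cast_nonneg n)
  have hM : 0 ≤ C ^ 2 * (1 + C) := by positivity
  refine h.expectedTimeWithin_of_exp (M := C + C ^ 2 * (1 + C)) hc hm hC (by positivity) ?_ ?_
  · intro k hk
    refine (stay_false_le R s.pos k hC hk.le).trans (Real.exp_le_exp.2 ?_)
    linarith [mul_nonneg hM (hx k hk)]
  · intro k hk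
    refine le_trans (Real.exp_le_exp.2 ?_) (le_stay_false R s.pos hk hC)
    linarith [mul_nonneg hC0.le (hx k hk)]

theorem weight_le_one (r : Fin n) : (R r).toReal ≤ 1 :=
  ENNReal.toReal_le_of_le_ofReal zero_le_one (by simpa using R.coe_le_one r)

theorem exists_expectedTimeWithin_pushPull_zero (c C V q : ℝ) (hc : 0 < c) (hq : 0 < q) :
    ∃ K : ℝ, ∀ (n : ℕ) (R : PMF (Fin n)) (s ℓ : Fin n), c ≤ mean R → mean R ≤ C → var R ≤ V →
      q ≤ (R ℓ).toReal → (ℓ : ℕ) = 0 →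
      ExpectedTimeWithin (pushPull n) s R (Real.logb (1 + 2 * mean R) n +
        1 / (mean R - Real.log (R ℓ).toReal) * Real.log n) K := by
  refine ⟨expConst (c / (1 + c)) (V + 3 * C ^ 2 + 2 * C) c (C - Real.log q)
    ((C + 1 / q) + C ^ 2 * (1 + C)), fun n R s ℓ hm hC hV hqR hℓ => ?_⟩
  have hC0 : 0 < C := hc.trans_le (hm.trans hC)
  have h := spreads_pushPull.roundBounds (P := pushPull n) hc hm hC hV
  rw [show rate True R = 2 * mean R from if_pos trivial] at h
  have hx : ∀ k < n, 0 ≤ ((n : ℝ) - k) / n := fun k hk =>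
    div_nonneg (by have : (k : ℝ) ≤ n := by exact_mod_cast hk.le
                   linarith) (Nat.cast_nonneg n)
  have hM : 0 ≤ C ^ 2 * (1 + C) := by positivity
  have hp := hq.trans_le hqR
  have hp1 : Real.log (R ℓ).toReal ≤ 0 := Real.log_nonpos hp.le (weight_le_one ℓ)
  have hpq : Real.log q ≤ Real.log (R ℓ).toReal := Real.log_le_log hq hqR
  refine h.expectedTimeWithin_of_exp (M := (C + 1 / q) + C ^ 2 * (1 + C)) (Λ := C - Real.log q)
    hc (by linarith) (by linarith) (by positivity) ?_ ?_
  · intro k hk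
    refine (stay_true_le R hℓ hk.le hC hq hqR).trans (Real.exp_le_exp.2 ?_)
    linarith [mul_nonneg hM (hx k hk)]
  · intro k hk
    refine le_trans (Real.exp_le_exp.2 ?_) (le_stay_true R hℓ hk hC hp)
    linarith [mul_nonneg (by positivity : 0 ≤ C + 1 / q) (hx k hk)]

/-- The lower bound needs n large in terms of j and the constants. If log n ≤ B, the claimed main
term is itself bounded above, and E[T] ≥ 0 suffices. -/
theorem exists_expectedTimeWithin_pushPull_succ (c C V q : ℝ) (hc : 0 < c) (hq : 0 < q) (j : ℕ)
    (hj : 1 ≤ j) :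
    ∃ K : ℝ, ∀ (n : ℕ) (R : PMF (Fin n)) (s ℓ : Fin n), c ≤ mean R → mean R ≤ C → var R ≤ V →
      IsLeast R.support ℓ → q ≤ (R ℓ).toReal → (ℓ : ℕ) = j →
      ExpectedTimeWithin (pushPull n) s R (Real.logb (1 + 2 * mean R) n +
        Real.logb (1 + j) (Real.log n)) K := by
  set c₁ := c / (1 + c) with hc₁
  set D := V + 3 * C ^ 2 + 2 * C with hD
  set c₀ := Real.exp (-C - C ^ 2 * (1 + C)) * q / (j : ℝ) ^ j with hc₀
  set a := Real.log (2 / c₀) + (1 + j) * Real.log 2 with ha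
  set B := 8 * |a| + 2 * Real.log (2 * j) with hB
  set K₂ := 2 * (Real.log 4 + Real.log (2 * a)) +
      2 * (8 * D * 4 ^ (1 + j) / c₀ ^ 2 + D / Real.log (1 + c₁)) / c₁ with hK₂
  refine ⟨|2 * (1 + j + Real.log 4) + growthConst c₁ D (Real.exp 2)| +
    |(|K₂| + (B / Real.log (1 + c₁) + 2 * B))|, fun n R s ℓ hm hC hV hℓ hqR hℓj => ?_⟩
  have hj' : (1 : ℝ) ≤ j := by exact_mod_cast hj
  have hC0 : 0 < C := hc.trans_le (hm.trans hC)
  have h := spreads_pushPull.roundBounds (P := pushPull n) hc hm hC hV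
  rw [show rate True R = 2 * mean R from if_pos trivial, ← hD, ← hc₁] at h
  have hn2 := two_le_of_mean_pos R (hc.trans_le hm)
  have hn2' : (2 : ℝ) ≤ n := by exact_mod_cast hn2
  have hn0 : (0 : ℝ) < n := by linarith
  have hl2 := RoundBounds.half_le_log_two
  have hlogn : 1 / 2 ≤ Real.log n := hl2.trans (Real.log_le_log (by norm_num) hn2')
  have hb : 1 / 2 ≤ Real.log (1 + (j : ℝ)) :=
    hl2.trans (Real.log_le_log (by norm_num) (by linarith))
  have hb0 : 0 < Real.log (1 + (j : ℝ)) := by linarith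
  have hG := h.log_pos
  have hγ := hG.trans_le h.log_le
  have hc₀0 : 0 < c₀ := by positivity
  have hq1 : q ≤ 1 := hqR.trans (weight_le_one ℓ)
  have hc₀1 : c₀ ≤ 1 := by
    rw [hc₀]
    apply div_le_one_of_le₀ _ (by positivity)
    have h1 : Real.exp (-C - C ^ 2 * (1 + C)) ≤ 1 := Real.exp_le_one_iff.2 (by
      have : 0 ≤ C ^ 2 * (1 + C) := by positivity
      linarith)
    have h2 : (1 : ℝ) ≤ (j : ℝ) ^ j := one_le_pow₀ hj'
    exact (mul_le_one₀ h1 hq.le hq1).trans h2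
  have hDpos := h.D_pos
  have hcpos := h.c_pos
  apply expectedTimeWithin_of_le
  · have h1 : 0 ≤ Real.logb (1 + 2 * mean R) n := div_nonneg (by linarith) hγ.le
    have h2 : -2 ≤ Real.logb (1 + j) (Real.log n) := by
      rw [Real.logb, le_div_iff₀ hb0]
      have h3 := Real.one_sub_inv_le_log_of_pos (by linarith : 0 < Real.log n)
      have h4 : (Real.log n)⁻¹ ≤ 2 := by
        rw [inv_le_comm₀ (by linarith) (by norm_num)]; linarith
      linarith
    have h3 : 0 ≤ growthConst c₁ D (Real.exp 2) := by
      unfold growthConst; positivity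
    have h4 := Real.log_nonneg (by norm_num : (1 : ℝ) ≤ 4)
    linarith
  · refine h.expectedTime_le_of_pow s hn2 hj ?_
    intro k hk
    have := stay_true_le_pow R hℓ hk.le
    rwa [hℓj] at this
  · intro hfin
    have hlj : 0 ≤ Real.log (2 * (j : ℝ)) := Real.log_nonneg (by linarith)
    have hB0 : 0 ≤ B := by positivity
    rcases le_or_gt (Real.log n) B with hsmall | hlarge
    · have h1 : Real.logb (1 + 2 * mean R) n ≤ B / Real.log (1 + c₁) :=
        div_le_div₀ hB0 hsmall hG h.log_le
      have h2 : Real.logb (1 + j) (Real.log n) ≤ 2 * B := by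
        rw [Real.logb, div_le_iff₀ hb0]
        have h3 := Real.log_le_sub_one_of_pos (by linarith : 0 < Real.log n)
        have h4 := mul_le_mul_of_nonneg_left hb hB0
        linarith
      have h3 : 0 ≤ (expectedTime (pushPull n) s R).toReal := ENNReal.toReal_nonneg
      linarith [abs_nonneg K₂]
    · have hj1 : (2 * (j : ℝ)) ^ 2 ≤ n := by
        rw [← Real.log_le_log_iff (by positivity) hn0, Real.log_pow]
        push_cast
        linarith [abs_nonneg a]
      have hj2 : j ^ 2 ≤ n := by
        have : (j : ℝ) ^ 2 ≤ n := by nlinarith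
        exact_mod_cast this
      have hj3 : 2 * j ≤ n := by
        have : 2 * (j : ℝ) ≤ n := by nlinarith
        exact_mod_cast this
      have h1 := h.le_expectedTime_of_pow s hj hc₀0 hc₀1 ha hfin (fun k hk hkj => by
        have := pow_le_stay_true R (by omega : 1 ≤ (ℓ : ℕ)) hk (by omega) hC hq hqR
        rwa [hℓj] at this) hj3 hj2 (by linarith [le_abs_self a])
      have h2 : 0 ≤ B / Real.log (1 + c₁) := by positivity
      have h3 := le_abs_self K₂
      have h4 : Real.logb (1 + 2 * mean R) n + Real.logb (1 + j) (Real.log n) - K₂ ≤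
        (expectedTime (pushPull n) s R).toReal := h1
      linarith

theorem le_mean {ℓ : Fin n} (hℓ : IsLeast R.support ℓ) : ((ℓ : ℕ) : ℝ) ≤ mean R := by
  rw [mean_eq_sum, ← one_mul ((ℓ : ℕ) : ℝ), ← sum_weights R, Finset.sum_mul]
  apply Finset.sum_le_sum
  intro r _
  rcases lt_or_ge r ℓ with h | h
  · simp [weight_eq_zero R hℓ h]
  · exact mul_le_mul_of_nonneg_left (by exact_mod_cast h) ENNReal.toReal_nonneg

end RumorSpreading

theorem mainTheorem9 (c C V : ℝ) (hc : 0 < c) :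
    (∃ K : ℝ, ∀ (n : ℕ) (R : PMF (Fin n)) (s : Fin n),
      c ≤ RumorSpreading.mean R → RumorSpreading.mean R ≤ C → RumorSpreading.var R ≤ V →
      RumorSpreading.ExpectedTimeWithin (RumorSpreading.push n) s R
        (Real.logb (1 + RumorSpreading.mean R) n + 1 / RumorSpreading.mean R * Real.log n) K) ∧
    (∀ q : ℝ, 0 < q → ∃ K : ℝ, ∀ (n : ℕ) (R : PMF (Fin n)) (s ℓ : Fin n),
      c ≤ RumorSpreading.mean R → RumorSpreading.mean R ≤ C → RumorSpreading.var R ≤ V →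
      IsLeast R.support ℓ → q ≤ (R ℓ).toReal →
      ((ℓ : ℕ) = 0 →
        RumorSpreading.ExpectedTimeWithin (RumorSpreading.pushPull n) s R
          (Real.logb (1 + 2 * RumorSpreading.mean R) n +
            1 / (RumorSpreading.mean R - Real.log (R ℓ).toReal) * Real.log n) K) ∧
      (0 < (ℓ : ℕ) →
        RumorSpreading.ExpectedTimeWithin (RumorSpreading.pushPull n) s R
          (Real.logb (1 + 2 * RumorSpreading.mean R) n +
            Real.logb (1 + (ℓ : ℕ)) (Real.log n)) K)) := by
  refine ⟨RumorSpreading.exists_expectedTimeWithin_push c C V hc, fun q hq => ?_⟩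
  obtain ⟨K₀, hK₀⟩ := RumorSpreading.exists_expectedTimeWithin_pushPull_zero c C V q hc hq
  choose K hK using fun j : ℕ =>
    RumorSpreading.exists_expectedTimeWithin_pushPull_succ c C V q hc hq (j + 1) (by omega)
  -- Since ℓ ≤ E[R] ≤ C, only finitely many ℓ occur and their constants can be added; `K j` belongs
  -- to ℓ = j + 1.
  refine ⟨|K₀| + ∑ j ∈ Finset.range (⌊C⌋₊ + 1), |K j|, fun n R s ℓ hm hC hV hℓ hqR =>
    ⟨fun h0 => ?_, fun hpos => ?_⟩⟩
  · refine (hK₀ n R s ℓ hm hC hV hqR h0).mono ?_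
    have := Finset.sum_nonneg fun j (_ : j ∈ Finset.range (⌊C⌋₊ + 1)) => abs_nonneg (K j)
    linarith [le_abs_self K₀]
  · obtain ⟨j, hj⟩ : ∃ j, (ℓ : ℕ) = j + 1 := ⟨(ℓ : ℕ) - 1, by omega⟩
    have h1 := hK j n R s ℓ hm hC hV hℓ hqR hj
    rw [← hj] at h1
    refine h1.mono ?_
    have h2 : (ℓ : ℕ) ≤ ⌊C⌋₊ := Nat.le_floor ((RumorSpreading.le_mean hℓ).trans hC)
    have h3 := Finset.single_le_sum (f := fun j => |K j|) (fun j _ => abs_nonneg (K j))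
      (Finset.mem_range.2 (by omega : j < ⌊C⌋₊ + 1))
    linarith [le_abs_self (K j), abs_nonneg K₀]
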